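/- Let $\mathcal Q$ be a finite bipartite quiver with vertex set $I=I_0\sqcup I_1$, where the vertices in $I_0$ are sinks and those in $I_1$ are sources, and let $\Omega$ be its set of arrows, $h:s(h)\to t(h)$ with $s(h)\in I_1$, $t(h)\in I_0$. Let $w=(w_i,w_i')_{i\in I}$ and $v=(v_i)_{i\in I}$ be vectors of nonnegative integers, and put $W_i=\mathbb C^{w_i}$, $W_i'=\mathbb C^{w_i'}$. Let $$\mathbf E_w=\bigoplus_{\alpha\in I_0}\mathrm{Hom}(W'_\alpha,W_\alpha)\oplus\bigoplus_{\beta\in I_1}\mathrm{Hom}(W_\beta,W'_\beta)\oplus\bigoplus_{h\in\Omega}\mathrm{Hom}(W_{s(h)},W_{t(h)}),$$ with elements $(x_i,y_h)$. For $\alpha\in I_0$ let $A_\alpha: W'_\alpha\oplus\bigoplus_{t(h)=\alpha}W_{s(h)}\to W_\alpha$, $(a,(b_h))\mapsto x_\alpha(a)+\sum_h y_h(b_h)$; for $\beta\in I_1$ let $A_\beta: W_\beta\to W'_\beta\oplus\bigoplus_{s(h)=\beta}W_{t(h)}$, $b\mapsto (x_\beta(b),(y_h(b))_h)$. Define the varieties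 $$\mathbf E_{v,w}=\{\mathrm{rank}\,A_i\le v_i\ \forall i\}\subseteq \mathbf E_w,\qquad \mathbf E^\circ_{v,w}=\{\mathrm{rank}\,A_i=v_i\ \forall i\}\subseteq\mathbf E_w ,$$ $$\mathcal F_{v,w}=\{(X_i)_{i\in I}: \dim X_i=v_i,\ X_\alpha\subseteq W_\alpha\ (\alpha\in I_0),\ X_\beta\subseteq W'_\beta\oplus\textstyle\bigoplus_{s(h)=\beta}X_{t(h)}\ (\beta\in I_1)\},$$ a subvariety of $\prod_{\alpha} Gr(v_\alpha,W_\alpha)\times\prod_\beta Gr(v_\beta,W'_\beta\oplus\bigoplus_{s(h)=\beta}W_{t(h)})$, and $$\tilde{\mathcal F}_{v,w}=\{(x_i,y_h,X_i): (x_i,y_h)\in\mathbf E_w,\ (X_i)\in\mathcal F_{v,w},\ \mathrm{im}\,A_i\subseteq X_i\ \forall i\},$$ with the projection $\pi:\tilde{\mathcal F}_{v,w}\to\mathbf E_{v,w}$, $(x_i,y_h,X_i)\mapsto(x_i,y_h)$. Call $(v,w)$ $l$-dominant if $w_i\ge v_i$ and $w'_i\ge v_i-\sum_{h:i-j}v_j$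 for all $i\in I$, where $h:i-j$ runs over all arrows with one endpoint $i$ and $j$ is the other endpoint. Let $\bar v_i=\min\big(v_i,w_i,w'_i+\sum_{h:i-j}\min(v_j,w_j)\big)$; the vector $\bar v$ is the largest $v'\le v$ such that $(v',w)$ is $l$-dominant. (Here $\le$ is componentwise.) (a) $\mathbf E_{v,w}=\mathbf E_{\bar v,w}$ is irreducible. Moreover $\mathbf E^\circ_{\bar v,w}$ is its largest stratum: it is nonempty and open in $\mathbf E_{v,w}$, and every nonempty $\mathbf E^\circ_{v',w}\subseteq\mathbf E_{v,w}$ has $v'\le\bar v$. Consequently $\mathbf E_{v,w}=\overline{\mathbf E^\circ_{\bar v,w}}$ (Zariski closure in $\mathbf E_w$). (b) Assume $v_\alpha\le w_\alpha$ for all $\alpha\in I_0$ and $v_\beta\le w'_\beta+\sum_{s(h)=\beta}v_{t(h)}$ for all $\beta\in I_1$. Then $\tilde{\mathcal F}_{v,w}$ and $\mathcal F_{v,w}$ are irreducible and nonsingular, and $\pi$ is surjective. Moreover $$\dim\mathcal F_{v,w}=d_{v,w}:=\sum_{\beta\in I_1}\Big(w'_\beta+\sum_{s(h)=\beta}v_{t(h)}-v_\beta\Big)v_\beta+\sum_{\alpha\in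 I_0}(w_\alpha-v_\alpha)v_\alpha=\sum_{\alpha\in I_0}w_\alpha v_\alpha+\sum_{\beta\in I_1}w'_\beta v_\beta-\sum_{i\in I}v_i^2+\sum_{h\in\Omega}v_{s(h)}v_{t(h)},$$ $$\dim\tilde{\mathcal F}_{v,w}=\tilde d_{v,w}:=d_{v,w}+\sum_{\alpha\in I_0}v_\alpha w'_\alpha+\sum_{\beta\in I_1}v_\beta w_\beta=\sum_{\alpha\in I_0}(w_\alpha+w'_\alpha)v_\alpha+\sum_{\beta\in I_1}(w_\beta+w'_\beta)v_\beta-\sum_{i\in I}v_i^2+\sum_{h\in\Omega}v_{s(h)}v_{t(h)},$$ $$\dim\mathbf E_{v,w}=\dim\mathbf E_{\bar v,w}=\tilde d_{\bar v,w}.$$ (c) If $(v,w)$ is $l$-dominant, then $\pi$ is birational, and it restricts to an isomorphism $\pi^{-1}(\mathbf E^\circ_{v,w})\xrightarrow{\ \cong\ }\mathbf E^\circ_{v,w}$. -/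

import Mathlib

open Filter Topology Set

noncomputable section

/-! ### Complex algebraic varieties as spaces with functions -/

/-- A topological space with a sheaf of `ℂ`-algebras of `ℂ`-valued functions.  The sheaf is given
by the relation `RegAt f x`: the function `f` is regular in a neighbourhood of `x` (the values of
`f` away from `x` are irrelevant). A function is regular on an open set `U` if it is regular at
every point of `U`. -/
structure FunctionSpace where
  carrier : Type
  top : TopologicalSpace carrier
  RegAt : (carrier → ℂ) → carrier → Prop
  regAt_congr : ∀ {f g : carrier → ℂ} {x : carrier}, f =ᶠ[𝓝 x] g → RegAt f x → RegAt g x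
  regAt_const : ∀ (c : ℂ) (x : carrier), RegAt (fun _ => c) x
  regAt_add : ∀ {f g : carrier → ℂ} {x : carrier}, RegAt f x → RegAt g x → RegAt (f + g) x
  regAt_mul : ∀ {f g : carrier → ℂ} {x : carrier}, RegAt f x → RegAt g x → RegAt (f * g) x
  regAt_nhds : ∀ {f : carrier → ℂ} {x : carrier}, RegAt f x → ∀ᶠ y in 𝓝 x, RegAt f y

namespace FunctionSpace

instance : CoeSort FunctionSpace Type := ⟨FunctionSpace.carrier⟩

instance (X : FunctionSpace) : TopologicalSpace X := X.top

/-- The local ring of germs of regular functions at `x`. -/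
def stalk (X : FunctionSpace) (x : X) : Subring (Germ (𝓝 x) ℂ) where
  carrier := {g | ∃ f : X → ℂ, X.RegAt f x ∧ g = (f : Germ (𝓝 x) ℂ)}
  zero_mem' := ⟨fun _ => 0, X.regAt_const 0 x, rfl⟩
  one_mem' := ⟨fun _ => 1, X.regAt_const 1 x, rfl⟩
  add_mem' := by
    rintro _ _ ⟨f, hf, rfl⟩ ⟨g, hg, rfl⟩
    exact ⟨f + g, X.regAt_add hf hg, rfl⟩
  mul_mem' := by
    rintro _ _ ⟨f, hf, rfl⟩ ⟨g, hg, rfl⟩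
    exact ⟨f * g, X.regAt_mul hf hg, rfl⟩
  neg_mem' := by
    rintro _ ⟨f, hf, rfl⟩
    refine ⟨(fun _ => -1) * f, X.regAt_mul (X.regAt_const (-1) x) hf, ?_⟩
    rw [← Germ.coe_neg]
    congr 1
    funext y
    simp

/-- Nonsingular: all local rings are regular. -/
def IsNonsingular (X : FunctionSpace) : Prop :=
  ∀ x : X, IsRegularLocalRing (X.stalk x)

/-- The dimension of `X` (its Krull dimension as a topological space) is the integer `d`. -/
def HasDim (X : FunctionSpace) (d : ℤ) : Prop :=
  ∃ n : ℕ, topologicalKrullDim X = n ∧ (n : ℤ) = d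

/-- Morphisms: continuous maps that pull regular functions back to regular functions. -/
def IsMorphism {X Y : FunctionSpace} (φ : X → Y) : Prop :=
  Continuous φ ∧ ∀ (f : Y → ℂ) (x : X), Y.RegAt f (φ x) → X.RegAt (f ∘ φ) x

/-- Isomorphisms. -/
def IsIsomorphism {X Y : FunctionSpace} (φ : X → Y) : Prop :=
  ∃ ψ : Y → X, Function.LeftInverse ψ φ ∧ Function.RightInverse ψ φ ∧
    IsMorphism φ ∧ IsMorphism ψ

/-- A subset with the induced topology; a function on it is regular if it is locally the
restriction of a regular function of the ambient space.  (For a locally closed subset of a variety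
this is its structure of a reduced subvariety.) -/
def sub (X : FunctionSpace) (S : Set X) : FunctionSpace where
  carrier := S
  top := instTopologicalSpaceSubtype
  RegAt f x := ∃ g : X → ℂ, X.RegAt g x.1 ∧ ∀ᶠ y in 𝓝 x, f y = g y.1
  regAt_congr := by
    rintro f f' x h ⟨g, hg, hfg⟩
    refine ⟨g, hg, ?_⟩
    filter_upwards [h, hfg] with y h1 h2
    rw [← h1, h2]
  regAt_const c x := ⟨fun _ => c, X.regAt_const c _, Eventually.of_forall fun _ => rfl⟩
  regAt_add := by
    rintro f f' x ⟨g, hg, h⟩ ⟨g', hg', h'⟩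
    refine ⟨g + g', X.regAt_add hg hg', ?_⟩
    filter_upwards [h, h'] with y h1 h2
    simp [h1, h2]
  regAt_mul := by
    rintro f f' x ⟨g, hg, h⟩ ⟨g', hg', h'⟩
    refine ⟨g * g', X.regAt_mul hg hg', ?_⟩
    filter_upwards [h, h'] with y h1 h2
    simp [h1, h2]
  regAt_nhds := by
    rintro f x ⟨g, hg, h⟩
    have h1 : ∀ᶠ y in 𝓝 x, X.RegAt g y.1 :=
      continuous_subtype_val.continuousAt.eventually (X.regAt_nhds hg)
    filter_upwards [h1, h.eventually_nhds] with y h2 h3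
    exact ⟨g, h2, h3⟩

/-- The quotient structure along a map `q : X → Y`: a set is open if its preimage is, and
a function on an open set is regular if its pull-back to `X` is. -/
def quot (X : FunctionSpace) {Y : Type} (q : X → Y) : FunctionSpace where
  carrier := Y
  top := TopologicalSpace.coinduced q X.top
  RegAt f y := ∀ᶠ y' in @nhds Y (TopologicalSpace.coinduced q X.top) y,
    ∀ x : X, q x = y' → X.RegAt (f ∘ q) x
  regAt_congr := by
    let _ : TopologicalSpace Y := TopologicalSpace.coinduced q X.top
    have hq : Continuous q := continuous_coinduced_rng
    intro f g y h hf
    filter_upwards [hf, h.eventually_nhds] with y' h1 h2 x hx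
    subst hx
    exact X.regAt_congr (hq.continuousAt.eventually h2) (h1 x rfl)
  regAt_const c y := Eventually.of_forall fun _ x _ => X.regAt_const c x
  regAt_add := by
    intro f g y hf hg
    filter_upwards [hf, hg] with y' h1 h2 x hx
    exact X.regAt_add (h1 x hx) (h2 x hx)
  regAt_mul := by
    intro f g y hf hg
    filter_upwards [hf, hg] with y' h1 h2 x hx
    exact X.regAt_mul (h1 x hx) (h2 x hx)
  regAt_nhds := by
    let _ : TopologicalSpace Y := TopologicalSpace.coinduced q X.top
    intro f y hf
    exact Filter.Eventually.eventually_nhds hf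

/-- `φ` is birational: it is a morphism that restricts to an isomorphism between dense open
subsets of `X` and `Y`. -/
def IsBirational {X Y : FunctionSpace} (φ : X → Y) : Prop :=
  IsMorphism φ ∧ ∃ (U : Set X) (V : Set Y) (h : MapsTo φ U V),
    IsOpen U ∧ Dense U ∧ IsOpen V ∧ Dense V ∧
    IsIsomorphism (X := X.sub U) (Y := Y.sub V) (h.restrict φ U V)

end FunctionSpace

/-- Polynomial functions on a complex vector space: the algebra of functions generated by the
linear functionals. -/
def polyFun (V : Type) [AddCommGroup V] [Module ℂ V] : Subalgebra ℂ (V → ℂ) :=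
  Algebra.adjoin ℂ {f | ∃ φ : Module.Dual ℂ V, f = fun x => φ x}

/-- The Zariski topology on a complex vector space, with the sets `{p ≠ 0}`, `p` a polynomial
function, as basis of open sets. -/
abbrev zariskiTopology (V : Type) [AddCommGroup V] [Module ℂ V] : TopologicalSpace V :=
  TopologicalSpace.generateFrom {U | ∃ p ∈ polyFun V, U = {x | p x ≠ 0}}

/-- A (finite-dimensional) complex vector space as an affine space: Zariski topology, and the
regular functions are locally quotients of polynomial functions. -/
def affineSpace (V : Type) [AddCommGroup V] [Module ℂ V] : FunctionSpace where
  carrier := V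
  top := zariskiTopology V
  RegAt f x := ∃ p ∈ polyFun V, ∃ q ∈ polyFun V, q x ≠ 0 ∧
    ∀ᶠ y in @nhds V (zariskiTopology V) x, f y = p y / q y
  regAt_congr := by
    rintro f g x h ⟨p, hp, q, hq, hx, hf⟩
    refine ⟨p, hp, q, hq, hx, ?_⟩
    filter_upwards [h, hf] with y h1 h2
    rw [← h1, h2]
  regAt_const c x :=
    ⟨fun _ => c, (polyFun V).algebraMap_mem c, 1, (polyFun V).one_mem, by simp,
      Eventually.of_forall fun _ => by simp⟩
  regAt_add := by
    let _ : TopologicalSpace V := zariskiTopology V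
    rintro f g x ⟨p, hp, q, hq, hx, hf⟩ ⟨p', hp', q', hq', hx', hg⟩
    have h0 : ∀ᶠ y in 𝓝 x, q y ≠ 0 :=
      (TopologicalSpace.isOpen_generateFrom_of_mem ⟨q, hq, rfl⟩ :
        IsOpen {x | q x ≠ 0}).mem_nhds hx
    have h0' : ∀ᶠ y in 𝓝 x, q' y ≠ 0 :=
      (TopologicalSpace.isOpen_generateFrom_of_mem ⟨q', hq', rfl⟩ :
        IsOpen {x | q' x ≠ 0}).mem_nhds hx'
    refine ⟨p * q' + q * p', add_mem (mul_mem hp hq') (mul_mem hq hp'), q * q', mul_mem hq hq',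
      mul_ne_zero hx hx', ?_⟩
    filter_upwards [hf, hg, h0, h0'] with y h1 h2 h3 h4
    simp only [Pi.add_apply, Pi.mul_apply, h1, h2]
    exact div_add_div _ _ h3 h4
  regAt_mul := by
    rintro f g x ⟨p, hp, q, hq, hx, hf⟩ ⟨p', hp', q', hq', hx', hg⟩
    refine ⟨p * p', mul_mem hp hp', q * q', mul_mem hq hq', mul_ne_zero hx hx', ?_⟩
    filter_upwards [hf, hg] with y h1 h2
    simp only [Pi.mul_apply, h1, h2]
    exact div_mul_div_comm _ _ _ _
  regAt_nhds := by
    let _ : TopologicalSpace V := zariskiTopology V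
    rintro f x ⟨p, hp, q, hq, hx, hf⟩
    have h0 : ∀ᶠ y in 𝓝 x, q y ≠ 0 :=
      (TopologicalSpace.isOpen_generateFrom_of_mem ⟨q, hq, rfl⟩ :
        IsOpen {x | q x ≠ 0}).mem_nhds hx
    filter_upwards [h0, hf.eventually_nhds] with y h1 h2
    exact ⟨p, hp, q, hq, h1, h2⟩

section Grassmannian

variable {ι : Type} (E : ι → Type) [∀ i, AddCommGroup (E i)] [∀ i, Module ℂ (E i)] (d : ι → ℕ)

/-- Families of `d i`-dimensional subspaces of `E i`. -/
abbrev GrPoint : Type :=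
  {X : ∀ i, Submodule ℂ (E i) // ∀ i, Module.finrank ℂ (X i) = d i}

/-- Families of linear maps `ℂ ^ (d i) → E i`. -/
abbrev FrameMaps : Type := ∀ i, (Fin (d i) → ℂ) →ₗ[ℂ] E i

variable {E d} in
/-- The family of subspaces spanned by a family of frames. -/
def FrameMaps.span (a : FrameMaps E d) (ha : ∀ i, Function.Injective (a i)) : GrPoint E d :=
  ⟨fun i => LinearMap.range (a i), fun i => by
    rw [LinearMap.finrank_range_of_inj (ha i), Module.finrank_fin_fun]⟩

/-- The product of Grassmannians `∏ i, Gr(d i, E i)`: the quotient of the open subset of families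
of injective maps (frames) in the affine space of all families of linear maps `ℂ ^ (d i) → E i`
by change of frames. -/
def grassmannians : FunctionSpace :=
  ((affineSpace (FrameMaps E d)).sub
      {a : FrameMaps E d | ∀ i, Function.Injective (a i)}).quot
    (Y := GrPoint E d) fun a => FrameMaps.span (E := E) (d := d) a.1 a.2

/-- The product variety `V × ∏ i, Gr(d i, E i)` with an affine space `V`, as the quotient of
`V × {families of frames}` by change of frames. -/
def affineProdGrassmannians (V : Type) [AddCommGroup V] [Module ℂ V] : FunctionSpace :=
  ((affineSpace (V × FrameMaps E d)).sub
      {z : V × FrameMaps E d | ∀ i, Function.Injective (z.2 i)}).quot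
    (Y := V × GrPoint E d) fun z => (z.1.1, FrameMaps.span (E := E) (d := d) z.1.2 z.2)

end Grassmannian

/-! ### Graded quiver varieties of a bipartite quiver

A bipartite quiver has vertex set `I = I₀ ⊕ I₁`, with sinks `I₀` and sources `I₁`, and
`Ω β α` is the set of arrows from the source `β : I₁` to the sink `α : I₀`.
The dimension vectors are `w = (w i, w' i)` and `v = (v i)`, with `W i = ℂ ^ (w i)` and
`W' i = ℂ ^ (w' i)`. -/

namespace GradedQuiver

variable {I₀ I₁ : Type} [Fintype I₀] [Fintype I₁]
  (Ω : I₁ → I₀ → Type) [∀ β α, Fintype (Ω β α)]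
  (v w w' : I₀ ⊕ I₁ → ℕ)

/-- The arrows with source `β`. -/
abbrev ArrowsFrom (β : I₁) : Type := Σ α : I₀, Ω β α

/-- The arrows with target `α`. -/
abbrev ArrowsTo (α : I₀) : Type := Σ β : I₁, Ω β α

/-- The representation space `E_w` of the decorated quiver: `x_α : W'_α → W_α` for sinks,
`x_β : W_β → W'_β` for sources, `y_h : W_β → W_α` for arrows `h : β → α`. -/
abbrev Rep : Type :=
  (∀ α : I₀, (Fin (w' (.inl α)) → ℂ) →ₗ[ℂ] (Fin (w (.inl α)) → ℂ)) ×
  (∀ β : I₁, (Fin (w (.inr β)) → ℂ) →ₗ[ℂ] (Fin (w' (.inr β)) → ℂ)) ×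
  (∀ (β : I₁) (α : I₀), Ω β α → ((Fin (w (.inr β)) → ℂ) →ₗ[ℂ] (Fin (w (.inl α)) → ℂ)))

/-- The target of `A_i`: `W_α` for a sink `α`, and `W'_β ⊕ ⨁_{h : β → α} W_α` for a source `β`. -/
abbrev Target : I₀ ⊕ I₁ → Type
  | .inl α => Fin (w (.inl α)) → ℂ
  | .inr β => (Fin (w' (.inr β)) → ℂ) × (∀ h : ArrowsFrom Ω β, Fin (w (.inl h.1)) → ℂ)

instance : ∀ i, AddCommGroup (Target Ω w w' i)
  | .inl α => inferInstanceAs (AddCommGroup (Fin (w (.inl α)) → ℂ))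
  | .inr β => inferInstanceAs
      (AddCommGroup ((Fin (w' (.inr β)) → ℂ) × (∀ h : ArrowsFrom Ω β, Fin (w (.inl h.1)) → ℂ)))

instance : ∀ i, Module ℂ (Target Ω w w' i)
  | .inl α => inferInstanceAs (Module ℂ (Fin (w (.inl α)) → ℂ))
  | .inr β => inferInstanceAs
      (Module ℂ ((Fin (w' (.inr β)) → ℂ) × (∀ h : ArrowsFrom Ω β, Fin (w (.inl h.1)) → ℂ)))

instance : ∀ i, FiniteDimensional ℂ (Target Ω w w' i)
  | .inl α => inferInstanceAs (FiniteDimensional ℂ (Fin (w (.inl α)) → ℂ))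
  | .inr β => inferInstanceAs (FiniteDimensional ℂ
      ((Fin (w' (.inr β)) → ℂ) × (∀ h : ArrowsFrom Ω β, Fin (w (.inl h.1)) → ℂ)))

variable {Ω w w'}

/-- `A_α : W'_α ⊕ ⨁_{h : β → α} W_β → W_α`, `(a, b) ↦ x_α a + ∑ y_h b_h`, for a sink `α`. -/
def sinkMap (r : Rep Ω w w') (α : I₀) :
    ((Fin (w' (.inl α)) → ℂ) × (∀ h : ArrowsTo Ω α, Fin (w (.inr h.1)) → ℂ)) →ₗ[ℂ]
      (Fin (w (.inl α)) → ℂ) :=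
  LinearMap.coprod (r.1 α)
    (∑ h : ArrowsTo Ω α, (r.2.2 h.1 α h.2).comp (LinearMap.proj h))

/-- `A_β : W_β → W'_β ⊕ ⨁_{h : β → α} W_α`, `b ↦ (x_β b, (y_h b)_h)`, for a source `β`. -/
def sourceMap (r : Rep Ω w w') (β : I₁) :
    (Fin (w (.inr β)) → ℂ) →ₗ[ℂ]
      (Fin (w' (.inr β)) → ℂ) × (∀ h : ArrowsFrom Ω β, Fin (w (.inl h.1)) → ℂ) :=
  LinearMap.prod (r.2.1 β) (LinearMap.pi fun h : ArrowsFrom Ω β => r.2.2 β h.1 h.2)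

/-- The image of `A_i`. -/
def imA (r : Rep Ω w w') : ∀ i, Submodule ℂ (Target Ω w w' i)
  | .inl α => LinearMap.range (sinkMap r α)
  | .inr β => LinearMap.range (sourceMap r β)

/-- The rank of `A_i`. -/
def rankA (r : Rep Ω w w') (i : I₀ ⊕ I₁) : ℕ := Module.finrank ℂ (imA r i)

variable (Ω w w')

/-- `E_w` as a variety (an affine space). -/
def repSpace : FunctionSpace := affineSpace (Rep Ω w w')

/-- The points of `E_{v,w}`: `rank A_i ≤ v_i` for all `i`. -/
def affineSet : Set (repSpace Ω w w') := {r : Rep Ω w w' | ∀ i, rankA r i ≤ v i}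

/-- The stratum `E°_{v,w}`: `rank A_i = v_i` for all `i`. -/
def stratum : Set (repSpace Ω w w') := {r : Rep Ω w w' | ∀ i, rankA r i = v i}

/-- The affine graded quiver variety `E_{v,w}`. -/
def affineVariety : FunctionSpace := (repSpace Ω w w').sub (affineSet Ω v w w')

variable {Ω v w w'} in
/-- The condition `X_β ⊆ W'_β ⊕ ⨁_{h : β → α} X_α` for all sources `β`. -/
def IsFlag (X : GrPoint (Target Ω w w') v) : Prop :=
  ∀ (β : I₁), ∀ z ∈ X.1 (.inr β), ∀ h : ArrowsFrom Ω β, z.2 h ∈ X.1 (.inl h.1)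

/-- The projective variety `F_{v,w}`, a subvariety of
`∏_α Gr(v_α, W_α) × ∏_β Gr(v_β, W'_β ⊕ ⨁_{h : β → α} W_α)`. -/
def flagVariety : FunctionSpace :=
  (grassmannians (Target Ω w w') v).sub {X : GrPoint (Target Ω w w') v | IsFlag X}

/-- The points `(x, y, X)` of `F̃_{v,w}`. -/
def nonsingularSet : Set (affineProdGrassmannians (Target Ω w w') v (Rep Ω w w')) :=
  {z : Rep Ω w w' × GrPoint (Target Ω w w') v | IsFlag z.2 ∧ ∀ i, imA z.1 i ≤ z.2.1 i}

/-- Nakajima's nonsingular graded quiver variety `F̃_{v,w}`, a subvariety of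
`E_w × ∏_α Gr(v_α, W_α) × ∏_β Gr(v_β, W'_β ⊕ ⨁_{h : β → α} W_α)`. -/
def nonsingularVariety : FunctionSpace :=
  (affineProdGrassmannians (Target Ω w w') v (Rep Ω w w')).sub (nonsingularSet Ω v w w')

/-- The projection `π : F̃_{v,w} → E_{v,w}`, `(x, y, X) ↦ (x, y)`. -/
def proj (z : nonsingularVariety Ω v w w') : affineVariety Ω v w w' :=
  ⟨z.1.1, fun i => (Submodule.finrank_mono (z.2.2 i)).trans_eq (z.1.2.2 i)⟩

/-- The condition for `F_{v,w}` to be nonempty: `v_α ≤ w_α` for sinks `α`, and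
`v_β ≤ w'_β + ∑_{h : β → α} v_α` for sources `β`. -/
def NonemptyCondition : Prop :=
  (∀ α : I₀, v (.inl α) ≤ w (.inl α)) ∧
  ∀ β : I₁, v (.inr β) ≤ w' (.inr β) + ∑ h : ArrowsFrom Ω β, v (.inl h.1)

/-- The sum of `u_j` over all arrows joining `i` to some vertex `j`. -/
def adjSum (u : I₀ ⊕ I₁ → ℕ) : I₀ ⊕ I₁ → ℕ
  | .inl α => ∑ h : ArrowsTo Ω α, u (.inr h.1)
  | .inr β => ∑ h : ArrowsFrom Ω β, u (.inl h.1)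

/-- `(v, w)` is `l`-dominant: `w_i ≥ v_i` and `w'_i ≥ v_i - ∑_{h : i - j} v_j` for all `i`. -/
def LDominant : Prop :=
  ∀ i, (v i : ℤ) ≤ w i ∧ (v i : ℤ) - (adjSum Ω v i : ℤ) ≤ w' i

/-- `v̄_i = min(v_i, w_i, w'_i + ∑_{h : i - j} min(v_j, w_j))`. -/
def vbar (i : I₀ ⊕ I₁) : ℕ :=
  min (v i) (min (w i) (w' i + adjSum Ω (fun j => min (v j) (w j)) i))

/-- `d_{v,w}`. -/
def dimF : ℤ :=
  ∑ β : I₁, ((w' (.inr β) : ℤ) + ∑ h : ArrowsFrom Ω β, (v (.inl h.1) : ℤ) - v (.inr β))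
      * v (.inr β)
    + ∑ α : I₀, ((w (.inl α) : ℤ) - v (.inl α)) * v (.inl α)

/-- `d̃_{v,w}`. -/
def dimFtilde : ℤ :=
  dimF Ω v w w' + ∑ α : I₀, (v (.inl α) : ℤ) * w' (.inl α)
    + ∑ β : I₁, (v (.inr β) : ℤ) * w (.inr β)

end GradedQuiver

end

/-! The condition `im A_α ⊆ X_α` follows from the others: on `W'_α` the map `A_α` is `x_α`, and
`y_h(b)` is a component of `A_β(b) ∈ X_β`, so the flag condition puts it in `X_α`. A point of F̃ is
therefore a flag `(X_i)` with arbitrary maps `x_α : W'_α → X_α` and `A_β : W_β → X_β`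
(`nonsingularSet_eq`). So F̃ is the total space of a vector bundle over F, and F is an iterated
Grassmannian bundle.

Both are instances of one abstract bundle (`FlagBundle.bundle`), F being the case of zero fibres.
Frames of `X_α`, frames of `X_β` written in `W'_β ⊕ ⨁ ℂ ^ v_α`, and coordinates of the maps form an
affine space of parameters. Its nonempty open subset of injective frames surjects onto the bundle,
which is thus irreducible (`irreducibleSpace_bundle`). Normalising frames by fixed linear maps to `ℂ
^ v_i` gives open charts that are affine spaces of the expected dimension (`FlagBundle.chart`);
nonsingularity and the dimension formulas are read off there.

The maps `A_i` at neighbouring vertices factor through each other's images, so every rank vector is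
l-dominant (`lDominant_rankA`) and E_{v,w} = E_{v̄,w}. For v̄ the projection π is onto: enlarge each
`im A_α` to `X_α`, then each `im A_β` to `X_β` (`proj_surjective`). Hence E is irreducible. For
l-dominant v the stratum is nonempty, because injectivity of frames and surjectivity of coordinates
are two nonempty open conditions on the irreducible parameter space (`stratum_nonempty`). It is open
by semicontinuity of rank, hence dense.

Over this stratum `X_i = im A_i` is forced, and restricting `A_i` to a fixed subspace gives a local
regular frame of its image, so π has a regular inverse (`morphAt_stratumSection`). Finally dim E ≤
d̃, since a polynomial map from a chart has dense image (`topologicalKrullDim_le_of_dense`), and dim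
E ≥ d̃, since the part of a chart over the stratum embeds in E. -/

namespace FunctionSpace

/-! ### Locally ringed function spaces and morphisms near a point -/

/-- Regular functions that do not vanish at a point are invertible near that point. -/
class IsLocallyRinged (X : FunctionSpace) : Prop where
  regAt_inv : ∀ {f : X → ℂ} {x : X}, X.RegAt f x → f x ≠ 0 → X.RegAt (fun y => (f y)⁻¹) x
  eventually_ne : ∀ {f : X → ℂ} {x : X}, X.RegAt f x → f x ≠ 0 → ∀ᶠ y in 𝓝 x, f y ≠ 0

/-- `φ` is a morphism near the point `x`. -/
def MorphAt {X Y : FunctionSpace} (φ : X → Y) (x : X) : Prop :=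
  ContinuousAt φ x ∧ ∀ f : Y → ℂ, Y.RegAt f (φ x) → X.RegAt (f ∘ φ) x

theorem isMorphism_iff {X Y : FunctionSpace} {φ : X → Y} :
    IsMorphism φ ↔ ∀ x, MorphAt φ x :=
  ⟨fun h x => ⟨h.1.continuousAt, fun f => h.2 f x⟩,
    fun h => ⟨continuous_iff_continuousAt.2 fun x => (h x).1, fun f x => (h x).2 f⟩⟩

/-- The quotient map `q`, as a map to the quotient structure along `q`. -/
def toQuot {X : FunctionSpace} {Q : Type} (q : X → Q) : X → X.quot q := q

theorem continuous_toQuot {X : FunctionSpace} {Q : Type} (q : X → Q) :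
    Continuous (toQuot q) :=
  continuous_iff_coinduced_le.2 le_rfl

theorem isOpen_quot_iff {X : FunctionSpace} {Q : Type} {q : X → Q} {O : Set (X.quot q)} :
    IsOpen O ↔ IsOpen (toQuot q ⁻¹' O) := Iff.rfl

theorem regAt_quot_iff {X : FunctionSpace} {Q : Type} {q : X → Q} {f : X.quot q → ℂ}
    {y : X.quot q} :
    (X.quot q).RegAt f y ↔
      ∀ᶠ y' in 𝓝 y, ∀ x : X, toQuot q x = y' → X.RegAt (fun x => f (toQuot q x)) x := Iff.rfl

theorem regAt_affineSpace_iff {V : Type} [AddCommGroup V] [Module ℂ V] {f : affineSpace V → ℂ}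
    {x : affineSpace V} :
    (affineSpace V).RegAt f x ↔ ∃ p : affineSpace V → ℂ, p ∈ polyFun V ∧
      ∃ q : affineSpace V → ℂ, q ∈ polyFun V ∧ q x ≠ 0 ∧ ∀ᶠ y in 𝓝 x, f y = p y / q y := Iff.rfl

theorem isOpen_ne_zero {V : Type} [AddCommGroup V] [Module ℂ V] {p : affineSpace V → ℂ}
    (hp : p ∈ polyFun V) : IsOpen {x : affineSpace V | p x ≠ 0} :=
  TopologicalSpace.isOpen_generateFrom_of_mem ⟨p, hp, rfl⟩

namespace MorphAt

variable {X Y Z : FunctionSpace}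

theorem comp {ψ : Y → Z} {φ : X → Y} {x : X} (hψ : MorphAt ψ (φ x)) (hφ : MorphAt φ x) :
    MorphAt (fun y => ψ (φ y)) x :=
  ⟨ContinuousAt.comp (f := φ) hψ.1 hφ.1, fun f hf => hφ.2 _ (hψ.2 f hf)⟩

theorem congr {φ ψ : X → Y} {x : X} (h : MorphAt φ x) (e : φ =ᶠ[𝓝 x] ψ) : MorphAt ψ x := by
  have hx : φ x = ψ x := e.self_of_nhds
  refine ⟨h.1.congr e, fun f hf => ?_⟩
  rw [← hx] at hf
  refine X.regAt_congr ?_ (h.2 f hf)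
  filter_upwards [e] with y hy
  simp [hy]

theorem subVal (S : Set X) (x : X.sub S) : MorphAt (X := X.sub S) (Y := X) Subtype.val x :=
  ⟨continuous_subtype_val.continuousAt, fun f hf => ⟨f, hf, Eventually.of_forall fun _ => rfl⟩⟩

/-- A regular function on a subset is locally the restriction of an ambient one, so only the
composite with the inclusion has to be tested. -/
theorem codRestrict {S : Set Y} {φ : X → Y.sub S} {x : X}
    (h : MorphAt (X := X) (Y := Y) (fun y => (φ y).1) x) : MorphAt φ x := by
  have hc : ContinuousAt φ x := by
    exact IsInducing.subtypeVal.continuousAt_iff.2 h.1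
  refine ⟨hc, ?_⟩
  rintro f ⟨g, hg, hfg⟩
  refine X.regAt_congr ?_ (h.2 g hg)
  filter_upwards [hc.eventually hfg] with y hy
  exact hy.symm

theorem toQuot {Q : Type} (q : X → Q) (x : X) : MorphAt (toQuot q) x :=
  ⟨(continuous_toQuot q).continuousAt, fun _ hf => (regAt_quot_iff.1 hf).self_of_nhds x rfl⟩

/-- Openness and regularity on a quotient are tested upstairs by definition. Regularity at `y`
involves all fibres near `y`, so the hypothesis is needed over an open set `O`, not just over `y`.
-/
theorem quotLift {Q : Type} {q : X → Q} {O : Set (X.quot q)} (hO : IsOpen O)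
    {φ : X.quot q → Z}
    (h : ∀ x : X, FunctionSpace.toQuot q x ∈ O → MorphAt (fun y => φ (FunctionSpace.toQuot q y)) x)
    {y : X.quot q} (hy : y ∈ O) : MorphAt φ y := by
  have hq := continuous_toQuot q
  have hc : ∀ y ∈ O, ContinuousAt φ y := by
    have : ContinuousOn φ O := by
      rw [continuousOn_open_iff hO]
      intro N hN
      rw [isOpen_quot_iff, isOpen_iff_mem_nhds]
      rintro x ⟨hx, hxN⟩
      exact Filter.inter_mem (hq.continuousAt.preimage_mem_nhds (hO.mem_nhds hx))
        ((h x hx).1 (hN.mem_nhds hxN))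
    exact fun y hy => this.continuousAt (hO.mem_nhds hy)
  refine ⟨hc y hy, fun f hf => ?_⟩
  rw [regAt_quot_iff]
  filter_upwards [(hc y hy).eventually (Z.regAt_nhds hf), hO.mem_nhds hy] with y' h2 h3 x hx
  subst hx
  exact (h x h3).2 f h2

end MorphAt

instance {X : FunctionSpace} [IsLocallyRinged X] (S : Set X) : IsLocallyRinged (X.sub S) where
  regAt_inv := by
    rintro f x ⟨g, hg, h⟩ hx
    refine ⟨fun y => (g y)⁻¹, IsLocallyRinged.regAt_inv hg ?_, ?_⟩
    · rwa [← h.self_of_nhds]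
    · filter_upwards [h] with y hy
      rw [hy]
  eventually_ne := by
    rintro f x ⟨g, hg, h⟩ hx
    have h1 : g x.1 ≠ 0 := by rwa [← h.self_of_nhds]
    have h2 : ∀ᶠ y : X.sub S in 𝓝 x, g y.1 ≠ 0 :=
      (MorphAt.subVal S x).1.eventually (IsLocallyRinged.eventually_ne hg h1)
    filter_upwards [h, h2] with y hy h3
    rwa [hy]

instance (V : Type) [AddCommGroup V] [Module ℂ V] : IsLocallyRinged (affineSpace V) where
  regAt_inv := by
    intro f x hf hx
    rw [regAt_affineSpace_iff] at hf ⊢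
    obtain ⟨p, hp, q, hq, hqx, h⟩ := hf
    refine ⟨q, hq, p, hp, ?_, ?_⟩
    · rw [h.self_of_nhds] at hx
      exact (div_ne_zero_iff.1 hx).1
    · filter_upwards [h] with y hy
      rw [hy, inv_div]
  eventually_ne := by
    intro f x hf hx
    obtain ⟨p, hp, q, hq, hqx, h⟩ := regAt_affineSpace_iff.1 hf
    rw [h.self_of_nhds] at hx
    filter_upwards [h, (isOpen_ne_zero hp).mem_nhds (div_ne_zero_iff.1 hx).1,
      (isOpen_ne_zero hq).mem_nhds hqx] with y h1 h2 h3
    rw [h1]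
    exact div_ne_zero h2 h3

/-- Invertibility becomes nonvanishing of a polynomial, hence an open condition. -/
theorem isUnit_end_iff_det_ne_zero {k : ℕ} (g : Module.End ℂ (Fin k → ℂ)) :
    IsUnit g ↔ (LinearMap.toMatrix' g).det ≠ 0 := by
  rw [← isUnit_iff_ne_zero, ← Matrix.isUnit_iff_isUnit_det]
  exact (MulEquiv.isUnit_map (LinearMap.toMatrixAlgEquiv' (R := ℂ) (n := Fin k))).symm

/-! ### Regular maps to vector spaces -/

section RegMap

variable (X : FunctionSpace) {M M₁ M₂ M₃ : Type} [AddCommGroup M] [Module ℂ M]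
  [AddCommGroup M₁] [Module ℂ M₁] [AddCommGroup M₂] [Module ℂ M₂] [AddCommGroup M₃] [Module ℂ M₃]

/-- The map `Ψ` to a vector space is regular near `x`. -/
def RegMapAt (Ψ : X → M) (x : X) : Prop :=
  ∀ φ : Module.Dual ℂ M, X.RegAt (fun y => φ (Ψ y)) x

variable {X}

theorem regAt_sum {ι : Type*} (s : Finset ι) {f : ι → X → ℂ} {x : X}
    (h : ∀ i ∈ s, X.RegAt (f i) x) : X.RegAt (fun y => ∑ i ∈ s, f i y) x := by
  classical
  induction s using Finset.induction_on with
  | empty => simpa using X.regAt_const 0 x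
  | insert i s hi ih =>
    simp only [Finset.sum_insert hi]
    exact X.regAt_add (h i (by simp)) (ih fun j hj => h j (by simp [hj]))

theorem regAt_prod {ι : Type*} (s : Finset ι) {f : ι → X → ℂ} {x : X}
    (h : ∀ i ∈ s, X.RegAt (f i) x) : X.RegAt (fun y => ∏ i ∈ s, f i y) x := by
  classical
  induction s using Finset.induction_on with
  | empty => simpa using X.regAt_const 1 x
  | insert i s hi ih =>
    simp only [Finset.prod_insert hi]
    exact X.regAt_mul (h i (by simp)) (ih fun j hj => h j (by simp [hj]))

theorem MorphAt.regMapAt {Y : FunctionSpace} {φ : X → Y} {x : X} (h : MorphAt φ x)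
    {Ψ : Y → M} (hΨ : Y.RegMapAt Ψ (φ x)) : X.RegMapAt (fun y => Ψ (φ y)) x :=
  fun l => h.2 _ (hΨ l)

theorem regMapAt_id (x : M) : (affineSpace M).RegMapAt (fun y : M => y) x := fun φ =>
  ⟨fun y => φ y, Algebra.subset_adjoin ⟨φ, rfl⟩, 1, (polyFun M).one_mem, by simp,
    Eventually.of_forall fun _ => by simp⟩

namespace RegMapAt

variable {x : X}

theorem const (m : M) (x : X) : X.RegMapAt (fun _ => m) x := fun φ => X.regAt_const (φ m) x

theorem linear {Ψ : X → M₁} (h : X.RegMapAt Ψ x) (l : M₁ →ₗ[ℂ] M₂) :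
    X.RegMapAt (fun y => l (Ψ y)) x := fun φ => h (φ.comp l)

theorem add {Ψ Ψ' : X → M} (h : X.RegMapAt Ψ x) (h' : X.RegMapAt Ψ' x) :
    X.RegMapAt (fun y => Ψ y + Ψ' y) x := fun φ => by
  simp only [map_add]
  exact X.regAt_add (h φ) (h' φ)

theorem of_regAt {f : X → ℂ} (h : X.RegAt f x) : X.RegMapAt f x := fun φ => by
  have : (fun y => φ (f y)) = (fun _ => φ 1) * f := by
    funext y
    have := φ.map_smul (f y) 1
    simp only [smul_eq_mul, mul_one] at this
    simp [this, mul_comm]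
  rw [this]
  exact X.regAt_mul (X.regAt_const _ _) h

theorem congr {Ψ Ψ' : X → M} (h : X.RegMapAt Ψ x) (e : Ψ =ᶠ[𝓝 x] Ψ') : X.RegMapAt Ψ' x :=
  fun φ => X.regAt_congr (e.mono fun y hy => by simp [hy]) (h φ)

theorem smul {f : X → ℂ} {Ψ : X → M} (hf : X.RegAt f x) (h : X.RegMapAt Ψ x) :
    X.RegMapAt (fun y => f y • Ψ y) x := fun φ => by
  simp only [map_smul, smul_eq_mul]
  exact X.regAt_mul hf (h φ)

theorem sum {ι : Type*} (s : Finset ι) {Ψ : ι → X → M} (h : ∀ i ∈ s, X.RegMapAt (Ψ i) x) :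
    X.RegMapAt (fun y => ∑ i ∈ s, Ψ i y) x := fun φ => by
  simpa using regAt_sum s fun i hi => h i hi φ

/-- Expanding the first argument in a finite basis leaves sums of regular scalars times linear
images of `Ψ₂`. -/
theorem bilin [FiniteDimensional ℂ M₁] {Ψ₁ : X → M₁} {Ψ₂ : X → M₂}
    (B : M₁ →ₗ[ℂ] M₂ →ₗ[ℂ] M₃) (h₁ : X.RegMapAt Ψ₁ x) (h₂ : X.RegMapAt Ψ₂ x) :
    X.RegMapAt (fun y => B (Ψ₁ y) (Ψ₂ y)) x := by
  let b := Module.finBasis ℂ M₁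
  have : (fun y => B (Ψ₁ y) (Ψ₂ y)) = fun y => ∑ i, b.coord i (Ψ₁ y) • B (b i) (Ψ₂ y) := by
    funext y
    conv_lhs => rw [← b.sum_repr (Ψ₁ y), map_sum, LinearMap.sum_apply]
    exact Finset.sum_congr rfl fun i _ => by simp
  rw [this]
  exact sum _ fun i _ => smul (h₁ (b.coord i)) (h₂.linear (B (b i)))

theorem prodMk {Ψ₁ : X → M₁} {Ψ₂ : X → M₂} (h₁ : X.RegMapAt Ψ₁ x) (h₂ : X.RegMapAt Ψ₂ x) :
    X.RegMapAt (fun y => (Ψ₁ y, Ψ₂ y)) x := by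
  have := (h₁.linear (LinearMap.inl ℂ M₁ M₂)).add (h₂.linear (LinearMap.inr ℂ M₁ M₂))
  simpa using this

theorem pi {ι : Type} [Finite ι] {N : ι → Type} [∀ i, AddCommGroup (N i)] [∀ i, Module ℂ (N i)]
    {Ψ : X → ∀ i, N i} (h : ∀ i, X.RegMapAt (fun y => Ψ y i) x) : X.RegMapAt Ψ x := by
  classical
  have := Fintype.ofFinite ι
  have h2 := sum Finset.univ fun i _ => (h i).linear (LinearMap.single ℂ N i)
  refine h2.congr (Eventually.of_forall fun y => ?_)
  funext j
  simp [Finset.sum_apply]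

theorem linComp [FiniteDimensional ℂ M₁] [FiniteDimensional ℂ M₂] [FiniteDimensional ℂ M₃]
    {Ψ₁ : X → (M₂ →ₗ[ℂ] M₃)} {Ψ₂ : X → (M₁ →ₗ[ℂ] M₂)}
    (h₁ : X.RegMapAt Ψ₁ x) (h₂ : X.RegMapAt Ψ₂ x) :
    X.RegMapAt (fun y => (Ψ₁ y).comp (Ψ₂ y)) x :=
  bilin (LinearMap.llcomp ℂ M₁ M₂ M₃) h₁ h₂

theorem comp_polyFun {Ψ : X → M} (h : X.RegMapAt Ψ x) {p : M → ℂ} (hp : p ∈ polyFun M) :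
    X.RegAt (fun y => p (Ψ y)) x := by
  induction hp using Algebra.adjoin_induction with
  | mem p hp =>
    obtain ⟨φ, rfl⟩ := hp
    exact h φ
  | algebraMap c => exact X.regAt_const c x
  | add p q _ _ hp hq => exact X.regAt_add hp hq
  | mul p q _ _ hp hq => exact X.regAt_mul hp hq

/-- Basic open sets pull back to nonvanishing loci of regular functions, and fractions to products
with an inverse; both uses need `IsLocallyRinged`. -/
theorem morphAt [IsLocallyRinged X] {Ψ : X → affineSpace M} (h : X.RegMapAt (M := M) Ψ x) :
    MorphAt (Y := affineSpace M) Ψ x := by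
  have hc : ContinuousAt Ψ x := by
    rw [ContinuousAt]
    refine TopologicalSpace.tendsto_nhds_generateFrom_iff.2 ?_
    rintro _ ⟨p, hp, rfl⟩ hx
    exact IsLocallyRinged.eventually_ne (h.comp_polyFun hp) hx
  refine ⟨hc, ?_⟩
  rintro f ⟨p, hp, q, hq, hx, hf⟩
  refine X.regAt_congr ?_ (X.regAt_mul (h.comp_polyFun hp)
    (IsLocallyRinged.regAt_inv (h.comp_polyFun hq) hx))
  filter_upwards [hc.eventually hf] with y hy
  simp only [Function.comp, hy, Pi.mul_apply, div_eq_mul_inv]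

theorem det {n : Type} [Fintype n] [DecidableEq n] {A : X → Matrix n n ℂ}
    (h : X.RegMapAt A x) : X.RegAt (fun y => (A y).det) x := by
  simp only [Matrix.det_apply]
  refine regAt_sum _ fun σ _ => ?_
  have : X.RegAt (fun y => ∏ i, A y (σ i) i) x := regAt_prod _ fun i _ =>
    h ((LinearMap.proj (R := ℂ) (φ := fun _ : n => ℂ) i).comp
      (LinearMap.proj (R := ℂ) (φ := fun _ : n => n → ℂ) (σ i)))
  have h2 := X.regAt_mul (X.regAt_const ((Equiv.Perm.sign σ : ℤ) : ℂ) x) this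
  refine X.regAt_congr (Eventually.of_forall fun y => ?_) h2
  simp [Units.smul_def]

theorem adjugate {n : Type} [Fintype n] [DecidableEq n] {A : X → Matrix n n ℂ}
    (h : X.RegMapAt A x) : X.RegMapAt (fun y => (A y).adjugate) x := by
  refine pi fun i => pi fun j => of_regAt ?_
  simp only [Matrix.adjugate_apply]
  refine det (pi fun k => ?_)
  by_cases hk : k = j
  · subst hk
    simpa using const _ _
  · simp only [Matrix.updateRow_ne hk]
    exact h.linear (LinearMap.proj (R := ℂ) (φ := fun _ : n => n → ℂ) k)

/-- Cramer's rule: near a unit the inverse is the adjugate divided by the determinant. The total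
function `Ring.inverse` agrees with this formula only near `x`, which is enough. -/
theorem ringInverse [IsLocallyRinged X] {k : ℕ} {g : X → Module.End ℂ (Fin k → ℂ)}
    (h : X.RegMapAt g x) (hx : IsUnit (g x)) : X.RegMapAt (fun y => Ring.inverse (g y)) x := by
  have h1 : X.RegMapAt (fun y => LinearMap.toMatrix' (g y)) x :=
    h.linear (LinearMap.toMatrix' : ((Fin k → ℂ) →ₗ[ℂ] (Fin k → ℂ)) ≃ₗ[ℂ] _).toLinearMap
  have hd := (isUnit_end_iff_det_ne_zero _).1 hx
  have h2 := (smul (IsLocallyRinged.regAt_inv h1.det hd) h1.adjugate).linear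
    (LinearMap.toMatrix' : ((Fin k → ℂ) →ₗ[ℂ] (Fin k → ℂ)) ≃ₗ[ℂ] _).symm.toLinearMap
  refine h2.congr ?_
  filter_upwards [IsLocallyRinged.eventually_ne h1.det hd] with y hy
  have hi : (LinearMap.toMatrix' (g y))⁻¹ =
      (LinearMap.toMatrix' (g y)).det⁻¹ • (LinearMap.toMatrix' (g y)).adjugate := by
    rw [Matrix.inv_def, Ring.inverse_eq_inv']
  obtain ⟨u, hgu⟩ := (isUnit_end_iff_det_ne_zero _).2 hy
  rw [← hi, ← hgu, Ring.inverse_unit]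
  simp only [LinearEquiv.coe_coe]
  rw [LinearEquiv.symm_apply_eq]
  refine Matrix.inv_eq_right_inv ?_
  rw [← LinearMap.toMatrix'_mul, Units.mul_inv, LinearMap.toMatrix'_one]


end RegMapAt

end RegMap

end FunctionSpace

namespace FunctionSpace

/-! ### Local isomorphisms and local rings -/

section Stalk

variable {X Y : FunctionSpace}

/-- The map of local rings induced by a morphism. -/
noncomputable def stalkMap {φ : X → Y} {x : X} (h : MorphAt φ x) :
    Y.stalk (φ x) →+* X.stalk x where
  toFun g := ⟨g.1.compTendsto φ h.1, by
    obtain ⟨f, hf, hg⟩ := g.2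
    exact ⟨f ∘ φ, h.2 f hf, by rw [hg]; rfl⟩⟩
  map_one' := rfl
  map_zero' := rfl
  map_add' := by
    rintro ⟨_, f, hf, rfl⟩ ⟨_, g, hg, rfl⟩
    rfl
  map_mul' := by
    rintro ⟨_, f, hf, rfl⟩ ⟨_, g, hg, rfl⟩
    rfl

/-- Pulling germs back along the local inverse `χ` inverts the map; `χ` need be inverse to `φ` only
near the two points. -/
theorem stalkMap_bijective {φ : X → Y} {x : X} (h : MorphAt φ x) {χ : Y → X}
    (h' : MorphAt χ (φ x)) (hχφ : ∀ᶠ z in 𝓝 x, χ (φ z) = z)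
    (hφχ : ∀ᶠ y in 𝓝 (φ x), φ (χ y) = y) : Function.Bijective (stalkMap h) := by
  have hx : χ (φ x) = x := hχφ.self_of_nhds
  constructor
  · rintro ⟨_, f, hf, rfl⟩ ⟨_, g, hg, rfl⟩ hfg
    have h1 : (((f ∘ φ : X → ℂ) : Germ (𝓝 x) ℂ)) = ((g ∘ φ : X → ℂ) : Germ (𝓝 x) ℂ) :=
      congrArg Subtype.val hfg
    have h2 : f ∘ φ =ᶠ[𝓝 x] g ∘ φ := Germ.coe_eq.1 h1
    have h3 : Tendsto χ (𝓝 (φ x)) (𝓝 x) := by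
      have := h'.1
      rwa [ContinuousAt, hx] at this
    refine Subtype.ext (Germ.coe_eq.2 ?_)
    filter_upwards [h3.eventually h2, hφχ] with y h4 h5
    simpa [h5] using h4
  · rintro ⟨_, f, hf, rfl⟩
    have hf' : Y.RegAt (f ∘ χ) (φ x) := h'.2 f (by rwa [hx])
    refine ⟨⟨((f ∘ χ : Y → ℂ) : Germ (𝓝 (φ x)) ℂ), _, hf', rfl⟩, Subtype.ext (Germ.coe_eq.2 ?_)⟩
    filter_upwards [hχφ] with z hz
    simp [hz]

end Stalk

/-! ### Affine spaces -/

theorem isRegularLocalRing_of_isLocalization_atPrime {R A : Type*} [CommRing R] [IsRegularRing R]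
    [CommRing A] [Algebra R A] (p : Ideal R) [p.IsPrime] [IsLocalization.AtPrime A p] :
    IsRegularLocalRing A :=
  IsRegularLocalRing.of_ringEquiv
    (IsLocalization.algEquiv p.primeCompl (Localization.AtPrime p) A).toRingEquiv

section Affine

variable (V : Type) [AddCommGroup V] [Module ℂ V]

theorem isTopologicalBasis_affineSpace :
    TopologicalSpace.IsTopologicalBasis
      {U : Set (affineSpace V) | ∃ p : affineSpace V → ℂ, p ∈ polyFun V ∧ U = {x | p x ≠ 0}} where
  exists_subset_inter := by
    rintro _ ⟨p, hp, rfl⟩ _ ⟨q, hq, rfl⟩ x ⟨hx, hx'⟩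
    exact ⟨_, ⟨p * q, mul_mem hp hq, rfl⟩, mul_ne_zero hx hx', fun y hy =>
      ⟨left_ne_zero_of_mul hy, right_ne_zero_of_mul hy⟩⟩
  sUnion_eq := by
    refine eq_univ_of_forall fun x => mem_sUnion.2 ⟨_, ⟨1, (polyFun V).one_mem, rfl⟩, ?_⟩
    simp
  eq_generateFrom := rfl

variable {V} in
theorem exists_polyFun_of_mem_nhds {x : affineSpace V} {U : Set (affineSpace V)} (hU : U ∈ 𝓝 x) :
    ∃ p : affineSpace V → ℂ, p ∈ polyFun V ∧ p x ≠ 0 ∧ {y | p y ≠ 0} ⊆ U := by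
  obtain ⟨_, ⟨p, hp, rfl⟩, h1, h2⟩ := (isTopologicalBasis_affineSpace V).mem_nhds_iff.1 hU
  exact ⟨p, hp, h1, h2⟩

/-- Evaluation of polynomials on the coordinates of a basis. -/
noncomputable def evalCoord {ι : Type} (b : Module.Basis ι ℂ V) :
    MvPolynomial ι ℂ →ₐ[ℂ] (V → ℂ) :=
  MvPolynomial.aeval fun i x => b.coord i x

variable {V}

theorem evalCoord_apply {ι : Type} (b : Module.Basis ι ℂ V) (P : MvPolynomial ι ℂ) (x : V) :
    evalCoord V b P x = MvPolynomial.eval (fun i => b.coord i x) P := by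
  have : (Pi.evalAlgHom ℂ (fun _ : V => ℂ) x).comp (evalCoord V b) =
      MvPolynomial.aeval fun i => b.coord i x := by
    ext i
    simp [evalCoord]
  exact congrArg (fun g => g P) this

theorem evalCoord_injective {ι : Type} [Finite ι] (b : Module.Basis ι ℂ V) :
    Function.Injective (evalCoord V b) := by
  have := Fintype.ofFinite ι
  intro P Q h
  refine MvPolynomial.funext fun c => ?_
  have h2 := congrFun h (b.equivFun.symm c)
  rw [evalCoord_apply, evalCoord_apply] at h2
  have : (fun i => b.coord i (b.equivFun.symm c)) = c := by
    funext i
    rw [b.coord_equivFun_symm]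
  rwa [this] at h2

theorem range_evalCoord {ι : Type} [Finite ι] (b : Module.Basis ι ℂ V) :
    (evalCoord V b).range = polyFun V := by
  have := Fintype.ofFinite ι
  rw [evalCoord, ← Algebra.adjoin_range_eq_range_aeval]
  apply le_antisymm
  · refine Algebra.adjoin_mono ?_
    rintro _ ⟨i, rfl⟩
    exact ⟨b.coord i, rfl⟩
  · refine Algebra.adjoin_le ?_
    rintro _ ⟨φ, rfl⟩
    have : (fun x => φ x) = ∑ i, φ (b i) • (fun x => b.coord i x : V → ℂ) := by
      funext x
      conv_lhs => rw [← b.sum_repr x, map_sum]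
      simp [mul_comm]
    rw [this]
    exact sum_mem fun i _ => Subalgebra.smul_mem _ (Algebra.subset_adjoin (mem_range_self i)) _

variable (V) [FiniteDimensional ℂ V]

/-- The algebra of polynomial functions is a polynomial algebra. -/
noncomputable def polyFunEquiv :
    MvPolynomial (Fin (Module.finrank ℂ V)) ℂ ≃ₐ[ℂ] polyFun V :=
  (AlgEquiv.ofInjective _ (evalCoord_injective (Module.finBasis ℂ V))).trans
    (Subalgebra.equivOfEq _ _ (range_evalCoord _))

instance : IsDomain (polyFun V) :=
  (polyFunEquiv V).symm.toMulEquiv.isDomain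

instance : IsRegularRing (polyFun V) :=
  IsRegularRing.of_ringEquiv (polyFunEquiv V).toRingEquiv

instance : Algebra.FiniteType ℂ (polyFun V) :=
  Algebra.FiniteType.equiv inferInstance (polyFunEquiv V)

instance : IrreducibleSpace (affineSpace V) where
  isPreirreducible_univ := by
    rintro U U' hU hU' ⟨x, -, hx⟩ ⟨x', -, hx'⟩
    obtain ⟨p, hp, hpx, hpU⟩ := exists_polyFun_of_mem_nhds (hU.mem_nhds hx)
    obtain ⟨q, hq, hqx, hqU⟩ := exists_polyFun_of_mem_nhds (hU'.mem_nhds hx')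
    have : (⟨p, hp⟩ * ⟨q, hq⟩ : polyFun V) ≠ 0 := by
      refine mul_ne_zero (fun h => hpx ?_) fun h => hqx ?_
      · exact congrFun (congrArg Subtype.val h) x
      · exact congrFun (congrArg Subtype.val h) x'
    obtain ⟨y, hy⟩ : ∃ y, p y * q y ≠ 0 := by
      by_contra! h
      exact this (Subtype.ext (funext h))
    exact ⟨y, mem_univ _, hpU (left_ne_zero_of_mul hy), hqU (right_ne_zero_of_mul hy)⟩
  toNonempty := ⟨(0 : V)⟩

variable {V}

/-- A polynomial function vanishing near a point vanishes. -/
theorem eq_of_eventuallyEq {p q : affineSpace V → ℂ} (hp : p ∈ polyFun V) (hq : q ∈ polyFun V)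
    {x : affineSpace V} (h : p =ᶠ[𝓝 x] q) : p = q := by
  by_contra hne
  obtain ⟨y, hy⟩ := Function.ne_iff.1 hne
  obtain ⟨O, hO, hOo, hxO⟩ := eventually_nhds_iff.1 h
  obtain ⟨z, hz, hz'⟩ := nonempty_preirreducible_inter hOo
    (isOpen_ne_zero (sub_mem hp hq)) ⟨x, hxO⟩ ⟨y, sub_ne_zero.2 hy⟩
  exact hz' (sub_eq_zero.2 (hO z hz))

/-- The stalk is the localization of the polynomial algebra at the kernel of evaluation at `x`:
germs are fractions by definition, and a polynomial is determined by its germ because the space is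
irreducible. Polynomial rings over a field are regular. -/
theorem isRegularLocalRing_affineSpace_stalk (x : affineSpace V) :
    IsRegularLocalRing ((affineSpace V).stalk x) := by
  have hreg : ∀ p : affineSpace V → ℂ, p ∈ polyFun V → (affineSpace V).RegAt p x := fun p hp =>
    (regMapAt_id (M := V) x).comp_polyFun hp
  let ev : polyFun V →+* ℂ := (Pi.evalRingHom (fun _ : V => ℂ) x).comp (polyFun V).val.toRingHom
  let toStalk : polyFun V →+* (affineSpace V).stalk x :=
    { toFun := fun p => ⟨Germ.ofFun (l := 𝓝 x) p.1, p.1, hreg p.1 p.2, rfl⟩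
      map_one' := rfl
      map_zero' := rfl
      map_add' := fun _ _ => rfl
      map_mul' := fun _ _ => rfl }
  let _ : Algebra (polyFun V) ((affineSpace V).stalk x) := toStalk.toAlgebra
  have hprime : (RingHom.ker ev).IsPrime := RingHom.ker_isPrime ev
  have hloc : IsLocalization.AtPrime ((affineSpace V).stalk x) (RingHom.ker ev) := by
    refine ⟨?_, ?_, ?_⟩
    · rintro ⟨p, hp⟩
      have hpx : p.1 x ≠ 0 := hp
      refine IsUnit.of_mul_eq_one ⟨((fun y => (p.1 y)⁻¹ : affineSpace V → ℂ) : Germ (𝓝 x) ℂ), _,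
        IsLocallyRinged.regAt_inv (hreg p.1 p.2) hpx, rfl⟩ (Subtype.ext (Germ.coe_eq.2 ?_))
      filter_upwards [IsLocallyRinged.eventually_ne (hreg p.1 p.2) hpx] with y hy
      exact mul_inv_cancel₀ hy
    · rintro ⟨_, f, hf, rfl⟩
      obtain ⟨p, hp, q, hq, hqx, h⟩ := regAt_affineSpace_iff.1 hf
      refine ⟨(⟨p, hp⟩, ⟨⟨q, hq⟩, hqx⟩), Subtype.ext (Germ.coe_eq.2 ?_)⟩
      filter_upwards [h, IsLocallyRinged.eventually_ne (hreg q hq) hqx] with y h1 h2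
      change f y * q y = p y
      rw [h1, div_mul_cancel₀ _ h2]
    · intro p q h
      refine ⟨1, ?_⟩
      have h1 : Germ.ofFun (l := 𝓝 x) p.1 = Germ.ofFun (l := 𝓝 x) q.1 :=
        congrArg Subtype.val h
      have : p = q := Subtype.ext (eq_of_eventuallyEq p.2 q.2 (Germ.coe_eq.1 h1))
      rw [this]
  exact isRegularLocalRing_of_isLocalization_atPrime (RingHom.ker ev)

end Affine

end FunctionSpace

namespace FunctionSpace

/-! ### Dimension -/

/-- By Noether normalization `R` is integral over a polynomial ring in `s` variables. Transcendence
degree in the larger polynomial ring gives `s ≤ n`, and incomparability of primes gives `dim R ≤ s`.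
-/
theorem ringKrullDim_le_of_injective_mvPolynomial {R : Type*} [CommRing R] [Nontrivial R]
    [Algebra ℂ R] [Algebra.FiniteType ℂ R] {n : ℕ} (g : R →ₐ[ℂ] MvPolynomial (Fin n) ℂ)
    (hg : Function.Injective g) : ringKrullDim R ≤ n := by
  obtain ⟨s, h, hinj, hint⟩ := exists_integral_inj_algHom_of_fg ℂ R
  have hsn : s ≤ n := by
    have h1 := lift_trdeg_le_of_injective (g.comp h) (hg.comp hinj)
    rw [MvPolynomial.trdeg_of_isDomain, MvPolynomial.trdeg_of_isDomain] at h1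
    simpa using h1
  let _ : Algebra (MvPolynomial (Fin s) ℂ) R := h.toRingHom.toAlgebra
  have : Algebra.IsIntegral (MvPolynomial (Fin s) ℂ) R := ⟨hint⟩
  -- Contraction of primes along an integral extension preserves strict inclusions.
  have h2 : ringKrullDim R ≤ ringKrullDim (MvPolynomial (Fin s) ℂ) := by
    refine Order.krullDim_le_of_strictMono
      (PrimeSpectrum.comap (algebraMap (MvPolynomial (Fin s) ℂ) R)) fun p q hpq => ?_
    exact Ideal.IsIntegral.comap_lt_comap (I := p.asIdeal) (J := q.asIdeal) hpq
  rw [MvPolynomial.ringKrullDim_of_isNoetherianRing, ringKrullDim_eq_zero_of_field] at h2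
  refine h2.trans ?_
  simpa using hsn

section Affine

variable {V : Type} [AddCommGroup V] [Module ℂ V] [FiniteDimensional ℂ V]

/-- The affine subspaces `u + W` through a point `u` of `U` are closed and irreducible, so the
lattice of subspaces of `V` embeds in the irreducible closed subsets of `U`. -/
theorem finrank_le_topologicalKrullDim {U : Set (affineSpace V)} (hU : IsOpen U)
    (hne : U.Nonempty) : (Module.finrank ℂ V : WithBot ℕ∞) ≤ topologicalKrullDim U := by
  obtain ⟨u, hu⟩ := hne
  let u' : V := u
  let A : Submodule ℂ V → Set V := fun W => {y | y - u' ∈ W}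
  have hirr : ∀ W, IsIrreducible (X := affineSpace V) (A W) := by
    intro W
    let t : W → V := fun z => u' + W.subtype z
    have ht : Continuous (X := affineSpace W) (Y := affineSpace V) t :=
      continuous_iff_continuousAt.2 fun z => (RegMapAt.morphAt (M := V)
        ((RegMapAt.const u' z).add ((regMapAt_id (M := W) z).linear W.subtype))).1
    have h1 := (IrreducibleSpace.isIrreducible_univ (affineSpace W)).image (Y := affineSpace V) t
      ht.continuousOn
    have h2 : A W = t '' univ := by
      ext y
      constructor
      · intro hy
        exact ⟨⟨y - u', hy⟩, mem_univ _, add_sub_cancel u' y⟩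
      · rintro ⟨z, -, rfl⟩
        have : u' + (z : V) - u' ∈ W := by simp
        exact this
    rw [h2]
    exact h1
  -- A subspace is the common kernel of the functionals that vanish on it.
  have hcl : ∀ W, IsClosed (X := affineSpace V) (A W) := by
    intro W
    have : A W = ⋂ φ ∈ {φ : Module.Dual ℂ V | W ≤ LinearMap.ker φ},
        {y : V | φ (y - u') ≠ 0}ᶜ := by
      ext y
      simp only [mem_iInter, mem_compl_iff, mem_ofPred_eq, not_not, A]
      constructor
      · intro hy φ hφ
        exact hφ hy
      · intro h
        by_contra hy
        obtain ⟨φ, h1, h2⟩ := Submodule.exists_le_ker_of_notMem hy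
        exact h1 (h φ h2)
    rw [this]
    refine isClosed_biInter (X := affineSpace V) fun φ _ =>
      (isOpen_ne_zero (V := V) (p := fun y : V => φ (y - u')) ?_).isClosed_compl
    change (fun y : V => φ (y - u')) ∈ polyFun V
    have : (fun y : V => φ (y - u')) = (fun y => φ y) - algebraMap ℂ (V → ℂ) (φ u') := by
      funext y
      simp
    rw [this]
    exact sub_mem (Algebra.subset_adjoin ⟨φ, rfl⟩) (Subalgebra.algebraMap_mem _ _)
  let Z : Submodule ℂ V → TopologicalSpace.IrreducibleCloseds (affineSpace V) := fun W =>
    ⟨A W, hirr W, hcl W⟩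
  have hZ : StrictMono Z := by
    intro W W' hW
    refine lt_of_le_of_ne (fun y hy => hW.le hy) fun h => ?_
    obtain ⟨z, hz, hz'⟩ := SetLike.exists_of_lt hW
    have h1 : A W = A W' := congrArg TopologicalSpace.IrreducibleCloseds.carrier h
    have h2 : u' + z ∈ A W := by
      rw [h1]
      change u' + z - u' ∈ W'
      simpa using hz
    have h3 : u' + z - u' ∈ W := h2
    exact hz' (by simpa using h3)
  -- Every `u + W` meets `U`, so passing to its trace on the open set `U` preserves strict
  -- inclusions.
  let F : Submodule ℂ V → TopologicalSpace.IrreducibleCloseds U := fun W =>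
    (TopologicalSpace.IrreducibleCloseds.orderIsoOfIsOpenEmbedding _
      hU.isOpenEmbedding_subtypeVal).symm
      ⟨Z W, ⟨⟨u, hu⟩, by
        change u' - u' ∈ W
        simp⟩⟩
  have hF : StrictMono F := fun W W' hW => (OrderIso.strictMono _) (hZ hW)
  have h3 := Order.krullDim_le_of_strictMono F hF
  -- The Krull dimension of the lattice of subspaces is the length of `V`, that is, its dimension.
  rw [← Module.coe_length, Module.length_eq_finrank] at h3
  exact_mod_cast h3

variable {M : Type} [AddCommGroup M] [Module ℂ M] [FiniteDimensional ℂ M]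

/-- Pull-back along `θ` embeds `polyFun M ⧸ ker f` in `polyFun V`, so this quotient has dimension at
most `dim V`. Irreducible closed subsets of `S` inject, with order reversed, into its primes, since
the polynomials killed by `θ` vanish on `S`. The set `S` itself need not be closed. -/
theorem topologicalKrullDim_le_of_dense {S : Set (affineSpace M)} {θ : V → M}
    (hθ : ∀ p ∈ polyFun M, p ∘ θ ∈ polyFun V)
    (hS : S ⊆ closure (X := affineSpace M) (range θ)) :
    topologicalKrullDim S ≤ Module.finrank ℂ V := by
  let f : polyFun M →ₐ[ℂ] polyFun V :=
    { toFun := fun p => ⟨p.1 ∘ θ, hθ p.1 p.2⟩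
      map_one' := rfl
      map_zero' := rfl
      map_add' := fun _ _ => rfl
      map_mul' := fun _ _ => rfl
      commutes' := fun _ => rfl }
  have hker : ∀ p : polyFun M, f p = 0 → ∀ x ∈ S, p.1 x = 0 := by
    intro p hp x hx
    have hcl : IsClosed (X := affineSpace M) {x : affineSpace M | p.1 x = 0} := by
      have := (isOpen_ne_zero p.2).isClosed_compl
      simpa [compl_ofPred] using this
    refine closure_minimal ?_ hcl (hS hx)
    rintro _ ⟨t, rfl⟩
    exact congrFun (congrArg Subtype.val hp) t
  let J : TopologicalSpace.IrreducibleCloseds S → Ideal (polyFun M) := fun Z =>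
    { carrier := {p | ∀ z ∈ Z, p.1 z.1 = 0}
      zero_mem' := fun _ _ => rfl
      add_mem' := fun {p q} hp hq z hz => by
        change p.1 z.1 + q.1 z.1 = 0
        rw [hp z hz, hq z hz, add_zero]
      smul_mem' := fun c p hp z hz => by
        change c.1 z.1 * p.1 z.1 = 0
        rw [hp z hz, mul_zero] }
  have hJ : ∀ Z, (J Z).IsPrime := by
    intro Z
    refine ⟨fun h => ?_, fun {p q} hpq => ?_⟩
    · obtain ⟨z, hz⟩ := Z.isIrreducible.nonempty
      have : (1 : polyFun M) ∈ J Z := by rw [h]; trivial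
      exact one_ne_zero (α := ℂ) (this z hz)
    · by_contra! h
      obtain ⟨h1, h2⟩ := h
      have h1' : ∃ z ∈ Z, p.1 z.1 ≠ 0 := by
        by_contra! h; exact h1 h
      have h2' : ∃ z ∈ Z, q.1 z.1 ≠ 0 := by
        by_contra! h; exact h2 h
      obtain ⟨z, hz, hz1⟩ := h1'
      obtain ⟨z', hz', hz1'⟩ := h2'
      obtain ⟨y, hy, hy1, hy2⟩ := Z.isIrreducible.isPreirreducible _ _
        ((isOpen_ne_zero p.2).preimage continuous_subtype_val)
        ((isOpen_ne_zero q.2).preimage continuous_subtype_val) ⟨z, hz, hz1⟩ ⟨z', hz', hz1'⟩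
      exact mul_ne_zero hy1 hy2 (hpq y hy)
  -- A point outside `Z'` has a basic neighbourhood `{p ≠ 0}` whose trace on `S` misses `Z'`; this
  -- `p` lies in `J Z'` but not in `J Z`.
  have hmono : ∀ Z Z', J Z' ≤ J Z → Z ≤ Z' := by
    intro Z Z' h z hz
    by_contra hz'
    have h1 : ((Z' : Set S)ᶜ) ∈ 𝓝 z := Z'.isClosed.isOpen_compl.mem_nhds hz'
    rw [mem_nhds_subtype] at h1
    obtain ⟨u, hu, hu'⟩ := h1
    obtain ⟨p, hp, hpz, hpu⟩ := exists_polyFun_of_mem_nhds hu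
    refine hpz (h (x := ⟨p, hp⟩) (fun y hy => ?_) z hz)
    by_contra hpy
    exact hu' (hpu hpy) hy
  let F : (TopologicalSpace.IrreducibleCloseds S)ᵒᵈ →
      PrimeSpectrum.zeroLocus (R := polyFun M) (RingHom.ker f : Set (polyFun M)) := fun Z =>
    ⟨⟨J (OrderDual.ofDual Z), hJ _⟩, fun p hp z _ => hker p hp z.1 z.2⟩
  have hF : StrictMono F := by
    intro Z Z' hZ
    refine lt_of_le_of_ne (fun p hp z hz => hp z (hZ.le hz)) fun h => ?_
    have h2 : J (OrderDual.ofDual Z') ≤ J (OrderDual.ofDual Z) :=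
      (congrArg (fun y => y.1.asIdeal) h).ge
    exact hZ.not_ge (hmono _ _ h2)
  have h1 := Order.krullDim_le_of_strictMono F hF
  rw [Order.krullDim_orderDual, ← ringKrullDim_quotient] at h1
  refine h1.trans ?_
  have := Ideal.Quotient.nontrivial_iff.2 (RingHom.ker_ne_top f)
  exact ringKrullDim_le_of_injective_mvPolynomial (R := polyFun M ⧸ RingHom.ker f)
    ((polyFunEquiv V).symm.toAlgHom.comp (Ideal.kerLiftAlg f))
    ((polyFunEquiv V).symm.injective.comp (Ideal.kerLiftAlg_injective f))

theorem topologicalKrullDim_affineSpace :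
    topologicalKrullDim (affineSpace V) = Module.finrank ℂ V := by
  apply le_antisymm
  · rw [← IsHomeomorph.topologicalKrullDim_eq _ (Homeomorph.Set.univ (affineSpace V)).isHomeomorph]
    refine topologicalKrullDim_le_of_dense (θ := id) (fun p hp => hp) fun x _ => ?_
    exact subset_closure (X := affineSpace V) ⟨x, rfl⟩
  · rw [← IsHomeomorph.topologicalKrullDim_eq _ (Homeomorph.Set.univ (affineSpace V)).isHomeomorph]
    exact finrank_le_topologicalKrullDim isOpen_univ univ_nonempty

end Affine

/-! ### Charts -/

/-- An isomorphism of an affine space with an open subset. -/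
structure AffineChart (X : FunctionSpace) (T : Type) [AddCommGroup T] [Module ℂ T] where
  toFun : affineSpace T → X
  invFun : X → affineSpace T
  target : Set X
  isOpen_target : IsOpen target
  mapsTo : ∀ t, toFun t ∈ target
  left_inv : ∀ t, invFun (toFun t) = t
  right_inv : ∀ x ∈ target, toFun (invFun x) = x
  morphAt_toFun : ∀ t, MorphAt toFun t
  morphAt_invFun : ∀ x ∈ target, MorphAt invFun x

namespace AffineChart

variable {X : FunctionSpace} {T : Type} [AddCommGroup T] [Module ℂ T]

/-- The image of an open set is its preimage under the inverse, taken inside the open target. -/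
theorem isOpenEmbedding (c : AffineChart X T) : IsOpenEmbedding c.toFun := by
  refine .of_continuous_injective_isOpenMap
    (continuous_iff_continuousAt.2 fun t => (c.morphAt_toFun t).1)
    (Function.LeftInverse.injective c.left_inv) fun N hN => ?_
  have : c.toFun '' N = c.target ∩ c.invFun ⁻¹' N := by
    ext x
    constructor
    · rintro ⟨t, ht, rfl⟩
      exact ⟨c.mapsTo t, by simpa [c.left_inv] using ht⟩
    · rintro ⟨hx, hxN⟩
      exact ⟨_, hxN, c.right_inv x hx⟩
  rw [this]
  exact ContinuousOn.isOpen_inter_preimage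
    (fun x hx => (c.morphAt_invFun x hx).1.continuousWithinAt) c.isOpen_target hN

variable [FiniteDimensional ℂ T]

theorem isRegularLocalRing_stalk (c : AffineChart X T) {x : X} (hx : x ∈ c.target) :
    IsRegularLocalRing (X.stalk x) := by
  rw [← c.right_inv x hx]
  have h := c.morphAt_toFun (c.invFun x)
  have hb := stalkMap_bijective h (c.morphAt_invFun _ (c.mapsTo _))
    (Eventually.of_forall c.left_inv) (by
      filter_upwards [c.isOpen_target.mem_nhds (c.mapsTo _)] with y hy using c.right_inv y hy)
  have := isRegularLocalRing_affineSpace_stalk (c.invFun x)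
  exact IsRegularLocalRing.of_ringEquiv (RingEquiv.ofBijective _ hb).symm

end AffineChart

theorem isNonsingular_of_charts {X : FunctionSpace}
    (h : ∀ x : X, ∃ (T : Type) (_ : AddCommGroup T) (_ : Module ℂ T) (_ : FiniteDimensional ℂ T)
      (c : AffineChart X T), x ∈ c.target) : X.IsNonsingular := by
  intro x
  obtain ⟨T, _, _, _, c, hx⟩ := h x
  exact c.isRegularLocalRing_stalk hx

/-- The dimension is a supremum of coheights. The coheight of `Z` can be computed in any open set
meeting `Z`, because larger irreducible closed sets meet it too. So one chart at a point of `Z`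
suffices, and no finite cover is needed. -/
theorem topologicalKrullDim_of_charts {X : FunctionSpace} [Nonempty X] {n : ℕ}
    (h : ∀ x : X, ∃ (T : Type) (_ : AddCommGroup T) (_ : Module ℂ T) (_ : FiniteDimensional ℂ T)
      (c : AffineChart X T), x ∈ c.target ∧ Module.finrank ℂ T = n) :
    topologicalKrullDim X = n := by
  apply le_antisymm
  · rw [topologicalKrullDim, Order.krullDim_eq_iSup_coheight]
    refine iSup_le fun Z => ?_
    obtain ⟨x, hx⟩ := Z.isIrreducible.nonempty
    obtain ⟨T, _, _, _, c, hxc, hT⟩ := h x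
    let e := TopologicalSpace.IrreducibleCloseds.orderIsoOfIsOpenEmbedding _ c.isOpenEmbedding
    let Z' := e.symm ⟨Z, ⟨c.invFun x, by
        change c.toFun (c.invFun x) ∈ (Z : Set X)
        rwa [c.right_inv x hxc]⟩⟩
    have hZ : TopologicalSpace.IrreducibleCloseds.map _ c.isOpenEmbedding.continuous Z' = Z :=
      congrArg Subtype.val (e.apply_symm_apply _)
    rw [← hZ, c.isOpenEmbedding.coheight_map, ← hT, ← topologicalKrullDim_affineSpace]
    exact Order.coheight_le_krullDim Z'
  · obtain ⟨x⟩ := ‹Nonempty X›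
    obtain ⟨T, _, _, _, c, hx, hT⟩ := h x
    have := c.isOpenEmbedding.isInducing.topologicalKrullDim_le
    rwa [topologicalKrullDim_affineSpace, hT] at this

end FunctionSpace

namespace FunctionSpace

/-! ### Polynomial maps as regular maps -/

/-- A vector space with the polynomial functions as the only regular functions. -/
def polySpace (V : Type) [AddCommGroup V] [Module ℂ V] : FunctionSpace where
  carrier := V
  top := ⊤
  RegAt f _ := f ∈ polyFun V
  regAt_congr := by
    intro f g x h hf
    rw [_root_.nhds_top] at h
    rwa [show g = f from (funext fun y => Filter.eventually_top.1 h y).symm]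
  regAt_const c _ := (polyFun V).algebraMap_mem c
  regAt_add := add_mem
  regAt_mul := mul_mem
  regAt_nhds h := Eventually.of_forall fun _ => h

theorem regMapAt_polySpace_id {V : Type} [AddCommGroup V] [Module ℂ V] (x : V) :
    (polySpace V).RegMapAt (fun y : V => y) x :=
  fun φ => Algebra.subset_adjoin ⟨φ, rfl⟩

/-- On `polySpace` being regular at one point means being polynomial everywhere, so the calculus of
regular maps also proves that explicit maps are polynomial. -/
theorem RegMapAt.polyFun_comp {V M : Type} [AddCommGroup V] [Module ℂ V] [AddCommGroup M]
    [Module ℂ M] {θ : V → M} {x : V} (h : (polySpace V).RegMapAt θ x) {p : M → ℂ}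
    (hp : p ∈ polyFun M) : p ∘ θ ∈ polyFun V :=
  h.comp_polyFun (X := polySpace V) hp

namespace RegMapAt

variable {X : FunctionSpace} {x : X} {M : Type} [AddCommGroup M] [Module ℂ M]
  [FiniteDimensional ℂ M]

theorem linPi {ι : Type} [Finite ι] {N : ι → Type} [∀ i, AddCommGroup (N i)]
    [∀ i, Module ℂ (N i)] [∀ i, FiniteDimensional ℂ (N i)] {Ψ : X → ∀ i, M →ₗ[ℂ] N i}
    (h : ∀ i, X.RegMapAt (fun y => Ψ y i) x) :
    X.RegMapAt (fun y => LinearMap.pi (Ψ y)) x := by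
  classical
  have := Fintype.ofFinite ι
  refine (sum Finset.univ fun i _ => linComp (const (LinearMap.single ℂ N i) x) (h i)).congr
    (Eventually.of_forall fun y => ?_)
  ext m j
  simp [LinearMap.sum_apply, Finset.sum_apply]

theorem linProd {N₁ N₂ : Type} [AddCommGroup N₁] [Module ℂ N₁] [AddCommGroup N₂] [Module ℂ N₂]
    [FiniteDimensional ℂ N₁] [FiniteDimensional ℂ N₂] {Ψ₁ : X → (M →ₗ[ℂ] N₁)}
    {Ψ₂ : X → (M →ₗ[ℂ] N₂)} (h₁ : X.RegMapAt Ψ₁ x) (h₂ : X.RegMapAt Ψ₂ x) :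
    X.RegMapAt (fun y => (Ψ₁ y).prod (Ψ₂ y)) x := by
  refine ((linComp (const (LinearMap.inl ℂ N₁ N₂) x) h₁).add
    (linComp (const (LinearMap.inr ℂ N₁ N₂) x) h₂)).congr (Eventually.of_forall fun y => ?_)
  ext m <;> simp

theorem apply {ι : Type} {N : ι → Type} [∀ i, AddCommGroup (N i)] [∀ i, Module ℂ (N i)]
    {Ψ : X → ∀ i, N i} (h : X.RegMapAt Ψ x) (i : ι) : X.RegMapAt (fun y => Ψ y i) x :=
  h.linear (LinearMap.proj i)

theorem fst {N₁ N₂ : Type} [AddCommGroup N₁] [Module ℂ N₁] [AddCommGroup N₂] [Module ℂ N₂]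
    {Ψ : X → N₁ × N₂} (h : X.RegMapAt Ψ x) : X.RegMapAt (fun y => (Ψ y).1) x :=
  h.linear (LinearMap.fst ℂ N₁ N₂)

theorem snd {N₁ N₂ : Type} [AddCommGroup N₁] [Module ℂ N₁] [AddCommGroup N₂] [Module ℂ N₂]
    {Ψ : X → N₁ × N₂} (h : X.RegMapAt Ψ x) : X.RegMapAt (fun y => (Ψ y).2) x :=
  h.linear (LinearMap.snd ℂ N₁ N₂)

theorem eventually_isUnit [IsLocallyRinged X] {k : ℕ} {g : X → Module.End ℂ (Fin k → ℂ)}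
    (h : X.RegMapAt g x) (hx : IsUnit (g x)) : ∀ᶠ y in 𝓝 x, IsUnit (g y) := by
  have h1 : X.RegMapAt (fun y => LinearMap.toMatrix' (g y)) x :=
    h.linear (LinearMap.toMatrix' : ((Fin k → ℂ) →ₗ[ℂ] (Fin k → ℂ)) ≃ₗ[ℂ] _).toLinearMap
  simp only [isUnit_end_iff_det_ne_zero] at hx ⊢
  exact IsLocallyRinged.eventually_ne h1.det hx

/-- Injectivity is an open condition on linear maps. -/
theorem eventually_injective [IsLocallyRinged X] {k : ℕ} {g : X → ((Fin k → ℂ) →ₗ[ℂ] M)}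
    (h : X.RegMapAt g x) (hx : Function.Injective (g x)) :
    ∀ᶠ y in 𝓝 x, Function.Injective (g y) := by
  -- With a left inverse `p` of `g x` fixed, `p ∘ g y` stays invertible for `y` near `x`, which
  -- forces `g y` to be injective.
  obtain ⟨p, hp⟩ := LinearMap.exists_leftInverse_of_injective (g x) (LinearMap.ker_eq_bot.2 hx)
  have h1 : X.RegMapAt (M := Module.End ℂ (Fin k → ℂ)) (fun y => p.comp (g y)) x :=
    linComp (const p x) h
  have h2 := h1.eventually_isUnit (by rw [hp]; exact isUnit_one)
  filter_upwards [h2] with y hy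
  have := (Module.End.isUnit_iff _).1 hy
  exact Function.Injective.of_comp (f := p) this.1

/-- Surjectivity is an open condition on linear maps. -/
theorem eventually_surjective [IsLocallyRinged X] {k : ℕ} {g : X → (M →ₗ[ℂ] (Fin k → ℂ))}
    (h : X.RegMapAt g x) (hx : Function.Surjective (g x)) :
    ∀ᶠ y in 𝓝 x, Function.Surjective (g y) := by
  obtain ⟨p, hp⟩ := LinearMap.exists_rightInverse_of_surjective (g x) (LinearMap.range_eq_top.2 hx)
  have h1 : X.RegMapAt (M := Module.End ℂ (Fin k → ℂ)) (fun y => (g y).comp p) x :=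
    linComp h (const p x)
  have h2 := h1.eventually_isUnit (by rw [hp]; exact isUnit_one)
  filter_upwards [h2] with y hy
  have := (Module.End.isUnit_iff _).1 hy
  exact Function.Surjective.of_comp (g := p) this.2

end RegMapAt

end FunctionSpace

/-! ### Grassmannians -/

section Frames

variable {ι : Type} {E : ι → Type} [∀ i, AddCommGroup (E i)] [∀ i, Module ℂ (E i)] {d : ι → ℕ}

theorem FrameMaps.exists_span_eq [∀ i, FiniteDimensional ℂ (E i)] (X : GrPoint E d) :
    ∃ (a : FrameMaps E d) (ha : ∀ i, Function.Injective (a i)), a.span ha = X := by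
  let b := fun i => Module.finBasisOfFinrankEq ℂ (X.1 i) (X.2 i)
  refine ⟨fun i => (X.1 i).subtype.comp (b i).equivFun.symm.toLinearMap, fun i => ?_,
    Subtype.ext (funext fun i => ?_)⟩
  · exact (Subtype.val_injective).comp (b i).equivFun.symm.injective
  · change LinearMap.range ((X.1 i).subtype.comp _) = X.1 i
    rw [LinearMap.range_comp, LinearEquiv.range, Submodule.map_top, Submodule.range_subtype]

/-- Two frames of one subspace differ by a change of basis. -/
theorem exists_unit_of_range_eq {k : ℕ} {F : Type} [AddCommGroup F] [Module ℂ F]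
    {f f' : (Fin k → ℂ) →ₗ[ℂ] F} (hf : Function.Injective f) (hf' : Function.Injective f')
    (h : LinearMap.range f = LinearMap.range f') :
    ∃ u : (Module.End ℂ (Fin k → ℂ))ˣ, f' = f.comp (u : Module.End ℂ (Fin k → ℂ)) := by
  let u : (Fin k → ℂ) ≃ₗ[ℂ] (Fin k → ℂ) :=
    (LinearEquiv.ofInjective f' hf').trans ((LinearEquiv.ofEq _ _ h.symm).trans
      (LinearEquiv.ofInjective f hf).symm)
  refine ⟨LinearMap.GeneralLinearGroup.generalLinearEquiv ℂ _ |>.symm u, ?_⟩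
  refine LinearMap.ext fun z => ?_
  change f' z = f (u z)
  have h1 : LinearEquiv.ofInjective f hf (u z) = LinearEquiv.ofEq _ _ h.symm
      (LinearEquiv.ofInjective f' hf' z) := by simp [u]
  have h2 := congrArg Subtype.val h1
  simpa using h2.symm

/-- The frame normalised by `g` depends only on the subspace: in `f u (g f u)⁻¹` the unit `u`
cancels. When `g ∘ f` is not invertible both sides vanish by the convention for `Ring.inverse`. -/
theorem comp_inverse_eq_of_range_eq {k : ℕ} {F : Type} [AddCommGroup F] [Module ℂ F]
    {f f' : (Fin k → ℂ) →ₗ[ℂ] F} (hf : Function.Injective f) (hf' : Function.Injective f')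
    (h : LinearMap.range f = LinearMap.range f') (g : F →ₗ[ℂ] (Fin k → ℂ)) :
    f.comp (Ring.inverse (g.comp f : Module.End ℂ (Fin k → ℂ))) =
      f'.comp (Ring.inverse (g.comp f' : Module.End ℂ (Fin k → ℂ))) := by
  obtain ⟨u, rfl⟩ := exists_unit_of_range_eq hf hf' h
  have h1 : (g.comp (f.comp (u : Module.End ℂ (Fin k → ℂ))) : Module.End ℂ (Fin k → ℂ)) =
    (g.comp f : Module.End ℂ (Fin k → ℂ)) * u := rfl
  rw [h1]
  have h2 : Ring.inverse ((g.comp f : Module.End ℂ (Fin k → ℂ)) * u) =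
      (↑u⁻¹ : Module.End ℂ (Fin k → ℂ)) * Ring.inverse (g.comp f : Module.End ℂ (Fin k → ℂ)) := by
    by_cases hg : IsUnit (g.comp f : Module.End ℂ (Fin k → ℂ))
    · obtain ⟨w, hw⟩ := hg
      rw [← hw, ← Units.val_mul, Ring.inverse_unit, Ring.inverse_unit, mul_inv_rev, Units.val_mul]
    · rw [Ring.inverse_non_unit _ hg, Ring.inverse_non_unit, mul_zero]
      rwa [Units.isUnit_mul_units]
  rw [h2, LinearMap.comp_assoc]
  congr 1
  change _ = (u : Module.End ℂ (Fin k → ℂ)) * (_ * _)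
  rw [← mul_assoc, Units.mul_inv, one_mul]

/-- The right-hand side refers only to the subspace, so the domain of a chart can be described
without frames. -/
theorem isUnit_comp_iff {k : ℕ} {F : Type} [AddCommGroup F] [Module ℂ F]
    {f : (Fin k → ℂ) →ₗ[ℂ] F} (hf : Function.Injective f) (g : F →ₗ[ℂ] (Fin k → ℂ)) :
    IsUnit (g.comp f : Module.End ℂ (Fin k → ℂ)) ↔
      ∀ x ∈ LinearMap.range f, g x = 0 → x = 0 := by
  rw [LinearMap.isUnit_iff_ker_eq_bot, LinearMap.ker_eq_bot']
  constructor
  · rintro h _ ⟨z, rfl⟩ hz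
    rw [h z hz, map_zero]
  · intro h z hz
    exact hf (by rw [h _ ⟨z, rfl⟩ hz, map_zero])

namespace FunctionSpace

variable {V : Type} [AddCommGroup V] [Module ℂ V]

/-- The point of `V × ∏ i, Gr(d i, E i)` given by a vector and a family of frames. -/
def frameMk (z : V × FrameMaps E d) (hz : ∀ i, Function.Injective (z.2 i)) :
    affineProdGrassmannians E d V :=
  (z.1, FrameMaps.span z.2 hz)

theorem exists_frameMk_eq [∀ i, FiniteDimensional ℂ (E i)] (y : affineProdGrassmannians E d V) :
    ∃ (z : V × FrameMaps E d) (hz : ∀ i, Function.Injective (z.2 i)), frameMk z hz = y := by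
  obtain ⟨r, X⟩ := y
  obtain ⟨a, ha, rfl⟩ := FrameMaps.exists_span_eq X
  exact ⟨(r, a), ha, rfl⟩

/-- A map to `V × ∏ i, Gr(d i, E i)` that lifts locally to a regular map to frames is a
morphism. -/
theorem morphAt_of_frame_lift {X : FunctionSpace} [IsLocallyRinged X]
    {φ : X → affineProdGrassmannians E d V} {x : X} {Ψ : X → V × FrameMaps E d}
    (hΨ : X.RegMapAt Ψ x)
    (h : ∀ᶠ y in 𝓝 x, ∃ hy : ∀ i, Function.Injective ((Ψ y).2 i), frameMk (Ψ y) hy = φ y) :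
    MorphAt φ x := by
  classical
  let L : Set (affineSpace (V × FrameMaps E d)) :=
    {z : V × FrameMaps E d | ∀ i, Function.Injective (z.2 i)}
  have hx : ∀ i, Function.Injective ((Ψ x).2 i) := h.self_of_nhds.1
  -- Where `Ψ` fails to give frames the value is replaced by `Ψ x`; only the germ at `x` matters.
  let Ψ' : X → (affineSpace (V × FrameMaps E d)).sub L := fun y =>
    if hy : ∀ i, Function.Injective ((Ψ y).2 i) then ⟨Ψ y, hy⟩ else ⟨Ψ x, hx⟩
  have hΨ' : X.RegMapAt (M := V × FrameMaps E d) (fun y => (Ψ' y).1) x := by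
    refine hΨ.congr ?_
    filter_upwards [h] with y hy
    have : Ψ' y = ⟨Ψ y, hy.1⟩ := dif_pos hy.1
    rw [this]
  have h1 : MorphAt Ψ' x := MorphAt.codRestrict hΨ'.morphAt
  have h2 := (MorphAt.toQuot (X := (affineSpace (V × FrameMaps E d)).sub L)
    (Q := V × GrPoint E d)
    (fun z => (z.1.1, FrameMaps.span (E := E) (d := d) z.1.2 z.2)) (Ψ' x)).comp h1
  refine h2.congr ?_
  filter_upwards [h] with y ⟨hy, hy'⟩
  have : Ψ' y = ⟨Ψ y, hy⟩ := dif_pos hy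
  rw [this, ← hy']
  rfl

/-- A subset of `V × ∏ i, Gr(d i, E i)` is open if the set of frames over it is. -/
theorem isOpen_of_frames {O : Set (affineProdGrassmannians E d V)}
    (h : ∀ (z : affineSpace (V × FrameMaps E d)) (hz : ∀ i, Function.Injective (Prod.snd z i)),
      frameMk z hz ∈ O → ∀ᶠ z' : affineSpace (V × FrameMaps E d) in 𝓝 z,
        ∀ hz' : ∀ i, Function.Injective (Prod.snd z' i), frameMk z' hz' ∈ O) : IsOpen O := by
  refine isOpen_quot_iff.2 (isOpen_iff_mem_nhds.2 ?_)
  rintro ⟨z, hz⟩ hzO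
  have h1 := (MorphAt.subVal (X := affineSpace (V × FrameMaps E d)) _ ⟨z, hz⟩).1.eventually
    (h z hz hzO)
  filter_upwards [h1] with z' hz'
  exact hz' z'.2

/-- A map from an open subset of `V × ∏ i, Gr(d i, E i)` that is a morphism on frames is a
morphism. -/
theorem morphAt_of_frames {Z : FunctionSpace} {O : Set (affineProdGrassmannians E d V)}
    (hO : IsOpen O) {φ : affineProdGrassmannians E d V → Z} {Ψ : affineSpace (V × FrameMaps E d) → Z}
    (h : ∀ (z : affineSpace (V × FrameMaps E d)) (hz : ∀ i, Function.Injective (Prod.snd z i)),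
      frameMk z hz ∈ O → MorphAt Ψ z)
    (hφ : ∀ (z : V × FrameMaps E d) (hz : ∀ i, Function.Injective (z.2 i)),
      φ (frameMk z hz) = Ψ z) {y : affineProdGrassmannians E d V} (hy : y ∈ O) : MorphAt φ y := by
  refine MorphAt.quotLift hO (fun z hz => ?_) hy
  exact ((h z.1 z.2 hz).comp (MorphAt.subVal _ z)).congr
    (Eventually.of_forall fun y => (hφ y.1 y.2).symm)

end FunctionSpace

end Frames

/-! ### Vector bundles over flag varieties

Let `E i`, `i : I₀ ⊕ I₁`, be vector spaces with `E β = N β ⊕ ⨁_{h : H β} E (t h)` for `β : I₁`.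
The flag variety of all families `X i ⊆ E i` with `X β ⊆ N β ⊕ ⨁_h X (t h)` carries the vector
bundle of all families of maps `A α → X α`, `M β → X β`. -/

namespace FlagBundle

open FunctionSpace

variable {I₀ I₁ : Type} {H : I₁ → Type} {t : ∀ β, H β → I₀} {E : I₀ ⊕ I₁ → Type}
  [∀ i, AddCommGroup (E i)] [∀ i, Module ℂ (E i)]
  {N : I₁ → Type} [∀ β, AddCommGroup (N β)] [∀ β, Module ℂ (N β)]
  (e : ∀ β, E (.inr β) ≃ₗ[ℂ] N β × (∀ h : H β, E (.inl (t β h))))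
  {A : I₀ → Type} [∀ α, AddCommGroup (A α)] [∀ α, Module ℂ (A α)]
  {M : I₁ → Type} [∀ β, AddCommGroup (M β)] [∀ β, Module ℂ (M β)]
  {V : Type} [AddCommGroup V] [Module ℂ V]
  (ρ : V ≃ₗ[ℂ] (∀ α, A α →ₗ[ℂ] E (.inl α)) × (∀ β, M β →ₗ[ℂ] E (.inr β)))
  (v : I₀ ⊕ I₁ → ℕ)

variable (t N) in
/-- The space `N β ⊕ ⨁_h ℂ ^ v (t h)`. -/
abbrev Middle (β : I₁) : Type := N β × (∀ h : H β, Fin (v (.inl (t β h))) → ℂ)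

variable {v}

/-- The map `N β ⊕ ⨁_h ℂ ^ v (t h) → E β` given by maps `ℂ ^ v α → E α`. -/
def up (a : ∀ α, (Fin (v (.inl α)) → ℂ) →ₗ[ℂ] E (.inl α)) (β : I₁) :
    Middle t N v β →ₗ[ℂ] E (.inr β) :=
  (e β).symm.toLinearMap.comp ((LinearMap.fst ℂ _ _).prod
    (LinearMap.pi fun h => (a (t β h)).comp ((LinearMap.proj h).comp (LinearMap.snd ℂ _ _))))

/-- The map `E β → N β ⊕ ⨁_h ℂ ^ v (t h)` given by maps `E α → ℂ ^ v α`. -/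
def down (p : ∀ α, E (.inl α) →ₗ[ℂ] (Fin (v (.inl α)) → ℂ)) (β : I₁) :
    E (.inr β) →ₗ[ℂ] Middle t N v β :=
  ((LinearMap.fst ℂ _ _).prod (LinearMap.pi fun h => (p (t β h)).comp
    ((LinearMap.proj h).comp (LinearMap.snd ℂ _ _)))).comp (e β).toLinearMap

theorem e_up (a : ∀ α, (Fin (v (.inl α)) → ℂ) →ₗ[ℂ] E (.inl α)) (β : I₁)
    (z : Middle t N v β) : e β (up e a β z) = (z.1, fun h => a (t β h) (z.2 h)) := by
  simp only [up, LinearMap.comp_apply, LinearEquiv.coe_coe, LinearEquiv.apply_symm_apply]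
  rfl

theorem down_apply (p : ∀ α, E (.inl α) →ₗ[ℂ] (Fin (v (.inl α)) → ℂ)) (β : I₁)
    (x : E (.inr β)) : down e p β x = ((e β x).1, fun h => p (t β h) ((e β x).2 h)) := rfl

variable {p : ∀ α, E (.inl α) →ₗ[ℂ] (Fin (v (.inl α)) → ℂ)}
  {a : ∀ α, (Fin (v (.inl α)) → ℂ) →ₗ[ℂ] E (.inl α)}

theorem down_up (hpa : ∀ α z, p α (a α z) = z) (β : I₁) (z : Middle t N v β) :
    down e p β (up e a β z) = z := by
  rw [down_apply, e_up]
  simp [hpa]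

theorem up_injective (ha : ∀ α, Function.Injective (a α)) (β : I₁) :
    Function.Injective (up e a β) := by
  intro z z' h
  have h1 := congrArg (e β) h
  rw [e_up, e_up, Prod.mk.injEq] at h1
  exact Prod.ext h1.1 (funext fun h => ha _ (congrFun h1.2 h))

/-- This is where the flag condition enters: vectors of `X β` have components in the `X (t h)`, so
their coordinates in `Middle` lose nothing. -/
theorem up_down (hpa : ∀ α z, p α (a α z) = z) {β : I₁} {x : E (.inr β)}
    (hx : ∀ h, (e β x).2 h ∈ LinearMap.range (a (t β h))) : up e a β (down e p β x) = x := by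
  apply (e β).injective
  rw [e_up, down_apply]
  refine Prod.ext rfl (funext fun h => ?_)
  obtain ⟨z, hz⟩ := hx h
  simp only [← hz, hpa]

variable (t E N A M v) in
/-- Families of frames, with coordinates of the maps `A α → X α`, `M β → X β`. -/
abbrev Param : Type :=
  (∀ α, (Fin (v (.inl α)) → ℂ) →ₗ[ℂ] E (.inl α)) ×
  (∀ β, (Fin (v (.inr β)) → ℂ) →ₗ[ℂ] Middle t N v β) ×
  (∀ α, A α →ₗ[ℂ] (Fin (v (.inl α)) → ℂ)) ×
  (∀ β, M β →ₗ[ℂ] (Fin (v (.inr β)) → ℂ))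

/-- The frames of a parameter. -/
def frameOf (x : Param t E N A M v) : FrameMaps E v
  | .inl α => x.1 α
  | .inr β => (up e x.1 β).comp (x.2.1 β)

/-- The vector in `V` of a parameter. -/
def repOf (x : Param t E N A M v) : V :=
  ρ.symm (fun α => (x.1 α).comp (x.2.2.1 α),
    fun β => ((up e x.1 β).comp (x.2.1 β)).comp (x.2.2.2 β))

theorem frameOf_injective {x : Param t E N A M v} (h₀ : ∀ α, Function.Injective (x.1 α))
    (h₁ : ∀ β, Function.Injective (x.2.1 β)) : ∀ i, Function.Injective (frameOf e x i)
  | .inl α => h₀ α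
  | .inr β => (up_injective e h₀ β).comp (h₁ β)

/-- The flag condition `X β ⊆ N β ⊕ ⨁_h X (t h)`. -/
def Flag (X : GrPoint E v) : Prop :=
  ∀ β, ∀ z ∈ X.1 (.inr β), ∀ h, (e β z).2 h ∈ X.1 (.inl (t β h))

variable (v) in
/-- The total space of the bundle. -/
def bundleSet : Set (affineProdGrassmannians E v V) :=
  {z : V × GrPoint E v | Flag e z.2 ∧ (∀ α, LinearMap.range ((ρ z.1).1 α) ≤ z.2.1 (.inl α)) ∧
    ∀ β, LinearMap.range ((ρ z.1).2 β) ≤ z.2.1 (.inr β)}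

variable (v) in
/-- The bundle as a function space. -/
def bundle : FunctionSpace := (affineProdGrassmannians E v V).sub (bundleSet e ρ v)

/-- The frame of `X β` factors through `up`, which builds in the flag condition, and the linear maps
factor through the frames. -/
theorem frameMk_mem_bundleSet (x : Param t E N A M v) (h : ∀ i, Function.Injective (frameOf e x i)) :
    frameMk (repOf e ρ x, frameOf e x) h ∈ bundleSet e ρ v := by
  refine ⟨?_, ?_, ?_⟩
  · rintro β _ ⟨z, rfl⟩ h
    change (e β (up e x.1 β (x.2.1 β z))).2 h ∈ LinearMap.range (x.1 (t β h))
    rw [e_up]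
    exact ⟨_, rfl⟩
  · intro α
    change LinearMap.range ((ρ (ρ.symm _)).1 α) ≤ LinearMap.range (x.1 α)
    rw [LinearEquiv.apply_symm_apply]
    exact LinearMap.range_comp_le_range _ _
  · intro β
    change LinearMap.range ((ρ (ρ.symm _)).2 β) ≤ LinearMap.range ((up e x.1 β).comp (x.2.1 β))
    rw [LinearEquiv.apply_symm_apply]
    exact LinearMap.range_comp_le_range _ _

/-- The point of the bundle given by a parameter. -/
def pointOf (x : Param t E N A M v) (h : ∀ i, Function.Injective (frameOf e x i)) :
    bundle e ρ v :=
  ⟨frameMk (repOf e ρ x, frameOf e x) h, frameMk_mem_bundleSet e ρ x h⟩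

section Regular

variable [∀ β, Finite (H β)] [∀ i, FiniteDimensional ℂ (E i)] [∀ β, FiniteDimensional ℂ (N β)]

theorem regMapAt_up {X : FunctionSpace} {x : X}
    {a : X → ∀ α, (Fin (v (.inl α)) → ℂ) →ₗ[ℂ] E (.inl α)} (h : X.RegMapAt a x) (β : I₁) :
    X.RegMapAt (fun y => up e (a y) β) x :=
  RegMapAt.linComp (.const _ x) (RegMapAt.linProd (.const _ x) (RegMapAt.linPi fun _ =>
    RegMapAt.linComp (h.apply _) (.const _ x)))

variable [Finite I₀] [Finite I₁]

theorem regMapAt_frameOf {X : FunctionSpace} {x : X} {Ψ : X → Param t E N A M v}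
    (h : X.RegMapAt Ψ x) : X.RegMapAt (fun y => frameOf e (Ψ y)) x := by
  refine RegMapAt.pi fun i => ?_
  cases i with
  | inl α => exact h.fst.apply α
  | inr β => exact RegMapAt.linComp (regMapAt_up e h.fst β) (h.snd.fst.apply β)

variable [∀ α, FiniteDimensional ℂ (A α)] [∀ β, FiniteDimensional ℂ (M β)]

theorem regMapAt_repOf {X : FunctionSpace} {x : X} {Ψ : X → Param t E N A M v}
    (h : X.RegMapAt Ψ x) : X.RegMapAt (fun y => repOf e ρ (Ψ y)) x := by
  refine RegMapAt.linear (RegMapAt.prodMk (RegMapAt.pi fun α => ?_) (RegMapAt.pi fun β => ?_))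
    ρ.symm.toLinearMap
  · exact RegMapAt.linComp (h.fst.apply α) (h.snd.snd.fst.apply α)
  · exact RegMapAt.linComp (RegMapAt.linComp (regMapAt_up e h.fst β) (h.snd.fst.apply β))
      (h.snd.snd.snd.apply β)

theorem morphAt_pointOf {X : FunctionSpace} [IsLocallyRinged X] {x : X}
    {Ψ : X → Param t E N A M v} (h : X.RegMapAt Ψ x)
    (hΨ : ∀ y i, Function.Injective (frameOf e (Ψ y) i)) :
    MorphAt (fun y => pointOf e ρ (Ψ y) (hΨ y)) x :=
  MorphAt.codRestrict (morphAt_of_frame_lift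
    ((regMapAt_repOf e ρ h).prodMk (regMapAt_frameOf e h))
    (Eventually.of_forall fun y => ⟨hΨ y, rfl⟩))

end Regular

/-! #### Charts -/

section Chart

variable (p a) (q : ∀ β, Middle t N v β →ₗ[ℂ] (Fin (v (.inr β)) → ℂ))
  (b : ∀ β, (Fin (v (.inr β)) → ℂ) →ₗ[ℂ] Middle t N v β)

variable (A M) in
/-- The model space of the chart given by left inverses `p`, `q` of frames. -/
abbrev ChartModel : Type :=
  (∀ α, (Fin (v (.inl α)) → ℂ) →ₗ[ℂ] LinearMap.ker (p α)) ×
  (∀ β, (Fin (v (.inr β)) → ℂ) →ₗ[ℂ] LinearMap.ker (q β)) ×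
  (∀ α, A α →ₗ[ℂ] (Fin (v (.inl α)) → ℂ)) ×
  (∀ β, M β →ₗ[ℂ] (Fin (v (.inr β)) → ℂ))

/-- The parameter of a point of the model space. -/
def chartParam (x : ChartModel A M p q) : Param t E N A M v :=
  (fun α => a α + (LinearMap.ker (p α)).subtype.comp (x.1 α),
    fun β => b β + (LinearMap.ker (q β)).subtype.comp (x.2.1 β), x.2.2.1, x.2.2.2)

variable {p a q b}

/-- The projection to the kernel of `p` along the image of a right inverse of `p`. -/
def kerProj {F K : Type} [AddCommGroup F] [Module ℂ F] [AddCommGroup K] [Module ℂ K]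
    (p : F →ₗ[ℂ] K) (a : K →ₗ[ℂ] F) (h : ∀ z, p (a z) = z) : F →ₗ[ℂ] LinearMap.ker p :=
  LinearMap.codRestrict _ (LinearMap.id - a.comp p) fun x => by simp [h]

theorem p_chartParam (hpa : ∀ α z, p α (a α z) = z) (x : ChartModel A M p q) (α : I₀) (z : Fin (v (.inl α)) → ℂ) :
    p α ((chartParam p a q b x).1 α z) = z := by
  have := (x.1 α z).2
  rw [LinearMap.mem_ker] at this
  simp [chartParam, hpa, this]

theorem q_chartParam (hqb : ∀ β z, q β (b β z) = z) (x : ChartModel A M p q) (β : I₁) (z : Fin (v (.inr β)) → ℂ) :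
    q β ((chartParam p a q b x).2.1 β z) = z := by
  have := (x.2.1 β z).2
  rw [LinearMap.mem_ker] at this
  simp only [chartParam, LinearMap.add_apply, map_add, hqb]
  change z + q β ((x.2.1 β z : _)) = z
  rw [this, add_zero]

theorem frameOf_chartParam_injective (hpa : ∀ α z, p α (a α z) = z) (hqb : ∀ β z, q β (b β z) = z)
    (x : ChartModel A M p q) :
    ∀ i, Function.Injective (frameOf e (chartParam p a q b x) i) :=
  frameOf_injective e (fun α => Function.LeftInverse.injective (p_chartParam hpa x α))
    fun β => Function.LeftInverse.injective (q_chartParam hqb x β)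

/-- The coordinates of a point in a chart, computed from frames. -/
noncomputable def chartCoord (hpa : ∀ α z, p α (a α z) = z) (hqb : ∀ β z, q β (b β z) = z)
    (z : V × FrameMaps E v) : ChartModel A M p q :=
  (fun α => (kerProj (p α) (a α) (hpa α)).comp ((z.2 (.inl α)).comp
      (Ring.inverse ((p α).comp (z.2 (.inl α)) : Module.End ℂ (Fin (v (.inl α)) → ℂ)))),
    fun β => ((kerProj (q β) (b β) (hqb β)).comp (down e p β)).comp ((z.2 (.inr β)).comp
      (Ring.inverse (((q β).comp (down e p β)).comp (z.2 (.inr β)) :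
        Module.End ℂ (Fin (v (.inr β)) → ℂ)))),
    fun α => (p α).comp ((ρ z.1).1 α), fun β => ((q β).comp (down e p β)).comp ((ρ z.1).2 β))

/-- Only normalised frames enter the coordinates, so these descend from frames to subspaces. -/
theorem chartCoord_eq (hpa : ∀ α z, p α (a α z) = z) (hqb : ∀ β z, q β (b β z) = z)
    {z z' : V × FrameMaps E v} (hz : ∀ i, Function.Injective (z.2 i))
    (hz' : ∀ i, Function.Injective (z'.2 i)) (h : frameMk z hz = frameMk z' hz') :
    chartCoord e ρ hpa hqb z = chartCoord e ρ hpa hqb z' := by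
  have h1 : z.1 = z'.1 := congrArg (fun y : V × GrPoint E v => y.1) h
  have h2 : ∀ i, LinearMap.range (z.2 i) = LinearMap.range (z'.2 i) := fun i =>
    congrArg (fun y : V × GrPoint E v => y.2.1 i) h
  unfold chartCoord
  rw [h1]
  refine Prod.ext (funext fun α => ?_) (Prod.ext (funext fun β => ?_) rfl)
  · exact congrArg (LinearMap.comp _) (comp_inverse_eq_of_range_eq (hz _) (hz' _) (h2 _) _)
  · exact congrArg (LinearMap.comp _) (comp_inverse_eq_of_range_eq (hz _) (hz' _) (h2 _) _)

variable (V p q) in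
/-- The domain of a chart. -/
def chartDomain : Set (affineProdGrassmannians E v V) :=
  {z : V × GrPoint E v | (∀ α, ∀ x ∈ z.2.1 (.inl α), p α x = 0 → x = 0) ∧
    ∀ β, ∀ x ∈ z.2.1 (.inr β), (q β).comp (down e p β) x = 0 → x = 0}

theorem frameMk_mem_chartDomain {z : V × FrameMaps E v} (hz : ∀ i, Function.Injective (z.2 i)) :
    frameMk z hz ∈ chartDomain e V p q ↔
      (∀ α, IsUnit ((p α).comp (z.2 (.inl α)) : Module.End ℂ (Fin (v (.inl α)) → ℂ))) ∧
      ∀ β, IsUnit (((q β).comp (down e p β)).comp (z.2 (.inr β)) :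
        Module.End ℂ (Fin (v (.inr β)) → ℂ)) :=
  and_congr (forall_congr' fun _ => (isUnit_comp_iff (hz _) _).symm)
    (forall_congr' fun _ => (isUnit_comp_iff (hz _) _).symm)

theorem frameMk_chartParam_mem_chartDomain (hpa : ∀ α z, p α (a α z) = z) (hqb : ∀ β z, q β (b β z) = z)
    (x : ChartModel A M p q) :
    frameMk (repOf e ρ (chartParam p a q b x), frameOf e (chartParam p a q b x))
      (frameOf_chartParam_injective e hpa hqb x) ∈ chartDomain e V p q := by
  rw [frameMk_mem_chartDomain]
  refine ⟨fun α => ?_, fun β => ?_⟩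
  · have : (p α).comp (frameOf e (chartParam p a q b x) (.inl α)) = LinearMap.id :=
      LinearMap.ext (p_chartParam hpa x α)
    rw [this]
    exact isUnit_one
  · have : ((q β).comp (down e p β)).comp (frameOf e (chartParam p a q b x) (.inr β)) =
        LinearMap.id := LinearMap.ext fun z => by
      change q β (down e p β (up e _ β _)) = z
      rw [down_up e (p_chartParam hpa x), q_chartParam hqb x]
    rw [this]
    exact isUnit_one

/-- Frames coming from the model space are already normalised, so the inverses are trivial and the
kernel projections return the kernel components. -/
theorem chartCoord_chartParam (hpa : ∀ α z, p α (a α z) = z) (hqb : ∀ β z, q β (b β z) = z)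
    (x : ChartModel A M p q) :
    chartCoord e ρ hpa hqb (repOf e ρ (chartParam p a q b x), frameOf e (chartParam p a q b x)) =
      x := by
  have hp : ∀ α, (p α).comp (frameOf e (chartParam p a q b x) (.inl α)) = LinearMap.id :=
    fun α => LinearMap.ext (p_chartParam hpa x α)
  have hq : ∀ β, ((q β).comp (down e p β)).comp (frameOf e (chartParam p a q b x) (.inr β)) =
      LinearMap.id := fun β => LinearMap.ext fun z => by
    change q β (down e p β (up e _ β _)) = z
    rw [down_up e (p_chartParam hpa x), q_chartParam hqb x]
  have hinv : ∀ k : ℕ, Ring.inverse (LinearMap.id : Module.End ℂ (Fin k → ℂ)) = LinearMap.id :=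
    fun k => Ring.inverse_one _
  simp only [chartCoord, hp, hq, hinv, LinearMap.comp_id, repOf, LinearEquiv.apply_symm_apply]
  refine Prod.ext (funext fun α => LinearMap.ext fun z => Subtype.ext ?_)
    (Prod.ext (funext fun β => LinearMap.ext fun z => Subtype.ext ?_)
      (Prod.ext (funext fun α => LinearMap.ext fun z => ?_)
        (funext fun β => LinearMap.ext fun z => ?_)))
  · change (chartParam p a q b x).1 α z - a α (p α ((chartParam p a q b x).1 α z)) = _
    rw [p_chartParam hpa]
    simp [chartParam]
  · change down e p β (up e _ β ((chartParam p a q b x).2.1 β z)) -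
      b β (q β (down e p β (up e _ β ((chartParam p a q b x).2.1 β z)))) = _
    rw [down_up e (p_chartParam hpa x), q_chartParam hqb]
    simp [chartParam]
  · exact p_chartParam (b := b) hpa x α _
  · change q β (down e p β (up e _ β ((chartParam p a q b x).2.1 β (x.2.2.2 β z)))) = _
    rw [down_up e (p_chartParam hpa x), q_chartParam hqb]

/-- Normalising does not change the spanned subspaces, and the linear maps are recovered from their
coordinates because they land in those subspaces. -/
theorem chartParam_chartCoord (hpa : ∀ α z, p α (a α z) = z) (hqb : ∀ β z, q β (b β z) = z)
    {z : V × FrameMaps E v} (hz : ∀ i, Function.Injective (z.2 i))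
    (hzO : frameMk z hz ∈ chartDomain e V p q) (hzS : frameMk z hz ∈ bundleSet e ρ v) :
    frameMk (repOf e ρ (chartParam p a q b (chartCoord e ρ hpa hqb z)),
      frameOf e (chartParam p a q b (chartCoord e ρ hpa hqb z)))
      (frameOf_chartParam_injective e hpa hqb _) = frameMk z hz := by
  obtain ⟨r, f⟩ := z
  obtain ⟨hP, hQ⟩ := (frameMk_mem_chartDomain e hz).1 hzO
  obtain ⟨hflag, hA, hM⟩ := hzS
  choose P hP using hP
  choose Q hQ using hQ
  set x := chartParam p a q b (chartCoord e ρ hpa hqb (r, f)) with hx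
  -- Adding `a` to the kernel projection restores the normalised frame, whose `p`-component is the
  -- identity.
  have hx₁ : ∀ α, x.1 α = (f (.inl α)).comp (↑(P α)⁻¹ : Module.End ℂ (Fin (v (.inl α)) → ℂ)) := by
    intro α
    refine LinearMap.ext fun z => ?_
    have h1 : p α (f (.inl α) ((↑(P α)⁻¹ : Module.End ℂ (Fin (v (.inl α)) → ℂ)) z)) = z := by
      have h2 := LinearMap.congr_fun (P α).mul_inv z
      rw [hP] at h2
      exact h2
    change a α z + (_ - a α (p α _)) = _
    rw [← hP, Ring.inverse_unit]
    simp only [LinearMap.comp_apply, LinearMap.id_apply]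
    rw [h1]
    abel
  have hpx : ∀ α z, p α (x.1 α z) = z := p_chartParam hpa _
  have hqx : ∀ β z, q β (x.2.1 β z) = z := q_chartParam hqb _
  have hr₀ : ∀ α, LinearMap.range (x.1 α) = LinearMap.range (f (.inl α)) := by
    intro α
    rw [hx₁]
    refine LinearMap.range_comp_of_range_eq_top _ (LinearMap.range_eq_top.2 ?_)
    exact ((Module.End.isUnit_iff _).1 (P α)⁻¹.isUnit).2
  -- Normalisation preserved the range over each `α`, so the flag condition for `f` is the one
  -- required by `up_down`.
  have hud : ∀ β, ∀ y ∈ LinearMap.range (f (.inr β)), up e x.1 β (down e p β y) = y := by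
    intro β y hy
    refine up_down e hpx fun h => ?_
    rw [hr₀]
    exact hflag β y hy h
  have hx₂ : ∀ β, x.2.1 β = (down e p β).comp ((f (.inr β)).comp
      (↑(Q β)⁻¹ : Module.End ℂ (Fin (v (.inr β)) → ℂ))) := by
    intro β
    refine LinearMap.ext fun z => ?_
    have h1 : q β (down e p β (f (.inr β)
        ((↑(Q β)⁻¹ : Module.End ℂ (Fin (v (.inr β)) → ℂ)) z))) = z := by
      have h2 := LinearMap.congr_fun (Q β).mul_inv z
      rw [hQ] at h2
      exact h2
    change b β z + (down e p β _ - b β (q β (down e p β _))) = _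
    rw [← hQ, Ring.inverse_unit]
    simp only [LinearMap.comp_apply]
    rw [h1]
    abel
  have hf₁ : ∀ β, (up e x.1 β).comp (x.2.1 β) =
      (f (.inr β)).comp (↑(Q β)⁻¹ : Module.End ℂ (Fin (v (.inr β)) → ℂ)) := by
    intro β
    rw [hx₂]
    exact LinearMap.ext fun z => hud β _ ⟨_, rfl⟩
  have hr₁ : ∀ β, LinearMap.range ((up e x.1 β).comp (x.2.1 β)) =
      LinearMap.range (f (.inr β)) := by
    intro β
    rw [hf₁]
    refine LinearMap.range_comp_of_range_eq_top _ (LinearMap.range_eq_top.2 ?_)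
    exact ((Module.End.isUnit_iff _).1 (Q β)⁻¹.isUnit).2
  have hrep : repOf e ρ x = r := by
    rw [repOf, LinearEquiv.symm_apply_eq]
    refine Prod.ext (funext fun α => LinearMap.ext fun z => ?_)
      (funext fun β => LinearMap.ext fun z => ?_)
    · change x.1 α (p α ((ρ r).1 α z)) = _
      obtain ⟨y, hy⟩ : (ρ r).1 α z ∈ LinearMap.range (x.1 α) := by
        rw [hr₀]
        exact hA α ⟨z, rfl⟩
      rw [← hy, hpx]
    · change up e x.1 β (x.2.1 β (q β (down e p β ((ρ r).2 β z)))) = _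
      obtain ⟨y, hy⟩ : (ρ r).2 β z ∈ LinearMap.range ((up e x.1 β).comp (x.2.1 β)) := by
        rw [hr₁]
        exact hM β ⟨z, rfl⟩
      rw [← hy, LinearMap.comp_apply, down_up e hpx, hqx]
  have hfr : ∀ i, LinearMap.range (frameOf e x i) = LinearMap.range (f i)
    | .inl α => hr₀ α
    | .inr β => hr₁ β
  exact Prod.ext (α := V) (β := GrPoint E v) hrep (Subtype.ext (funext hfr))

section Regular

variable [Finite I₀] [Finite I₁] [∀ i, FiniteDimensional ℂ (E i)]

theorem isOpen_chartDomain : IsOpen (chartDomain e V p q) := by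
  refine isOpen_of_frames fun z hz hzO => ?_
  obtain ⟨hP, hQ⟩ := (frameMk_mem_chartDomain e hz).1 hzO
  have h : (affineSpace (V × FrameMaps E v)).RegMapAt (fun y : V × FrameMaps E v => y) z :=
    regMapAt_id _
  have h1 : ∀ᶠ y : affineSpace (V × FrameMaps E v) in 𝓝 z, ∀ α,
      IsUnit ((p α).comp (Prod.snd y (.inl α)) : Module.End ℂ (Fin (v (.inl α)) → ℂ)) :=
    eventually_all.2 fun α => RegMapAt.eventually_isUnit
      (RegMapAt.linComp (.const (p α) z) (h.snd.apply (.inl α))) (hP α)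
  have h2 : ∀ᶠ y : affineSpace (V × FrameMaps E v) in 𝓝 z, ∀ β,
      IsUnit (((q β).comp (down e p β)).comp (Prod.snd y (.inr β)) :
        Module.End ℂ (Fin (v (.inr β)) → ℂ)) :=
    eventually_all.2 fun β => RegMapAt.eventually_isUnit
      (RegMapAt.linComp (.const ((q β).comp (down e p β)) z) (h.snd.apply (.inr β))) (hQ β)
  filter_upwards [h1, h2] with y hy1 hy2 hy
  exact (frameMk_mem_chartDomain e hy).2 ⟨hy1, hy2⟩

variable [∀ β, Finite (H β)] [∀ β, FiniteDimensional ℂ (N β)]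

theorem regMapAt_chartParam {X : FunctionSpace} {x : X} {Ψ : X → ChartModel A M p q}
    (h : X.RegMapAt Ψ x) : X.RegMapAt (fun y => chartParam p a q b (Ψ y)) x :=
  RegMapAt.prodMk (RegMapAt.pi fun α => RegMapAt.add (.const _ x)
      (RegMapAt.linComp (.const _ x) (h.fst.apply α)))
    (RegMapAt.prodMk (RegMapAt.pi fun β => RegMapAt.add (.const _ x)
      (RegMapAt.linComp (.const _ x) (h.snd.fst.apply β))) h.snd.snd)

variable [∀ α, FiniteDimensional ℂ (A α)] [∀ β, FiniteDimensional ℂ (M β)]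

theorem regMapAt_chartCoord (hpa : ∀ α z, p α (a α z) = z) (hqb : ∀ β z, q β (b β z) = z)
    {z : affineSpace (V × FrameMaps E v)} (hz : ∀ i, Function.Injective (Prod.snd z i))
    (hzO : frameMk z hz ∈ chartDomain e V p q) :
    (affineSpace (V × FrameMaps E v)).RegMapAt (chartCoord e ρ hpa hqb) z := by
  obtain ⟨hP, hQ⟩ := (frameMk_mem_chartDomain e hz).1 hzO
  have h : (affineSpace (V × FrameMaps E v)).RegMapAt (fun y : V × FrameMaps E v => y) z :=
    regMapAt_id _
  have hρ := h.fst.linear ρ.toLinearMap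
  refine RegMapAt.prodMk (RegMapAt.pi fun α => ?_) (RegMapAt.prodMk (RegMapAt.pi fun β => ?_)
    (RegMapAt.prodMk (RegMapAt.pi fun α => ?_) (RegMapAt.pi fun β => ?_)))
  · exact RegMapAt.linComp (.const _ z) (RegMapAt.linComp (h.snd.apply (.inl α))
      (RegMapAt.ringInverse (RegMapAt.linComp (.const (p α) z) (h.snd.apply (.inl α))) (hP α)))
  · exact RegMapAt.linComp (.const _ z) (RegMapAt.linComp (h.snd.apply (.inr β))
      (RegMapAt.ringInverse (RegMapAt.linComp (.const ((q β).comp (down e p β)) z)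
        (h.snd.apply (.inr β))) (hQ β)))
  · exact RegMapAt.linComp (.const _ z) (hρ.fst.apply α)
  · exact RegMapAt.linComp (.const _ z) (hρ.snd.apply β)

/-- The chart given by left inverses of frames. -/
noncomputable def chart (hpa : ∀ α z, p α (a α z) = z) (hqb : ∀ β z, q β (b β z) = z) :
    AffineChart (bundle e ρ v) (ChartModel A M p q) where
  toFun x := pointOf e ρ (chartParam p a q b x) (frameOf_chartParam_injective e hpa hqb x)
  -- The choice of frame is immaterial by `chartCoord_eq`.
  invFun y := chartCoord e ρ hpa hqb (exists_frameMk_eq y.1).choose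
  target := Subtype.val ⁻¹' chartDomain e V p q
  isOpen_target := (isOpen_chartDomain e).preimage continuous_subtype_val
  mapsTo x := frameMk_chartParam_mem_chartDomain e ρ hpa hqb x
  left_inv x := by
    obtain ⟨h1, h2⟩ := (exists_frameMk_eq (pointOf e ρ (chartParam p a q b x)
      (frameOf_chartParam_injective e hpa hqb x)).1).choose_spec
    exact (chartCoord_eq e ρ hpa hqb h1 _ h2).trans (chartCoord_chartParam e ρ hpa hqb x)
  right_inv y hy := by
    obtain ⟨h1, h2⟩ := (exists_frameMk_eq y.1).choose_spec
    refine Subtype.ext ?_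
    refine (chartParam_chartCoord e ρ hpa hqb h1 ?_ ?_).trans h2
    · rw [h2]
      exact hy
    · rw [h2]
      exact y.2
  morphAt_toFun x := morphAt_pointOf e ρ (regMapAt_chartParam (regMapAt_id _))
    (frameOf_chartParam_injective e hpa hqb)
  morphAt_invFun y hy := by
    refine MorphAt.comp (Z := affineSpace (ChartModel A M p q))
      (ψ := fun y : affineProdGrassmannians E v V =>
        chartCoord e ρ hpa hqb (exists_frameMk_eq y).choose)
      ?_ (MorphAt.subVal _ y)
    refine morphAt_of_frames (Z := affineSpace (ChartModel A M p q)) (isOpen_chartDomain e)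
      (Ψ := chartCoord (V := V) e ρ hpa hqb)
      (fun z hz hzO => (regMapAt_chartCoord e ρ hpa hqb hz hzO).morphAt) (fun z hz => ?_) hy
    obtain ⟨h1, h2⟩ := (exists_frameMk_eq (frameMk z hz)).choose_spec
    exact chartCoord_eq e ρ hpa hqb h1 hz h2

end Regular

end Chart

end FlagBundle

namespace FunctionSpace

/-- Transport of a chart along an isomorphism. -/
def AffineChart.ofIso {X Y : FunctionSpace} {T : Type} [AddCommGroup T] [Module ℂ T]
    (c : AffineChart X T) {φ : X → Y} {ψ : Y → X} (h₁ : ∀ x, ψ (φ x) = x) (h₂ : ∀ y, φ (ψ y) = y)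
    (hφ : ∀ x, MorphAt φ x) (hψ : ∀ y, MorphAt ψ y) : AffineChart Y T where
  toFun t := φ (c.toFun t)
  invFun y := c.invFun (ψ y)
  target := ψ ⁻¹' c.target
  isOpen_target := c.isOpen_target.preimage (isMorphism_iff.2 hψ).1
  mapsTo t := by simpa [h₁] using c.mapsTo t
  left_inv t := by simp [h₁, c.left_inv]
  right_inv y hy := by rw [c.right_inv _ hy, h₂]
  morphAt_toFun t := (hφ _).comp (c.morphAt_toFun t)
  morphAt_invFun y hy := (c.morphAt_invFun _ hy).comp (hψ y)

end FunctionSpace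

/-! ### Dimension counts in linear algebra -/

section LinearAlgebra

variable {F : Type} [AddCommGroup F] [Module ℂ F] [FiniteDimensional ℂ F] {k : ℕ}

theorem exists_injective_of_le_finrank (h : k ≤ Module.finrank ℂ F) :
    ∃ f : (Fin k → ℂ) →ₗ[ℂ] F, Function.Injective f := by
  refine ⟨Fintype.linearCombination ℂ (Module.finBasis ℂ F ∘ Fin.castLE h), ?_⟩
  rw [← linearIndependent_iff_injective_fintypeLinearCombination]
  exact (Module.finBasis ℂ F).linearIndependent.comp _ (Fin.castLE_injective h)

theorem exists_surjective_of_le_finrank (h : k ≤ Module.finrank ℂ F) :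
    ∃ f : F →ₗ[ℂ] (Fin k → ℂ), Function.Surjective f := by
  obtain ⟨g, hg⟩ := exists_injective_of_le_finrank h
  obtain ⟨f, hf⟩ := LinearMap.exists_leftInverse_of_injective g (LinearMap.ker_eq_bot.2 hg)
  exact ⟨f, Function.RightInverse.surjective (LinearMap.congr_fun hf)⟩

theorem finrank_ker_of_rightInverse {p : F →ₗ[ℂ] (Fin k → ℂ)} {a : (Fin k → ℂ) →ₗ[ℂ] F}
    (h : ∀ z, p (a z) = z) : (Module.finrank ℂ (LinearMap.ker p) : ℤ) = Module.finrank ℂ F - k := by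
  have h1 := LinearMap.finrank_range_add_finrank_ker p
  rw [LinearMap.range_eq_top.2 (Function.RightInverse.surjective h), finrank_top,
    Module.finrank_fin_fun] at h1
  rw [← h1]
  simp

theorem finrank_pi_linearMap {ι : Type} [Fintype ι] {F G : ι → Type} [∀ i, AddCommGroup (F i)]
    [∀ i, Module ℂ (F i)] [∀ i, FiniteDimensional ℂ (F i)] [∀ i, AddCommGroup (G i)]
    [∀ i, Module ℂ (G i)] [∀ i, FiniteDimensional ℂ (G i)] :
    (Module.finrank ℂ (∀ i, F i →ₗ[ℂ] G i) : ℤ) =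
      ∑ i, (Module.finrank ℂ (F i) : ℤ) * Module.finrank ℂ (G i) := by
  rw [Module.finrank_pi_fintype, Nat.cast_sum]
  simp [Module.finrank_linearMap]

theorem finrank_prod_four {F₁ F₂ F₃ F₄ : Type} [AddCommGroup F₁] [Module ℂ F₁] [AddCommGroup F₂]
    [Module ℂ F₂] [AddCommGroup F₃] [Module ℂ F₃] [AddCommGroup F₄] [Module ℂ F₄]
    [FiniteDimensional ℂ F₁] [FiniteDimensional ℂ F₂] [FiniteDimensional ℂ F₃]
    [FiniteDimensional ℂ F₄] : Module.finrank ℂ (F₁ × F₂ × F₃ × F₄) =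
      Module.finrank ℂ F₁ + Module.finrank ℂ F₂ + Module.finrank ℂ F₃ + Module.finrank ℂ F₄ := by
  simp [add_assoc]

end LinearAlgebra

/-! ### Chart covers, irreducibility and dimension of the bundle -/

namespace FlagBundle

open FunctionSpace

variable {I₀ I₁ : Type} {H : I₁ → Type} {t : ∀ β, H β → I₀} {E : I₀ ⊕ I₁ → Type}
  [∀ i, AddCommGroup (E i)] [∀ i, Module ℂ (E i)]
  {N : I₁ → Type} [∀ β, AddCommGroup (N β)] [∀ β, Module ℂ (N β)]
  (e : ∀ β, E (.inr β) ≃ₗ[ℂ] N β × (∀ h : H β, E (.inl (t β h))))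
  {A : I₀ → Type} [∀ α, AddCommGroup (A α)] [∀ α, Module ℂ (A α)]
  {M : I₁ → Type} [∀ β, AddCommGroup (M β)] [∀ β, Module ℂ (M β)]
  {V : Type} [AddCommGroup V] [Module ℂ V]
  (ρ : V ≃ₗ[ℂ] (∀ α, A α →ₗ[ℂ] E (.inl α)) × (∀ β, M β →ₗ[ℂ] E (.inr β)))
  {v : I₀ ⊕ I₁ → ℕ}

variable [∀ i, FiniteDimensional ℂ (E i)]

/-- Take frames `f` of the point itself and a left inverse `p` over each `α`. The coordinates of the
frame of `X β` are injective, since `up` undoes `down` on `X β`, and so have a left inverse `q`. -/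
theorem exists_mem_chartDomain {y : affineProdGrassmannians E v V} (hy : y ∈ bundleSet e ρ v) :
    ∃ (p : ∀ α, E (.inl α) →ₗ[ℂ] (Fin (v (.inl α)) → ℂ))
      (a : ∀ α, (Fin (v (.inl α)) → ℂ) →ₗ[ℂ] E (.inl α))
      (q : ∀ β, Middle t N v β →ₗ[ℂ] (Fin (v (.inr β)) → ℂ))
      (b : ∀ β, (Fin (v (.inr β)) → ℂ) →ₗ[ℂ] Middle t N v β),
      (∀ α z, p α (a α z) = z) ∧ (∀ β z, q β (b β z) = z) ∧ y ∈ chartDomain e V p q := by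
  obtain ⟨⟨r, f⟩, hf, rfl⟩ := exists_frameMk_eq y
  have hp : ∀ α, ∃ p : E (.inl α) →ₗ[ℂ] (Fin (v (.inl α)) → ℂ), p.comp (f (.inl α)) = .id :=
    fun α => LinearMap.exists_leftInverse_of_injective _ (LinearMap.ker_eq_bot.2 (hf _))
  choose p hp using hp
  have hpa : ∀ α z, p α (f (.inl α) z) = z := fun α => LinearMap.congr_fun (hp α)
  have hb : ∀ β, Function.Injective ((down e p β).comp (f (.inr β))) := by
    intro β
    refine Function.Injective.of_comp (f := up e (fun α => f (.inl α)) β) ?_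
    convert hf (.inr β) using 1
    funext z
    exact up_down e hpa fun h => hy.1 β _ ⟨z, rfl⟩ h
  have hq : ∀ β, ∃ q : Middle t N v β →ₗ[ℂ] (Fin (v (.inr β)) → ℂ),
      q.comp ((down e p β).comp (f (.inr β))) = .id :=
    fun β => LinearMap.exists_leftInverse_of_injective _ (LinearMap.ker_eq_bot.2 (hb _))
  choose q hq using hq
  refine ⟨p, fun α => f (.inl α), q, fun β => (down e p β).comp (f (.inr β)), hpa,
    fun β => LinearMap.congr_fun (hq β), ?_⟩
  rw [frameMk_mem_chartDomain]
  refine ⟨fun α => ?_, fun β => ?_⟩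
  · rw [hp]
    exact isUnit_one
  · rw [LinearMap.comp_assoc, hq]
    exact isUnit_one

theorem exists_pointOf_eq (y : bundle e ρ v) :
    ∃ (x : Param t E N A M v) (h₀ : ∀ α, Function.Injective (x.1 α))
      (h₁ : ∀ β, Function.Injective (x.2.1 β)), pointOf e ρ x (frameOf_injective e h₀ h₁) = y := by
  obtain ⟨p, a, q, b, hpa, hqb, hy⟩ := exists_mem_chartDomain e ρ y.2
  obtain ⟨z, hz, hzy⟩ := exists_frameMk_eq y.1
  refine ⟨chartParam p a q b (chartCoord e ρ hpa hqb z),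
    fun α => Function.LeftInverse.injective (p_chartParam hpa _ α),
    fun β => Function.LeftInverse.injective (q_chartParam hqb _ β), Subtype.ext ?_⟩
  refine (chartParam_chartCoord e ρ hpa hqb hz ?_ ?_).trans hzy
  · rwa [hzy]
  · rw [hzy]
    exact y.2

section Finite

variable [Fintype I₀] [Fintype I₁] [∀ β, Fintype (H β)] [∀ β, FiniteDimensional ℂ (N β)]

theorem isOpen_injective_params :
    IsOpen {x : affineSpace (Param t E N A M v) |
      (∀ α, Function.Injective (Prod.fst x α)) ∧ ∀ β, Function.Injective ((Prod.snd x).1 β)} := by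
  rw [isOpen_iff_mem_nhds]
  rintro x ⟨h₀, h₁⟩
  have h : (affineSpace (Param t E N A M v)).RegMapAt (fun y : Param t E N A M v => y) x :=
    regMapAt_id _
  have h1 : ∀ᶠ y : affineSpace (Param t E N A M v) in 𝓝 x, ∀ α,
      Function.Injective (Prod.fst y α) :=
    eventually_all.2 fun α => RegMapAt.eventually_injective (h.fst.apply α) (h₀ α)
  have h2 : ∀ᶠ y : affineSpace (Param t E N A M v) in 𝓝 x, ∀ β,
      Function.Injective ((Prod.snd y).1 β) :=
    eventually_all.2 fun β => RegMapAt.eventually_injective (h.snd.fst.apply β) (h₁ β)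
  filter_upwards [h1, h2] with y h3 h4 using ⟨h3, h4⟩

variable [∀ α, FiniteDimensional ℂ (A α)] [∀ β, FiniteDimensional ℂ (M β)]

/-- The bundle is a continuous image of the set of parameters with injective frames, a nonempty open
subset of an affine space; the two inequalities give nonemptiness. -/
theorem irreducibleSpace_bundle (h₀ : ∀ α, v (.inl α) ≤ Module.finrank ℂ (E (.inl α)))
    (h₁ : ∀ β, v (.inr β) ≤ Module.finrank ℂ (Middle t N v β)) :
    IrreducibleSpace (bundle e ρ v) := by
  let S : Set (affineSpace (Param t E N A M v)) := {x |
      (∀ α, Function.Injective (Prod.fst x α)) ∧ ∀ β, Function.Injective ((Prod.snd x).1 β)}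
  have hne : S.Nonempty := by
    choose a ha using fun α => exists_injective_of_le_finrank (h₀ α)
    choose b hb using fun β => exists_injective_of_le_finrank (h₁ β)
    exact ⟨(⟨a, b, 0, 0⟩ : Param t E N A M v), ha, hb⟩
  have hS : IsPreirreducible S := (PreirreducibleSpace.isPreirreducible_univ).open_subset
    isOpen_injective_params (subset_univ _)
  have : PreirreducibleSpace ((affineSpace (Param t E N A M v)).sub S) :=
    Subtype.preirreducibleSpace hS
  have : Nonempty ((affineSpace (Param t E N A M v)).sub S) := hne.to_subtype
  have : IrreducibleSpace ((affineSpace (Param t E N A M v)).sub S) := ⟨inferInstance⟩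
  let φ : (affineSpace (Param t E N A M v)).sub S → bundle e ρ v := fun x =>
    pointOf e ρ x.1 (frameOf_injective e x.2.1 x.2.2)
  have hφ : Continuous φ := continuous_iff_continuousAt.2 fun x =>
    (morphAt_pointOf e ρ (Ψ := fun x : (affineSpace (Param t E N A M v)).sub S => x.1)
      ((MorphAt.subVal S x).regMapAt (regMapAt_id _))
      fun x => frameOf_injective e x.2.1 x.2.2).1
  have hs : Function.Surjective φ := fun y => by
    obtain ⟨x, h1, h2, h3⟩ := exists_pointOf_eq e ρ y
    exact ⟨⟨x, h1, h2⟩, h3⟩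
  exact hs.irreducibleSpace hφ

variable (A M) in
theorem finrank_chartModel {p : ∀ α, E (.inl α) →ₗ[ℂ] (Fin (v (.inl α)) → ℂ)}
    {a : ∀ α, (Fin (v (.inl α)) → ℂ) →ₗ[ℂ] E (.inl α)}
    {q : ∀ β, Middle t N v β →ₗ[ℂ] (Fin (v (.inr β)) → ℂ)}
    {b : ∀ β, (Fin (v (.inr β)) → ℂ) →ₗ[ℂ] Middle t N v β}
    (hpa : ∀ α z, p α (a α z) = z) (hqb : ∀ β z, q β (b β z) = z) :
    (Module.finrank ℂ (ChartModel A M p q) : ℤ) =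
      ∑ α, (v (.inl α) : ℤ) * (Module.finrank ℂ (E (.inl α)) - v (.inl α)) +
      ∑ β, (v (.inr β) : ℤ) *
        (Module.finrank ℂ (N β) + ∑ h : H β, (v (.inl (t β h)) : ℤ) - v (.inr β)) +
      ∑ α, (Module.finrank ℂ (A α) : ℤ) * v (.inl α) +
      ∑ β, (Module.finrank ℂ (M β) : ℤ) * v (.inr β) := by
  have hM : ∀ β, (Module.finrank ℂ (Middle t N v β) : ℤ) =
      Module.finrank ℂ (N β) + ∑ h : H β, (v (.inl (t β h)) : ℤ) := fun β => by
    simp [Module.finrank_prod, Module.finrank_pi_fintype]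
  have h₁ : (Module.finrank ℂ (∀ α, (Fin (v (.inl α)) → ℂ) →ₗ[ℂ] LinearMap.ker (p α)) : ℤ) =
      ∑ α, (v (.inl α) : ℤ) * (Module.finrank ℂ (E (.inl α)) - v (.inl α)) := by
    simp only [finrank_pi_linearMap, Module.finrank_fin_fun, finrank_ker_of_rightInverse (hpa _)]
  have h₂ : (Module.finrank ℂ (∀ β, (Fin (v (.inr β)) → ℂ) →ₗ[ℂ] LinearMap.ker (q β)) : ℤ) =
      ∑ β, (v (.inr β) : ℤ) *
        (Module.finrank ℂ (N β) + ∑ h : H β, (v (.inl (t β h)) : ℤ) - v (.inr β)) := by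
    rw [finrank_pi_linearMap]
    refine Finset.sum_congr rfl fun β _ => ?_
    rw [Module.finrank_fin_fun, finrank_ker_of_rightInverse (hqb β), hM]
  have h₃ : (Module.finrank ℂ (∀ α, A α →ₗ[ℂ] (Fin (v (.inl α)) → ℂ)) : ℤ) =
      ∑ α, (Module.finrank ℂ (A α) : ℤ) * v (.inl α) := by
    simp only [finrank_pi_linearMap, Module.finrank_fin_fun]
  have h₄ : (Module.finrank ℂ (∀ β, M β →ₗ[ℂ] (Fin (v (.inr β)) → ℂ)) : ℤ) =
      ∑ β, (Module.finrank ℂ (M β) : ℤ) * v (.inr β) := by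
    simp only [finrank_pi_linearMap, Module.finrank_fin_fun]
  rw [← h₁, ← h₂, ← h₃, ← h₄]
  have h := finrank_prod_four (F₁ := ∀ α, (Fin (v (.inl α)) → ℂ) →ₗ[ℂ] LinearMap.ker (p α))
    (F₂ := ∀ β, (Fin (v (.inr β)) → ℂ) →ₗ[ℂ] LinearMap.ker (q β))
    (F₃ := ∀ α, A α →ₗ[ℂ] (Fin (v (.inl α)) → ℂ)) (F₄ := ∀ β, M β →ₗ[ℂ] (Fin (v (.inr β)) → ℂ))
  rw [h]
  push_cast
  rfl

/-- The polynomial map `θ` is recorded because it parametrises a dense part of the affine quiver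
variety in the dimension estimate. -/
theorem exists_chart (y : bundle e ρ v) :
    ∃ (T : Type) (_ : AddCommGroup T) (_ : Module ℂ T) (_ : FiniteDimensional ℂ T)
      (c : AffineChart (bundle e ρ v) T), y ∈ c.target ∧
      (∃ θ : T → V, (∀ p ∈ polyFun V, p ∘ θ ∈ polyFun T) ∧ ∀ x : T, (c.toFun x).1.1 = θ x) ∧
      (Module.finrank ℂ T : ℤ) =
        ∑ α, (v (.inl α) : ℤ) * (Module.finrank ℂ (E (.inl α)) - v (.inl α)) +
        ∑ β, (v (.inr β) : ℤ) *
          (Module.finrank ℂ (N β) + ∑ h : H β, (v (.inl (t β h)) : ℤ) - v (.inr β)) +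
        ∑ α, (Module.finrank ℂ (A α) : ℤ) * v (.inl α) +
        ∑ β, (Module.finrank ℂ (M β) : ℤ) * v (.inr β) := by
  obtain ⟨p, a, q, b, hpa, hqb, hy⟩ := exists_mem_chartDomain e ρ y.2
  refine ⟨ChartModel A M p q, inferInstance, inferInstance, inferInstance, chart e ρ hpa hqb, hy,
    ⟨fun x => repOf e ρ (chartParam p a q b x), fun P hP => ?_, fun x => rfl⟩,
    finrank_chartModel A M hpa hqb⟩
  exact RegMapAt.polyFun_comp (x := 0) (regMapAt_repOf e ρ (X := polySpace (ChartModel A M p q))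
    (regMapAt_chartParam (regMapAt_polySpace_id _))) hP

end Finite

end FlagBundle

/-! ### Morphisms between the Grassmannians and their product with a vector space -/

namespace FunctionSpace

section

variable {ι : Type} {E : ι → Type} [∀ i, AddCommGroup (E i)] [∀ i, Module ℂ (E i)]
  {d : ι → ℕ} {V : Type} [AddCommGroup V] [Module ℂ V]

theorem morphAt_affineProdGrassmannians_snd (y : affineProdGrassmannians E d V) :
    MorphAt (X := affineProdGrassmannians E d V) (Y := grassmannians E d)
      (fun z : V × GrPoint E d => z.2) y := by
  refine MorphAt.quotLift isOpen_univ (fun z _ => ?_) (mem_univ y)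
  let L : Set (affineSpace (FrameMaps E d)) := {a : FrameMaps E d | ∀ i, Function.Injective (a i)}
  let L' : Set (affineSpace (V × FrameMaps E d)) :=
    {z : V × FrameMaps E d | ∀ i, Function.Injective (z.2 i)}
  let φ : (affineSpace (V × FrameMaps E d)).sub L' → (affineSpace (FrameMaps E d)).sub L :=
    fun z => ⟨Prod.snd z.1, z.2⟩
  have h : ((affineSpace (V × FrameMaps E d)).sub L').RegMapAt (M := FrameMaps E d)
      (fun y => (φ y).1) z :=
    ((MorphAt.subVal L' z).regMapAt (regMapAt_id (M := V × FrameMaps E d) _)).snd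
  have hφ : MorphAt φ z := MorphAt.codRestrict h.morphAt
  exact (MorphAt.toQuot (X := (affineSpace (FrameMaps E d)).sub L) (Q := GrPoint E d)
    (fun a => FrameMaps.span (E := E) (d := d) a.1 a.2) (φ z)).comp hφ

theorem morphAt_grassmannians_mk (r : V) (y : grassmannians E d) :
    MorphAt (X := grassmannians E d) (Y := affineProdGrassmannians E d V)
      (fun X : GrPoint E d => (r, X)) y := by
  refine MorphAt.quotLift isOpen_univ (fun z _ => ?_) (mem_univ y)
  have h := (MorphAt.subVal (X := affineSpace (FrameMaps E d)) _ z).regMapAt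
    (regMapAt_id (M := FrameMaps E d) _)
  refine morphAt_of_frame_lift (Ψ := fun y => (r, y.1)) (RegMapAt.prodMk (.const r z) h)
    (Eventually.of_forall fun y => ⟨y.2, rfl⟩)

end

end FunctionSpace

/-! ### The flag variety as the bundle with zero fibres -/

namespace FlagBundle

open FunctionSpace

variable {I₀ I₁ : Type} {H : I₁ → Type}
  {t : ∀ β, H β → I₀} {E : I₀ ⊕ I₁ → Type}
  [∀ i, AddCommGroup (E i)] [∀ i, Module ℂ (E i)]
  {N : I₁ → Type} [∀ β, AddCommGroup (N β)] [∀ β, Module ℂ (N β)]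
  (e : ∀ β, E (.inr β) ≃ₗ[ℂ] N β × (∀ h : H β, E (.inl (t β h))))
  (v : I₀ ⊕ I₁ → ℕ)

/-- The flag variety as a function space. -/
def flagSpace : FunctionSpace := (grassmannians E v).sub {X : GrPoint E v | Flag e X}

/-- The zero-dimensional representation space. -/
def zeroEquiv : PUnit.{1} ≃ₗ[ℂ]
    (∀ α : I₀, PUnit.{1} →ₗ[ℂ] E (.inl α)) × (∀ β : I₁, PUnit.{1} →ₗ[ℂ] E (.inr β)) := 0

variable {v}

/-- The projection of the zero bundle to the flag variety. -/
def ofZeroBundle (z : bundle e (zeroEquiv (E := E)) v) : flagSpace e v := ⟨z.1.2, z.2.1⟩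

/-- The zero section of the zero bundle. -/
def toZeroBundle (X : flagSpace e v) : bundle e (zeroEquiv (E := E)) v :=
  ⟨(PUnit.unit, X.1), X.2, fun α => by
      rintro _ ⟨z, rfl⟩
      rw [Subsingleton.elim z 0, map_zero]
      exact zero_mem _, fun β => by
      rintro _ ⟨z, rfl⟩
      rw [Subsingleton.elim z 0, map_zero]
      exact zero_mem _⟩

theorem morphAt_ofZeroBundle (z : bundle e (zeroEquiv (E := E)) v) :
    MorphAt (ofZeroBundle e) z :=
  MorphAt.codRestrict ((morphAt_affineProdGrassmannians_snd z.1).comp (MorphAt.subVal _ z))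

theorem morphAt_toZeroBundle (X : flagSpace e v) : MorphAt (toZeroBundle e) X :=
  MorphAt.codRestrict ((morphAt_grassmannians_mk PUnit.unit X.1).comp (MorphAt.subVal _ X))

variable [Fintype I₀] [Fintype I₁] [∀ β, Fintype (H β)] [∀ i, FiniteDimensional ℂ (E i)]
  [∀ β, FiniteDimensional ℂ (N β)]

theorem exists_flagSpace_chart (X : flagSpace e v) :
    ∃ (T : Type) (_ : AddCommGroup T) (_ : Module ℂ T) (_ : FiniteDimensional ℂ T)
      (c : AffineChart (flagSpace e v) T), X ∈ c.target ∧
      (Module.finrank ℂ T : ℤ) =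
        ∑ α, (v (.inl α) : ℤ) * (Module.finrank ℂ (E (.inl α)) - v (.inl α)) +
        ∑ β, (v (.inr β) : ℤ) *
          (Module.finrank ℂ (N β) + ∑ h : H β, (v (.inl (t β h)) : ℤ) - v (.inr β)) := by
  obtain ⟨T, _, _, _, c, hc, -, hT⟩ := exists_chart e zeroEquiv (toZeroBundle e X)
  refine ⟨T, inferInstance, inferInstance, inferInstance,
    c.ofIso (φ := ofZeroBundle e) (ψ := toZeroBundle e) (fun _ => rfl) (fun _ => rfl)
      (morphAt_ofZeroBundle e) (morphAt_toZeroBundle e), hc, ?_⟩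
  simpa [Module.finrank_zero_of_subsingleton] using hT

theorem irreducibleSpace_flagSpace (h₀ : ∀ α, v (.inl α) ≤ Module.finrank ℂ (E (.inl α)))
    (h₁ : ∀ β, v (.inr β) ≤ Module.finrank ℂ (Middle t N v β)) :
    IrreducibleSpace (flagSpace e v) := by
  have := irreducibleSpace_bundle e zeroEquiv h₀ h₁
  have hs : Function.Surjective (ofZeroBundle e (v := v)) := fun X => ⟨toZeroBundle e X, rfl⟩
  exact hs.irreducibleSpace (isMorphism_iff.2 (morphAt_ofZeroBundle e)).1

end FlagBundle

/-! ### Graded quiver varieties -/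

namespace GradedQuiver

open FunctionSpace FlagBundle

variable {I₀ I₁ : Type} (Ω : I₁ → I₀ → Type) (v w w' : I₀ ⊕ I₁ → ℕ)

/-- The decomposition of the target of `A_β`. -/
def targetEquiv (β : I₁) : Target Ω w w' (.inr β) ≃ₗ[ℂ]
    (Fin (w' (.inr β)) → ℂ) × (∀ h : ArrowsFrom Ω β, Target Ω w w' (.inl h.1)) :=
  LinearEquiv.refl ℂ ((Fin (w' (.inr β)) → ℂ) × (∀ h : ArrowsFrom Ω β, Fin (w (.inl h.1)) → ℂ))

/-- A representation is determined by the maps `x_α` and `A_β`. -/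
def repEquiv : Rep Ω w w' ≃ₗ[ℂ]
    (∀ α : I₀, (Fin (w' (.inl α)) → ℂ) →ₗ[ℂ] Target Ω w w' (.inl α)) ×
    (∀ β : I₁, (Fin (w (.inr β)) → ℂ) →ₗ[ℂ] Target Ω w w' (.inr β)) where
  toFun r := (r.1, sourceMap r)
  map_add' _ _ := rfl
  map_smul' _ _ := rfl
  invFun s := (s.1, fun β => (LinearMap.fst ℂ _ _).comp (s.2 β),
    fun β α h => (LinearMap.proj (R := ℂ) (φ := fun h : ArrowsFrom Ω β => Fin (w (.inl h.1)) → ℂ)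
      ⟨α, h⟩).comp ((LinearMap.snd ℂ _ _).comp (s.2 β)))
  left_inv _ := rfl
  right_inv _ := rfl

theorem flagVariety_eq : flagVariety Ω v w w' = flagSpace (targetEquiv Ω w w') v := rfl

variable [Fintype I₁] [∀ β α, Fintype (Ω β α)]

variable {Ω w w'} in
theorem sinkMap_apply (r : Rep Ω w w') (α : I₀) (z) :
    sinkMap r α z = r.1 α z.1 + ∑ h : ArrowsTo Ω α, r.2.2 h.1 α h.2 (z.2 h) := by
  simp [sinkMap, LinearMap.coprod_apply, LinearMap.sum_apply]

/-- The condition at a sink reduces to the one on `x_α`, because `y_h b` is a component of a vector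
of `X_β` and the flag condition applies. What remains is linear in free data, so F̃ is a vector
bundle over F. -/
theorem nonsingularSet_eq :
    nonsingularSet Ω v w w' = bundleSet (targetEquiv Ω w w') (repEquiv Ω w w') v := by
  ext ⟨r, X⟩
  refine and_congr_right fun hX => ⟨fun h => ⟨fun α => ?_, fun β => h (.inr β)⟩, fun h i => ?_⟩
  · rintro _ ⟨z, rfl⟩
    refine h (.inl α) ⟨(z, 0), ?_⟩
    rw [sinkMap_apply]
    simp only [Pi.zero_apply, map_zero, Finset.sum_const_zero, add_zero]
    rfl
  · cases i with
    | inl α =>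
      rintro _ ⟨z, rfl⟩
      rw [sinkMap_apply]
      refine Submodule.add_mem _ (h.1 α ⟨z.1, rfl⟩) (Submodule.sum_mem _ fun k _ => ?_)
      exact hX k.1 (sourceMap r k.1 (z.2 k)) (h.2 k.1 ⟨z.2 k, rfl⟩) ⟨α, k.2⟩
    | inr β => exact h.2 β

end GradedQuiver

/-! ### Intermediate subspaces and semicontinuity of rank -/

section LinearAlgebra

variable {F : Type} [AddCommGroup F] [Module ℂ F]

theorem exists_submodule_between [FiniteDimensional ℂ F] {S P : Submodule ℂ F} (hSP : S ≤ P) {k : ℕ}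
    (hS : Module.finrank ℂ S ≤ k) (hP : k ≤ Module.finrank ℂ P) :
    ∃ U : Submodule ℂ F, S ≤ U ∧ U ≤ P ∧ Module.finrank ℂ U = k := by
  induction k, hS using Nat.le_induction with
  | base => exact ⟨S, le_rfl, hSP, rfl⟩
  | succ k _ ih =>
    obtain ⟨U, hSU, hUP, hU⟩ := ih (by omega)
    have hlt : U < P := lt_of_le_of_ne hUP fun h => by
      rw [h] at hU
      omega
    obtain ⟨x, hxP, hxU⟩ := SetLike.exists_of_lt hlt
    have hx : x ≠ 0 := fun h => hxU (h ▸ zero_mem _)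
    refine ⟨U ⊔ Submodule.span ℂ {x}, hSU.trans le_sup_left,
      sup_le hUP ((Submodule.span_singleton_le_iff_mem _ _).2 hxP), ?_⟩
    have h1 := Submodule.finrank_sup_add_finrank_inf_eq U (Submodule.span ℂ {x})
    have h2 : U ⊓ Submodule.span ℂ {x} = ⊥ := by
      rw [← disjoint_iff, Submodule.disjoint_span_singleton' hx]
      exact hxU
    rw [h2, finrank_bot, finrank_span_singleton hx, hU] at h1
    simpa using h1

/-- A lower bound on the rank is witnessed by a fixed `j` along which `f` is injective. Injectivity
is open, and `f ∘ j` serves as a frame of the image when the rank is exactly `k`. -/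
theorem exists_injective_comp [FiniteDimensional ℂ F] {F' : Type} [AddCommGroup F']
    [Module ℂ F'] {k : ℕ} {f : F' →ₗ[ℂ] F} (h : k ≤ Module.finrank ℂ (LinearMap.range f)) :
    ∃ j : (Fin k → ℂ) →ₗ[ℂ] F', Function.Injective (f.comp j) := by
  obtain ⟨g, hg⟩ := exists_injective_of_le_finrank h
  obtain ⟨s, hs⟩ := LinearMap.exists_rightInverse_of_surjective f.rangeRestrict
    (LinearMap.range_rangeRestrict f)
  refine ⟨s.comp g, ?_⟩
  have : f.comp (s.comp g) = (LinearMap.range f).subtype.comp g := by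
    refine LinearMap.ext fun z => ?_
    exact congrArg Subtype.val (LinearMap.congr_fun hs (g z))
  rw [this]
  exact Subtype.val_injective.comp hg

theorem le_finrank_range_of_injective_comp [FiniteDimensional ℂ F] {F' : Type}
    [AddCommGroup F'] [Module ℂ F'] {k : ℕ} {f : F' →ₗ[ℂ] F} {j : (Fin k → ℂ) →ₗ[ℂ] F'} (h : Function.Injective (f.comp j)) :
    k ≤ Module.finrank ℂ (LinearMap.range f) := by
  have h1 := LinearMap.finrank_range_of_inj h
  rw [Module.finrank_fin_fun] at h1
  rw [← h1]
  exact Submodule.finrank_mono (LinearMap.range_comp_le_range _ _)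

theorem range_comp_eq_of_injective [FiniteDimensional ℂ F] {F' : Type} [AddCommGroup F']
    [Module ℂ F'] {k : ℕ} {f : F' →ₗ[ℂ] F}
    {j : (Fin k → ℂ) →ₗ[ℂ] F'} (h : Function.Injective (f.comp j))
    (hf : Module.finrank ℂ (LinearMap.range f) = k) :
    LinearMap.range (f.comp j) = LinearMap.range f :=
  Submodule.eq_of_le_of_finrank_eq (LinearMap.range_comp_le_range _ _) (by
    rw [LinearMap.finrank_range_of_inj h, Module.finrank_fin_fun, hf])

theorem finrank_range_comp_le {F' F'' : Type} [AddCommGroup F'] [Module ℂ F'] [AddCommGroup F'']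
    [Module ℂ F''] [FiniteDimensional ℂ F'] (f : F' →ₗ[ℂ] F) (g : F'' →ₗ[ℂ] F') :
    Module.finrank ℂ (LinearMap.range (f.comp g)) ≤ Module.finrank ℂ F' :=
  (Submodule.finrank_mono (LinearMap.range_comp_le_range _ _)).trans f.finrank_range_le

end LinearAlgebra

theorem FunctionSpace.RegMapAt.eventually_le_finrank_range {X : FunctionSpace} [IsLocallyRinged X]
    {x : X} {F F' : Type} [AddCommGroup F] [Module ℂ F] [FiniteDimensional ℂ F] [AddCommGroup F']
    [Module ℂ F'] [FiniteDimensional ℂ F'] {g : X → (F' →ₗ[ℂ] F)} (h : X.RegMapAt g x) {k : ℕ}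
    (hk : k ≤ Module.finrank ℂ (LinearMap.range (g x))) :
    ∀ᶠ y in 𝓝 x, k ≤ Module.finrank ℂ (LinearMap.range (g y)) := by
  obtain ⟨j, hj⟩ := exists_injective_comp hk
  filter_upwards [(linComp h (const j x)).eventually_injective hj] with y hy
  exact le_finrank_range_of_injective_comp hy

namespace GradedQuiver

open FunctionSpace FlagBundle

variable {I₀ I₁ : Type} {Ω : I₁ → I₀ → Type} {v w w' : I₀ ⊕ I₁ → ℕ}

/-- Two vertices joined by an arrow. -/
def Joined (Ω : I₁ → I₀ → Type) : I₀ ⊕ I₁ → I₀ ⊕ I₁ → Prop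
  | .inl α, .inr β => Nonempty (Ω β α)
  | .inr β, .inl α => Nonempty (Ω β α)
  | _, _ => False

theorem Joined.symm {i j : I₀ ⊕ I₁} (h : Joined Ω i j) : Joined Ω j i := by
  cases i <;> cases j <;> exact h

variable [Fintype I₀] [Fintype I₁] [∀ β α, Fintype (Ω β α)]

/-! #### Ranks -/

/-- The vector `y_h b` is also the value of `A_α` at the element with `b` in the summand of `h` and
zero elsewhere. -/
theorem imA_isFlag (r : Rep Ω w w') (β : I₁) (z : Target Ω w w' (.inr β))
    (hz : z ∈ imA r (.inr β)) (h : ArrowsFrom Ω β) : z.2 h ∈ imA r (.inl h.1) := by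
  classical
  obtain ⟨b, rfl⟩ := hz
  refine ⟨(0, Pi.single ⟨β, h.2⟩ b), ?_⟩
  rw [sinkMap_apply, Finset.sum_eq_single ⟨β, h.2⟩]
  · simp only [map_zero, Pi.single_eq_same, zero_add]
    rfl
  · intro k _ hk
    simp only [Pi.single_eq_of_ne hk, map_zero]
  · simp

/-- Since `y_h b` is determined by `A_β b`, the map `A_α` factors through `W'_α ⊕ ⨁ im A_{s(h)}`. -/
theorem rankA_inl_le (r : Rep Ω w w') (α : I₀) :
    rankA r (.inl α) ≤ w' (.inl α) + ∑ h : ArrowsTo Ω α, rankA r (.inr h.1) := by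
  let f : (Fin (w' (.inl α)) → ℂ) × (∀ h : ArrowsTo Ω α, LinearMap.range (sourceMap r h.1)) →ₗ[ℂ]
      (Fin (w (.inl α)) → ℂ) :=
    { toFun := fun z => r.1 α z.1 + ∑ h : ArrowsTo Ω α, (z.2 h).1.2 ⟨α, h.2⟩
      map_add' := fun x y => by
        simp only [Prod.fst_add, Prod.snd_add, Pi.add_apply, Submodule.coe_add, map_add,
          Finset.sum_add_distrib]
        abel
      map_smul' := fun c x => by
        simp only [Prod.smul_fst, Prod.smul_snd, Pi.smul_apply, Submodule.coe_smul, map_smul,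
          Finset.smul_sum, smul_add, RingHom.id_apply] }
  let g : (Fin (w' (.inl α)) → ℂ) × (∀ h : ArrowsTo Ω α, Fin (w (.inr h.1)) → ℂ) →ₗ[ℂ]
      (Fin (w' (.inl α)) → ℂ) × (∀ h : ArrowsTo Ω α, LinearMap.range (sourceMap r h.1)) :=
    LinearMap.prodMap LinearMap.id (LinearMap.pi fun h =>
      (sourceMap r h.1).rangeRestrict.comp (LinearMap.proj h))
  have h1 : sinkMap r α = f.comp g := by
    refine LinearMap.ext fun z => ?_
    rw [sinkMap_apply]
    rfl
  have h2 : rankA r (.inl α) = Module.finrank ℂ (LinearMap.range (f.comp g)) := by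
    rw [← h1]
    rfl
  rw [h2]
  refine (finrank_range_comp_le f g).trans (le_of_eq ?_)
  rw [Module.finrank_prod, Module.finrank_fin_fun, Module.finrank_pi_fintype]
  rfl

/-- By `imA_isFlag` the image of `A_β` lies in `W'_β ⊕ ⨁ im A_{t(h)}`. -/
theorem rankA_inr_le (r : Rep Ω w w') (β : I₁) :
    rankA r (.inr β) ≤ w' (.inr β) + ∑ h : ArrowsFrom Ω β, rankA r (.inl h.1) := by
  let f : (Fin (w' (.inr β)) → ℂ) × (∀ h : ArrowsFrom Ω β, LinearMap.range (sinkMap r h.1)) →ₗ[ℂ]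
      (Fin (w' (.inr β)) → ℂ) × (∀ h : ArrowsFrom Ω β, Fin (w (.inl h.1)) → ℂ) :=
    LinearMap.prodMap LinearMap.id (LinearMap.pi fun h =>
      (Submodule.subtype _).comp (LinearMap.proj h))
  have h1 : LinearMap.range (sourceMap r β) ≤ LinearMap.range f := by
    intro z hz
    exact ⟨(z.1, fun h => ⟨z.2 h, imA_isFlag r β z hz h⟩), rfl⟩
  refine (Submodule.finrank_mono h1).trans (f.finrank_range_le.trans (le_of_eq ?_))
  rw [Module.finrank_prod, Module.finrank_fin_fun, Module.finrank_pi_fintype]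
  rfl

theorem lDominant_rankA (r : Rep Ω w w') : LDominant Ω (rankA r) w w' := by
  rintro (α | β)
  · refine ⟨?_, ?_⟩
    · have : rankA r (.inl α) ≤ Module.finrank ℂ (Fin (w (.inl α)) → ℂ) :=
        Submodule.finrank_le (LinearMap.range (sinkMap r α))
      rw [Module.finrank_fin_fun] at this
      exact_mod_cast this
    · have := rankA_inl_le r α
      simp only [adjSum]
      omega
  · refine ⟨?_, ?_⟩
    · have : rankA r (.inr β) ≤ Module.finrank ℂ (Fin (w (.inr β)) → ℂ) :=
        LinearMap.finrank_range_le (sourceMap r β)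
      rw [Module.finrank_fin_fun] at this
      exact_mod_cast this
    · have := rankA_inr_le r β
      simp only [adjSum]
      omega

/-! #### The vector `v̄` -/

theorem adjSum_mono {u u' : I₀ ⊕ I₁ → ℕ} (h : u ≤ u') : adjSum Ω u ≤ adjSum Ω u' := by
  rintro (α | β)
  · exact Finset.sum_le_sum fun k _ => h _
  · exact Finset.sum_le_sum fun k _ => h _

theorem Joined.le_adjSum {i j : I₀ ⊕ I₁} (h : Joined Ω i j) (u : I₀ ⊕ I₁ → ℕ) :
    u j ≤ adjSum Ω u i := by
  cases i with
  | inl α =>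
    cases j with
    | inl => exact h.elim
    | inr β =>
      obtain ⟨k⟩ := h
      exact Finset.single_le_sum (f := fun h : ArrowsTo Ω α => u (.inr h.1))
        (fun _ _ => Nat.zero_le _) (Finset.mem_univ ⟨β, k⟩)
  | inr β =>
    cases j with
    | inr => exact h.elim
    | inl α =>
      obtain ⟨k⟩ := h
      exact Finset.single_le_sum (f := fun h : ArrowsFrom Ω β => u (.inl h.1))
        (fun _ _ => Nat.zero_le _) (Finset.mem_univ ⟨α, k⟩)

theorem adjSum_congr {u u' : I₀ ⊕ I₁ → ℕ} {i : I₀ ⊕ I₁} (h : ∀ j, Joined Ω i j → u j = u' j) :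
    adjSum Ω u i = adjSum Ω u' i := by
  cases i with
  | inl α => exact Finset.sum_congr rfl fun k _ => h (.inr k.1) ⟨k.2⟩
  | inr β => exact Finset.sum_congr rfl fun k _ => h (.inl k.1) ⟨k.2⟩

/-- If `v̄_j = min(v_j, w_j)` for all neighbours `j` of `i`, the bound is built into `v̄_i`.
Otherwise some neighbour has `v̄_j = w'_j + ∑ min(v_k, w_k)`, a sum with `k = i` among its terms;
then `v̄_j ≥ min(v_i, w_i) ≥ v̄_i`, and this one neighbour suffices. -/
theorem lDominant_vbar : LDominant Ω (vbar Ω v w w') w w' := by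
  intro i
  have h1 : vbar Ω v w w' i ≤ w i := (min_le_right _ _).trans (min_le_left _ _)
  refine ⟨by exact_mod_cast h1, ?_⟩
  suffices h : vbar Ω v w w' i ≤ w' i + adjSum Ω (vbar Ω v w w') i by omega
  by_cases hj : ∀ j, Joined Ω i j → vbar Ω v w w' j = min (v j) (w j)
  · rw [adjSum_congr hj]
    exact (min_le_right _ _).trans (min_le_right _ _)
  · push Not at hj
    obtain ⟨j, hij, hj⟩ := hj
    have h2 : vbar Ω v w w' j = w' j + adjSum Ω (fun j => min (v j) (w j)) j := by
      simp only [vbar] at hj ⊢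
      omega
    have h3 : min (v i) (w i) ≤ adjSum Ω (fun j => min (v j) (w j)) j := 
      hij.symm.le_adjSum (fun j => min (v j) (w j))
    have h4 := hij.le_adjSum (vbar Ω v w w')
    have h5 : vbar Ω v w w' i ≤ min (v i) (w i) := by
      simp only [vbar]
      omega
    omega

theorem isGreatest_vbar : IsGreatest {u | u ≤ v ∧ LDominant Ω u w w'} (vbar Ω v w w') := by
  refine ⟨⟨fun i => min_le_left _ _, lDominant_vbar⟩, ?_⟩
  rintro u ⟨huv, hu⟩ i
  have h1 : ∀ j, u j ≤ min (v j) (w j) := fun j => le_min (huv j) (by exact_mod_cast (hu j).1)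
  have h2 : adjSum Ω u i ≤ adjSum Ω (fun j => min (v j) (w j)) i := adjSum_mono h1 i
  have h3 := (hu i).2
  refine le_min (huv i) (le_min ((h1 i).trans (min_le_right _ _)) ?_)
  change u i ≤ w' i + adjSum Ω (fun j => min (v j) (w j)) i
  omega

theorem vbar_eq_of_lDominant (h : LDominant Ω v w w') : vbar Ω v w w' = v :=
  le_antisymm (fun _ => min_le_left _ _) (isGreatest_vbar.2 ⟨le_rfl, h⟩)

theorem LDominant.nonemptyCondition (h : LDominant Ω v w w') : NonemptyCondition Ω v w w' := by
  refine ⟨fun α => by exact_mod_cast (h (.inl α)).1, fun β => ?_⟩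
  have := (h (.inr β)).2
  simp only [adjSum] at this
  omega

/-- Rank vectors are l-dominant, so one bounded by `v` is bounded by the greatest l-dominant vector
below `v`. -/
theorem affineSet_vbar : affineSet Ω v w w' = affineSet Ω (vbar Ω v w w') w w' := by
  ext r
  exact ⟨fun hr => isGreatest_vbar.2 ⟨hr, lDominant_rankA r⟩,
    fun hr i => (hr i).trans (min_le_left _ _)⟩

end GradedQuiver

namespace FunctionSpace

theorem morphAt_affineProdGrassmannians_fst {ι : Type} {E : ι → Type} [∀ i, AddCommGroup (E i)]
    [∀ i, Module ℂ (E i)] {d : ι → ℕ} {V : Type} [AddCommGroup V] [Module ℂ V]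
    (y : affineProdGrassmannians E d V) :
    MorphAt (X := affineProdGrassmannians E d V) (Y := affineSpace V)
      (fun z : V × GrPoint E d => z.1) y :=
  morphAt_of_frames isOpen_univ (Z := affineSpace V)
    (Ψ := fun z : (affineSpace (V × FrameMaps E d)).carrier => Prod.fst z)
    (fun _ _ _ => (regMapAt_id (M := V × FrameMaps E d) _).fst.morphAt) (fun _ _ => rfl)
    (mem_univ _)

end FunctionSpace

namespace GradedQuiver

open FunctionSpace FlagBundle

variable {I₀ I₁ : Type} {Ω : I₁ → I₀ → Type} {v w w' : I₀ ⊕ I₁ → ℕ}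
  [Fintype I₀] [Fintype I₁] [∀ β α, Fintype (Ω β α)]

instance : IsLocallyRinged (repSpace Ω w w') := inferInstanceAs (IsLocallyRinged (affineSpace _))

instance : IsLocallyRinged (affineVariety Ω v w w') := inferInstanceAs (IsLocallyRinged (sub _ _))

/-! #### The maps `A_i` depend regularly on the representation -/

theorem regMapAt_sourceMap {X : FunctionSpace} {Ψ : X → Rep Ω w w'} {x : X}
    (h : X.RegMapAt Ψ x) (β : I₁) : X.RegMapAt (fun y => sourceMap (Ψ y) β) x :=
  (h.linear (repEquiv Ω w w').toLinearMap).snd.apply β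

theorem regMapAt_sinkMap {X : FunctionSpace} {Ψ : X → Rep Ω w w'} {x : X}
    (h : X.RegMapAt Ψ x) (α : I₀) : X.RegMapAt (fun y => sinkMap (Ψ y) α) x :=
  RegMapAt.add (RegMapAt.linComp (h.fst.apply α) (.const (LinearMap.fst ℂ _ _) x))
    (RegMapAt.linComp (RegMapAt.sum Finset.univ fun k _ => RegMapAt.linComp
      (((h.snd.snd.apply k.1).apply α).apply k.2) (.const (LinearMap.proj k) x))
      (.const (LinearMap.snd ℂ _ _) x))

theorem eventually_le_rankA {X : FunctionSpace} [IsLocallyRinged X] {Ψ : X → Rep Ω w w'} {x : X}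
    (h : X.RegMapAt Ψ x) {k : ℕ} {i : I₀ ⊕ I₁} (hk : k ≤ rankA (Ψ x) i) :
    ∀ᶠ y in 𝓝 x, k ≤ rankA (Ψ y) i := by
  cases i with
  | inl α => exact (regMapAt_sinkMap h α).eventually_le_finrank_range hk
  | inr β => exact (regMapAt_sourceMap h β).eventually_le_finrank_range hk

theorem isOpen_le_rankA (k : ℕ) (i : I₀ ⊕ I₁) :
    IsOpen {r : repSpace Ω w w' | k ≤ rankA r i} :=
  isOpen_iff_mem_nhds.2 fun _ hr =>
    eventually_le_rankA (X := repSpace Ω w w') (regMapAt_id (M := Rep Ω w w') _) hr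

theorem isClosed_affineSet : IsClosed (affineSet Ω v w w') := by
  have : affineSet Ω v w w' = ⋂ i, {r : repSpace Ω w w' | v i + 1 ≤ rankA r i}ᶜ := by
    ext r
    simp only [mem_iInter, mem_compl_iff, mem_ofPred_eq, not_le, Nat.lt_succ_iff]
    rfl
  rw [this]
  exact isClosed_iInter fun i => (isOpen_le_rankA _ _).isClosed_compl

/-- Once the ranks are bounded above by `u`, equality is the open condition of being at least `u`.
-/
theorem isOpen_stratum {u : I₀ ⊕ I₁ → ℕ} (hu : affineSet Ω v w w' ⊆ affineSet Ω u w w') :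
    IsOpen {z : affineVariety Ω v w w' | z.1 ∈ stratum Ω u w w'} := by
  have h : IsOpen (⋂ i, {r : repSpace Ω w w' | u i ≤ rankA r i}) :=
    isOpen_iInter_of_finite fun i => isOpen_le_rankA _ _
  have h2 : {z : affineVariety Ω v w w' | z.1 ∈ stratum Ω u w w'} =
      Subtype.val ⁻¹' (⋂ i, {r : repSpace Ω w w' | u i ≤ rankA r i}) := by
    ext z
    change _ ↔ z.1 ∈ ⋂ i, {r : repSpace Ω w w' | u i ≤ rankA r i}
    rw [mem_iInter]
    exact forall_congr' fun i => ⟨fun h => h.ge, fun h => le_antisymm (hu z.2 i) h⟩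
  rw [h2]
  exact h.preimage continuous_subtype_val

/-! #### The projection -/

theorem morphAt_proj (z : nonsingularVariety Ω v w w') : MorphAt (proj Ω v w w') z :=
  MorphAt.codRestrict ((morphAt_affineProdGrassmannians_fst z.1).comp (MorphAt.subVal _ z))

/-- Sinks come first: `X_α` is any enlargement of `im A_α`. Then `im A_β` lies in `W'_β ⊕ ⨁
X_{t(h)}`, which has room for `X_β` by hypothesis. -/
theorem proj_surjective (h : NonemptyCondition Ω v w w') :
    Function.Surjective (proj Ω v w w') := by
  rintro ⟨r, hr⟩
  have h₀ : ∀ α, ∃ U : Submodule ℂ (Fin (w (.inl α)) → ℂ), LinearMap.range (sinkMap r α) ≤ U ∧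
      Module.finrank ℂ U = v (.inl α) := fun α => by
    obtain ⟨U, h1, -, h2⟩ := exists_submodule_between (le_top (a := LinearMap.range (sinkMap r α)))
      (hr (.inl α)) (by rw [finrank_top, Module.finrank_fin_fun]; exact h.1 α)
    exact ⟨U, h1, h2⟩
  choose U hrU hU using h₀
  have h₁ : ∀ β, ∃ P : Submodule ℂ
      ((Fin (w' (.inr β)) → ℂ) × (∀ h : ArrowsFrom Ω β, Fin (w (.inl h.1)) → ℂ)),
      LinearMap.range (sourceMap r β) ≤ P ∧ (∀ z ∈ P, ∀ h : ArrowsFrom Ω β, z.2 h ∈ U h.1) ∧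
      Module.finrank ℂ P = v (.inr β) := fun β => by
    let f : (Fin (w' (.inr β)) → ℂ) × (∀ h : ArrowsFrom Ω β, U h.1) →ₗ[ℂ]
        (Fin (w' (.inr β)) → ℂ) × (∀ h : ArrowsFrom Ω β, Fin (w (.inl h.1)) → ℂ) :=
      LinearMap.prodMap LinearMap.id (LinearMap.pi fun h =>
        (Submodule.subtype _).comp (LinearMap.proj h))
    have hf : Function.Injective f := fun x y hxy => by
      have h1 : x.1 = y.1 := (Prod.ext_iff.1 hxy).1
      have h2 := (Prod.ext_iff.1 hxy).2
      exact Prod.ext h1 (funext fun h => Subtype.ext (congrFun h2 h))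
    have h1 : LinearMap.range (sourceMap r β) ≤ LinearMap.range f := fun z hz =>
      ⟨(z.1, fun h => ⟨z.2 h, hrU _ (imA_isFlag r β z hz h)⟩), rfl⟩
    have h2 : v (.inr β) ≤ Module.finrank ℂ (LinearMap.range f) := by
      rw [LinearMap.finrank_range_of_inj hf, Module.finrank_prod, Module.finrank_fin_fun,
        Module.finrank_pi_fintype]
      simp only [hU]
      exact h.2 β
    obtain ⟨P, h3, h4, h5⟩ := exists_submodule_between h1 (hr (.inr β)) h2
    refine ⟨P, h3, fun z hz h => ?_, h5⟩
    obtain ⟨y, rfl⟩ := h4 hz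
    exact (y.2 h).2
  choose P hrP hPU hP using h₁
  let X : GrPoint (Target Ω w w') v := ⟨fun | .inl α => U α | .inr β => P β, fun
    | .inl α => hU α
    | .inr β => hP β⟩
  exact ⟨⟨(r, X), hPU, fun
    | .inl α => hrU α
    | .inr β => hrP β⟩, rfl⟩

/-! #### Nonemptiness of strata -/

variable (Ω v w w') in
/-- Frames with coordinates of the maps `x_α`, `A_β`. -/
abbrev QuiverParam : Type :=
  Param (fun β (h : ArrowsFrom Ω β) => h.1) (Target Ω w w') (fun β => Fin (w' (.inr β)) → ℂ)
    (fun α => Fin (w' (.inl α)) → ℂ) (fun β => Fin (w (.inr β)) → ℂ) v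

/-- The component `ℂ ^ v (s h) → ℂ ^ v_α` of a parameter, for an arrow `h` with target `α`. -/
def arrowCoord (x : QuiverParam Ω v w w') {α : I₀} (h : ArrowsTo Ω α) :
    (Fin (v (.inr h.1)) → ℂ) →ₗ[ℂ] (Fin (v (.inl α)) → ℂ) :=
  (LinearMap.proj (R := ℂ) (φ := fun h : ArrowsFrom Ω h.1 => Fin (v (.inl h.1)) → ℂ)
    ⟨α, h.2⟩).comp ((LinearMap.snd ℂ _ _).comp (x.2.1 h.1))

/-- The map `W'_α ⊕ ⨁_h ℂ ^ v (s h) → ℂ ^ v_α` that induces `A_α`. -/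
def sinkCoord (x : QuiverParam Ω v w w') (α : I₀) :
    ((Fin (w' (.inl α)) → ℂ) × (∀ h : ArrowsTo Ω α, Fin (v (.inr h.1)) → ℂ)) →ₗ[ℂ]
      (Fin (v (.inl α)) → ℂ) :=
  LinearMap.coprod (x.2.2.1 α) (∑ h : ArrowsTo Ω α, (arrowCoord x h).comp (LinearMap.proj h))

theorem sinkCoord_apply (x : QuiverParam Ω v w w') (α : I₀) (z) :
    sinkCoord x α z = x.2.2.1 α z.1 +
      ∑ h : ArrowsTo Ω α, (x.2.1 h.1 (z.2 h)).2 ⟨α, h.2⟩ := by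
  simp only [sinkCoord, LinearMap.coprod_apply, LinearMap.sum_apply]
  rfl

theorem sinkMap_repOf (x : QuiverParam Ω v w w') (α : I₀) :
    sinkMap (repOf (targetEquiv Ω w w') (repEquiv Ω w w') x) α = (x.1 α).comp ((sinkCoord x α).comp
      (LinearMap.prodMap LinearMap.id (LinearMap.pi fun h : ArrowsTo Ω α =>
        (x.2.2.2 h.1).comp (LinearMap.proj h)))) := by
  refine LinearMap.ext fun z => ?_
  rw [sinkMap_apply, LinearMap.comp_apply, LinearMap.comp_apply, sinkCoord_apply, map_add, map_sum]
  rfl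

theorem sourceMap_repOf (x : QuiverParam Ω v w w') (β : I₁) :
    sourceMap (repOf (targetEquiv Ω w w') (repEquiv Ω w w') x) β =
      ((up (targetEquiv Ω w w') x.1 β).comp (x.2.1 β)).comp (x.2.2.2 β) := rfl

/-- Each `A_i` is an injective frame after a surjection onto `ℂ ^ v_i`. At a sink the surjection
combines `sinkCoord` with the coordinate maps of the sources. -/
theorem rankA_repOf {x : QuiverParam Ω v w w'} (h₁ : ∀ α, Function.Injective (x.1 α))
    (h₂ : ∀ β, Function.Injective (x.2.1 β)) (h₃ : ∀ β, Function.Surjective (x.2.2.2 β))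
    (h₄ : ∀ α, Function.Surjective (sinkCoord x α)) (i : I₀ ⊕ I₁) :
    rankA (repOf (targetEquiv Ω w w') (repEquiv Ω w w') x) i = v i := by
  cases i with
  | inl α =>
    change Module.finrank ℂ (LinearMap.range (sinkMap _ α)) = _
    rw [sinkMap_repOf, LinearMap.range_comp_of_range_eq_top,
      LinearMap.finrank_range_of_inj (h₁ α), Module.finrank_fin_fun]
    refine LinearMap.range_eq_top.2 ((h₄ α).comp fun z => ?_)
    choose y hy using fun h : ArrowsTo Ω α => h₃ h.1 (z.2 h)
    exact ⟨(z.1, y), Prod.ext rfl (funext hy)⟩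
  | inr β =>
    change Module.finrank ℂ (LinearMap.range (sourceMap _ β)) = _
    rw [sourceMap_repOf, LinearMap.range_comp_of_range_eq_top _ (LinearMap.range_eq_top.2 (h₃ β)),
      LinearMap.finrank_range_of_inj (Function.Injective.comp
        (g := up (targetEquiv Ω w w') x.1 β) (f := x.2.1 β) (up_injective _ h₁ β) (h₂ β)),
      Module.finrank_fin_fun]

theorem regMapAt_arrowCoord {X : FunctionSpace} {Ψ : X → QuiverParam Ω v w w'} {x : X}
    (h : X.RegMapAt Ψ x) {α : I₀} (k : ArrowsTo Ω α) :
    X.RegMapAt (fun y => arrowCoord (Ψ y) k) x :=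
  RegMapAt.linComp (.const _ x) (RegMapAt.linComp (.const _ x) (h.snd.fst.apply k.1))

theorem regMapAt_sinkCoord {X : FunctionSpace} {Ψ : X → QuiverParam Ω v w w'} {x : X}
    (h : X.RegMapAt Ψ x) (α : I₀) : X.RegMapAt (fun y => sinkCoord (Ψ y) α) x :=
  RegMapAt.add (RegMapAt.linComp (h.snd.snd.fst.apply α) (.const (LinearMap.fst ℂ _ _) x))
    (RegMapAt.linComp (RegMapAt.sum Finset.univ fun k _ => RegMapAt.linComp
      (regMapAt_arrowCoord h k)
      (.const (LinearMap.proj k) x)) (.const (LinearMap.snd ℂ _ _) x))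

/-- The components of `g` are distributed over the arrows. Frames are ignored: those at sinks are
zero, and those at sources have zero `W'_β` part. -/
theorem exists_sinkCoord_eq
    (g : ∀ α, ((Fin (w' (.inl α)) → ℂ) × (∀ h : ArrowsTo Ω α, Fin (v (.inr h.1)) → ℂ)) →ₗ[ℂ]
      (Fin (v (.inl α)) → ℂ)) (d : ∀ β, (Fin (w (.inr β)) → ℂ) →ₗ[ℂ] (Fin (v (.inr β)) → ℂ)) :
    ∃ x : QuiverParam Ω v w w', x.2.2.2 = d ∧ ∀ α, sinkCoord x α = g α := by
  classical
  refine ⟨(0, fun β => LinearMap.prod 0 (LinearMap.pi fun h => (g h.1).comp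
    ((LinearMap.inr ℂ _ _).comp (LinearMap.single ℂ
      (fun h : ArrowsTo Ω h.1 => Fin (v (.inr h.1)) → ℂ) ⟨β, h.2⟩))),
    fun α => (g α).comp (LinearMap.inl ℂ _ _), d), rfl, fun α => LinearMap.ext fun z => ?_⟩
  rw [sinkCoord_apply]
  have h1 : z = LinearMap.inl ℂ _ _ z.1 + ∑ h, LinearMap.inr ℂ _ _
      (LinearMap.single ℂ (fun h : ArrowsTo Ω α => Fin (v (.inr h.1)) → ℂ) h (z.2 h)) := by
    rw [← map_sum]
    simp only [LinearMap.coe_single, Finset.univ_sum_single]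
    ext <;> simp
  conv_rhs => rw [h1, map_add, map_sum]
  rfl

theorem exists_injective_param (h : NonemptyCondition Ω v w w') :
    ∃ x : QuiverParam Ω v w w',
      (∀ α, Function.Injective (x.1 α)) ∧ ∀ β, Function.Injective (x.2.1 β) := by
  choose a ha using fun α => exists_injective_of_le_finrank (k := v (.inl α))
    (F := Target Ω w w' (.inl α)) (by
      rw [Module.finrank_fin_fun]
      exact h.1 α)
  choose b hb using fun β => exists_injective_of_le_finrank (k := v (.inr β))
    (F := Middle (fun β (h : ArrowsFrom Ω β) => h.1) (fun β => Fin (w' (.inr β)) → ℂ) v β) (by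
      rw [Module.finrank_prod, Module.finrank_fin_fun, Module.finrank_pi_fintype]
      simp only [Module.finrank_fin_fun]
      exact h.2 β)
  exact ⟨⟨a, b, 0, 0⟩, ha, hb⟩

/-- This uses the inequalities of l-dominance absent from `NonemptyCondition`: `v_β ≤ w_β` at
sources and `v_α ≤ w'_α + ∑ v_{s(h)}` at sinks. -/
theorem exists_surjective_param (h : LDominant Ω v w w') :
    ∃ x : QuiverParam Ω v w w',
      (∀ β, Function.Surjective (x.2.2.2 β)) ∧ ∀ α, Function.Surjective (sinkCoord x α) := by
  choose d hd using fun β => exists_surjective_of_le_finrank (k := v (.inr β))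
    (F := Fin (w (.inr β)) → ℂ) (by
      rw [Module.finrank_fin_fun]
      exact_mod_cast (h (.inr β)).1)
  choose g hg using fun α => exists_surjective_of_le_finrank (k := v (.inl α))
    (F := (Fin (w' (.inl α)) → ℂ) × (∀ h : ArrowsTo Ω α, Fin (v (.inr h.1)) → ℂ)) (by
      rw [Module.finrank_prod, Module.finrank_fin_fun, Module.finrank_pi_fintype]
      simp only [Module.finrank_fin_fun]
      have := (h (.inl α)).2
      simp only [adjSum] at this
      omega)
  obtain ⟨x, h1, h2⟩ := exists_sinkCoord_eq g d
  refine ⟨x, fun β => ?_, fun α => ?_⟩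
  · rw [h1]
    exact hd β
  · rw [h2]
    exact hg α

theorem isOpen_surjective_params : IsOpen {x : affineSpace (QuiverParam Ω v w w') |
    (∀ β, Function.Surjective ((Prod.snd x).2.2 β)) ∧
      ∀ α, Function.Surjective (sinkCoord x α)} := by
  rw [isOpen_iff_mem_nhds]
  rintro x ⟨h₀, h₁⟩
  have h : (affineSpace (QuiverParam Ω v w w')).RegMapAt (fun y : QuiverParam Ω v w w' => y) x :=
    regMapAt_id _
  have h1 : ∀ᶠ y : affineSpace (QuiverParam Ω v w w') in 𝓝 x, ∀ β,
      Function.Surjective ((Prod.snd y).2.2 β) :=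
    eventually_all.2 fun β => RegMapAt.eventually_surjective (h.snd.snd.snd.apply β) (h₀ β)
  have h2 : ∀ᶠ y : affineSpace (QuiverParam Ω v w w') in 𝓝 x, ∀ α,
      Function.Surjective (sinkCoord y α) :=
    eventually_all.2 fun α => RegMapAt.eventually_surjective (regMapAt_sinkCoord h α) (h₁ α)
  filter_upwards [h1, h2] with y h3 h4 using ⟨h3, h4⟩

/-- Injective frames at sources and surjective sink maps constrain the same coefficients, so they
are hard to arrange together by hand. Each condition is open and nonempty, and irreducibility of the
parameter space makes them compatible. -/
theorem stratum_nonempty (h : LDominant Ω v w w') : (stratum Ω v w w').Nonempty := by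
  obtain ⟨x, hx₁, hx₂⟩ := nonempty_preirreducible_inter isOpen_injective_params
    isOpen_surjective_params (exists_injective_param h.nonemptyCondition)
    (exists_surjective_param h)
  exact ⟨(repOf (targetEquiv Ω w w') (repEquiv Ω w w') x : Rep Ω w w'),
    rankA_repOf hx₁.1 hx₁.2 hx₂.1 hx₂.2⟩

end GradedQuiver

namespace FunctionSpace

theorem hasDim_of_charts {X : FunctionSpace} [hX : Nonempty X] {d : ℤ}
    (h : ∀ x : X, ∃ (T : Type) (_ : AddCommGroup T) (_ : Module ℂ T) (_ : FiniteDimensional ℂ T)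
      (c : AffineChart X T), x ∈ c.target ∧ (Module.finrank ℂ T : ℤ) = d) : X.HasDim d := by
  obtain ⟨T, _, _, _, c, -, hT⟩ := h hX.some
  refine ⟨Module.finrank ℂ T, topologicalKrullDim_of_charts fun x => ?_, hT⟩
  obtain ⟨T', i₁, i₂, i₃, c', hc', hT'⟩ := h x
  exact ⟨T', i₁, i₂, i₃, c', hc', by omega⟩

end FunctionSpace

namespace GradedQuiver

open FunctionSpace FlagBundle

variable {I₀ I₁ : Type} {Ω : I₁ → I₀ → Type} {v w w' : I₀ ⊕ I₁ → ℕ}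
  [Fintype I₀] [Fintype I₁] [∀ β α, Fintype (Ω β α)]

/-! #### Irreducibility and smoothness -/

theorem finrank_target_inl (α : I₀) :
    Module.finrank ℂ (Target Ω w w' (.inl α)) = w (.inl α) :=
  Module.finrank_fin_fun ℂ

theorem finrank_middle (β : I₁) :
    Module.finrank ℂ (Middle (fun β (h : ArrowsFrom Ω β) => h.1)
      (fun β => Fin (w' (.inr β)) → ℂ) v β) =
      w' (.inr β) + ∑ h : ArrowsFrom Ω β, v (.inl h.1) := by
  rw [Module.finrank_prod, Module.finrank_fin_fun, Module.finrank_pi_fintype]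
  simp only [Module.finrank_fin_fun]

theorem nonsingularVariety_eq :
    nonsingularVariety Ω v w w' = bundle (targetEquiv Ω w w') (repEquiv Ω w w') v :=
  congrArg (affineProdGrassmannians (Target Ω w w') v (Rep Ω w w')).sub
    (nonsingularSet_eq Ω v w w')

theorem irreducibleSpace_nonsingularVariety (h : NonemptyCondition Ω v w w') :
    IrreducibleSpace (nonsingularVariety Ω v w w') := by
  rw [nonsingularVariety_eq]
  exact irreducibleSpace_bundle _ _ (fun α => (h.1 α).trans_eq (finrank_target_inl α).symm)
    fun β => (h.2 β).trans_eq (finrank_middle β).symm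

theorem irreducibleSpace_flagVariety (h : NonemptyCondition Ω v w w') :
    IrreducibleSpace (flagVariety Ω v w w') := by
  rw [flagVariety_eq]
  exact irreducibleSpace_flagSpace _ (fun α => (h.1 α).trans_eq (finrank_target_inl α).symm)
    fun β => (h.2 β).trans_eq (finrank_middle β).symm

/-- The set `S` is kept variable so that its identification with the bundle can be substituted,
leaving the ambient data fixed. -/
theorem exists_sub_chart {S : Set (affineProdGrassmannians (Target Ω w w') v (Rep Ω w w'))}
    (hS : S = bundleSet (targetEquiv Ω w w') (repEquiv Ω w w') v)
    (y : (affineProdGrassmannians (Target Ω w w') v (Rep Ω w w')).sub S) :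
    ∃ (T : Type) (_ : AddCommGroup T) (_ : Module ℂ T) (_ : FiniteDimensional ℂ T)
      (c : AffineChart ((affineProdGrassmannians (Target Ω w w') v (Rep Ω w w')).sub S) T),
      y ∈ c.target ∧
      (∃ θ : T → Rep Ω w w', (∀ p ∈ polyFun (Rep Ω w w'), p ∘ θ ∈ polyFun T) ∧
        ∀ x : T, (c.toFun x).1.1 = θ x) ∧
      (Module.finrank ℂ T : ℤ) = dimFtilde Ω v w w' := by
  subst hS
  obtain ⟨T, i₁, i₂, i₃, c, hc, hθ, hT⟩ := exists_chart (targetEquiv Ω w w') (repEquiv Ω w w') y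
  refine ⟨T, i₁, i₂, i₃, c, hc, hθ, hT.trans ?_⟩
  simp only [Module.finrank_fin_fun, dimFtilde, dimF, mul_comm]
  ring

theorem exists_nonsingularVariety_chart (y : nonsingularVariety Ω v w w') :
    ∃ (T : Type) (_ : AddCommGroup T) (_ : Module ℂ T) (_ : FiniteDimensional ℂ T)
      (c : AffineChart (nonsingularVariety Ω v w w') T), y ∈ c.target ∧
      (∃ θ : T → Rep Ω w w', (∀ p ∈ polyFun (Rep Ω w w'), p ∘ θ ∈ polyFun T) ∧
        ∀ x : T, (c.toFun x).1.1 = θ x) ∧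
      (Module.finrank ℂ T : ℤ) = dimFtilde Ω v w w' :=
  exists_sub_chart (nonsingularSet_eq Ω v w w') y

theorem exists_flagVariety_chart (X : flagVariety Ω v w w') :
    ∃ (T : Type) (_ : AddCommGroup T) (_ : Module ℂ T) (_ : FiniteDimensional ℂ T)
      (c : AffineChart (flagVariety Ω v w w') T), X ∈ c.target ∧
      (Module.finrank ℂ T : ℤ) = dimF Ω v w w' := by
  obtain ⟨T, i₁, i₂, i₃, c, hc, hT⟩ := exists_flagSpace_chart (targetEquiv Ω w w') X
  refine ⟨T, i₁, i₂, i₃, c, hc, hT.trans ?_⟩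
  simp only [Module.finrank_fin_fun, dimF, mul_comm]
  ring

theorem isNonsingular_nonsingularVariety : (nonsingularVariety Ω v w w').IsNonsingular :=
  isNonsingular_of_charts fun y => by
    obtain ⟨T, i₁, i₂, i₃, c, hc, -⟩ := exists_nonsingularVariety_chart y
    exact ⟨T, i₁, i₂, i₃, c, hc⟩

theorem isNonsingular_flagVariety : (flagVariety Ω v w w').IsNonsingular :=
  isNonsingular_of_charts fun y => by
    obtain ⟨T, i₁, i₂, i₃, c, hc, -⟩ := exists_flagVariety_chart y
    exact ⟨T, i₁, i₂, i₃, c, hc⟩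

theorem hasDim_nonsingularVariety (h : NonemptyCondition Ω v w w') :
    (nonsingularVariety Ω v w w').HasDim (dimFtilde Ω v w w') := by
  have := irreducibleSpace_nonsingularVariety h
  refine hasDim_of_charts fun y => ?_
  obtain ⟨T, i₁, i₂, i₃, c, hc, -, hT⟩ := exists_nonsingularVariety_chart y
  exact ⟨T, i₁, i₂, i₃, c, hc, hT⟩

theorem hasDim_flagVariety (h : NonemptyCondition Ω v w w') :
    (flagVariety Ω v w w').HasDim (dimF Ω v w w') := by
  have := irreducibleSpace_flagVariety h
  exact hasDim_of_charts exists_flagVariety_chart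

/-! #### The affine varieties -/

theorem affineVariety_vbar :
    affineVariety Ω v w w' = affineVariety Ω (vbar Ω v w w') w w' :=
  congrArg (repSpace Ω w w').sub affineSet_vbar

/-- After replacing `v` by `v̄`, the projection from the irreducible F̃ is onto. -/
theorem irreducibleSpace_affineVariety : IrreducibleSpace (affineVariety Ω v w w') := by
  rw [affineVariety_vbar]
  have h := (lDominant_vbar (Ω := Ω) (v := v) (w := w) (w' := w')).nonemptyCondition
  have := irreducibleSpace_nonsingularVariety h
  exact (proj_surjective h).irreducibleSpace (isMorphism_iff.2 morphAt_proj).1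

theorem stratum_subset_affineSet : stratum Ω v w w' ⊆ affineSet Ω v w w' :=
  fun _ hr i => (hr i).le

theorem isGreatest_stratum :
    IsGreatest {u | (stratum Ω u w w').Nonempty ∧ stratum Ω u w w' ⊆ affineSet Ω v w w'}
      (vbar Ω v w w') := by
  refine ⟨⟨stratum_nonempty lDominant_vbar, ?_⟩, ?_⟩
  · rw [affineSet_vbar]
    exact stratum_subset_affineSet
  · rintro u ⟨⟨r, hr⟩, hu⟩ i
    have h := hu hr
    rw [affineSet_vbar] at h
    exact (hr i).ge.trans (h i)

theorem dense_stratum : Dense {z : affineVariety Ω v w w' | z.1 ∈ stratum Ω (vbar Ω v w w') w w'} := by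
  have := irreducibleSpace_affineVariety (Ω := Ω) (v := v) (w := w) (w' := w')
  obtain ⟨r, hr⟩ := stratum_nonempty (lDominant_vbar (Ω := Ω) (v := v) (w := w) (w' := w'))
  exact (isOpen_stratum affineSet_vbar.subset).dense ⟨⟨r, isGreatest_stratum.1.2 hr⟩, hr⟩

theorem affineSet_eq_closure :
    affineSet Ω v w w' = closure (stratum Ω (vbar Ω v w w') w w') := by
  refine Subset.antisymm (fun r hr => ?_)
    (closure_minimal isGreatest_stratum.1.2 isClosed_affineSet)
  have h := dense_stratum (⟨r, hr⟩ : affineVariety Ω v w w')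
  refine closure_mono ?_ (closure_subtype.1 h)
  rintro _ ⟨z, hz, rfl⟩
  exact hz

/-! #### The section of the projection over the open stratum -/

/-- The section `r ↦ (r, im A)` of the projection over the open stratum. -/
def stratumSection (z : (affineVariety Ω v w w').sub {z | z.1 ∈ stratum Ω v w w'}) :
    (nonsingularVariety Ω v w w').sub
      (proj Ω v w w' ⁻¹' {z : affineVariety Ω v w w' | z.1 ∈ stratum Ω v w w'}) :=
  ⟨⟨(z.1.1, ⟨imA z.1.1, z.2⟩), imA_isFlag z.1.1, fun _ => le_rfl⟩, z.2⟩

/-- Fix subspaces on which the maps `A_i` at `z` are injective with full image. They stay injective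
nearby, and constancy of rank on the stratum makes these restrictions regular frames of `im A_i`. -/
theorem morphAt_stratumSection
    (z : (affineVariety Ω v w w').sub {z | z.1 ∈ stratum Ω v w w'}) :
    MorphAt (stratumSection (Ω := Ω)) z := by
  refine MorphAt.codRestrict (MorphAt.codRestrict ?_)
  choose j₀ hj₀ using fun α => exists_injective_comp (f := sinkMap z.1.1 α) (z.2 (.inl α)).ge
  choose j₁ hj₁ using fun β => exists_injective_comp (f := sourceMap z.1.1 β) (z.2 (.inr β)).ge
  have h : ((affineVariety Ω v w w').sub {z | z.1 ∈ stratum Ω v w w'}).RegMapAt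
      (M := Rep Ω w w') (fun y => y.1.1) z :=
    (MorphAt.subVal (X := affineVariety Ω v w w') _ z).regMapAt (M := Rep Ω w w')
      ((MorphAt.subVal (X := repSpace Ω w w') _ z.1).regMapAt (M := Rep Ω w w')
        (regMapAt_id (M := Rep Ω w w') _))
  have h₀ := fun α => RegMapAt.linComp (regMapAt_sinkMap h α) (.const (j₀ α) z)
  have h₁ := fun β => RegMapAt.linComp (regMapAt_sourceMap h β) (.const (j₁ β) z)
  let F : Rep Ω w w' → FrameMaps (Target Ω w w') v := fun r => fun
    | .inl α => (sinkMap r α).comp (j₀ α)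
    | .inr β => (sourceMap r β).comp (j₁ β)
  refine morphAt_of_frame_lift (Ψ := fun y => ((y.1.1 : Rep Ω w w'), F y.1.1)) (h.prodMk
    (RegMapAt.pi fun
      | .inl α => h₀ α
      | .inr β => h₁ β)) ?_
  filter_upwards [eventually_all.2 fun α => (h₀ α).eventually_injective (hj₀ α),
    eventually_all.2 fun β => (h₁ β).eventually_injective (hj₁ β)] with y hy₀ hy₁
  refine ⟨fun | .inl α => hy₀ α | .inr β => hy₁ β, Prod.ext rfl (Subtype.ext (funext fun
    | .inl α => ?_
    | .inr β => ?_))⟩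
  · exact range_comp_eq_of_injective (hy₀ α) (y.2 (.inl α))
  · exact range_comp_eq_of_injective (hy₁ β) (y.2 (.inr β))

/-- Over the stratum `im A_i ⊆ X_i` is an inclusion of spaces of equal dimension. -/
theorem stratumSection_restrictPreimage_proj (y : (nonsingularVariety Ω v w w').sub
      (proj Ω v w w' ⁻¹' {z : affineVariety Ω v w w' | z.1 ∈ stratum Ω v w w'})) :
    stratumSection (restrictPreimage {z : affineVariety Ω v w w' | z.1 ∈ stratum Ω v w w'}
      (proj Ω v w w') y) = y :=
  Subtype.ext (Subtype.ext (Prod.ext rfl (Subtype.ext (funext fun i =>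
    Submodule.eq_of_le_of_finrank_eq (y.1.2.2 i) ((y.2 i).trans (y.1.1.2.2 i).symm)))))

theorem isMorphism_restrictPreimage_proj : IsMorphism
    (X := (nonsingularVariety Ω v w w').sub
      (proj Ω v w w' ⁻¹' {z : affineVariety Ω v w w' | z.1 ∈ stratum Ω v w w'}))
    (Y := (affineVariety Ω v w w').sub {z : affineVariety Ω v w w' | z.1 ∈ stratum Ω v w w'})
    (restrictPreimage {z : affineVariety Ω v w w' | z.1 ∈ stratum Ω v w w'} (proj Ω v w w')) :=
  isMorphism_iff.2 fun y => MorphAt.codRestrict ((morphAt_proj y.1).comp (MorphAt.subVal _ y))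

theorem isIsomorphism_restrictPreimage_proj : IsIsomorphism
    (X := (nonsingularVariety Ω v w w').sub
      (proj Ω v w w' ⁻¹' {z : affineVariety Ω v w w' | z.1 ∈ stratum Ω v w w'}))
    (Y := (affineVariety Ω v w w').sub {z : affineVariety Ω v w w' | z.1 ∈ stratum Ω v w w'})
    (restrictPreimage {z : affineVariety Ω v w w' | z.1 ∈ stratum Ω v w w'} (proj Ω v w w')) :=
  ⟨stratumSection, stratumSection_restrictPreimage_proj, fun _ => rfl,
    isMorphism_restrictPreimage_proj, isMorphism_iff.2 morphAt_stratumSection⟩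

theorem continuous_proj : Continuous (proj Ω v w w') := (isMorphism_iff.2 morphAt_proj).1

theorem preimage_stratum_nonempty (h : LDominant Ω v w w') :
    (proj Ω v w w' ⁻¹' {z : affineVariety Ω v w w' | z.1 ∈ stratum Ω v w w'}).Nonempty := by
  obtain ⟨r, hr⟩ := stratum_nonempty h
  obtain ⟨y, hy⟩ := proj_surjective h.nonemptyCondition ⟨r, stratum_subset_affineSet hr⟩
  refine ⟨y, ?_⟩
  rw [mem_preimage, hy]
  exact hr

theorem isBirational_proj (h : LDominant Ω v w w') : IsBirational (proj Ω v w w') := by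
  have hD := isOpen_stratum (Ω := Ω) (v := v) (w := w) (w' := w') Subset.rfl
  have := irreducibleSpace_nonsingularVariety h.nonemptyCondition
  have hd := dense_stratum (Ω := Ω) (v := v) (w := w) (w' := w')
  rw [vbar_eq_of_lDominant h] at hd
  exact ⟨isMorphism_iff.2 morphAt_proj, _, _, mapsTo_preimage _ _, hD.preimage continuous_proj,
    (hD.preimage continuous_proj).dense (preimage_stratum_nonempty h), hD, hd,
    isIsomorphism_restrictPreimage_proj⟩

/-! #### Dimension of the affine varieties -/

/-- A single chart of F̃ gives both bounds: its polynomial image is dense in E, and its part over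
the stratum embeds topologically in E. -/
theorem hasDim_affineVariety_of_lDominant (h : LDominant Ω v w w') :
    (affineVariety Ω v w w').HasDim (dimFtilde Ω v w w') := by
  have := irreducibleSpace_nonsingularVariety h.nonemptyCondition
  obtain ⟨y⟩ := (inferInstance : Nonempty (nonsingularVariety Ω v w w'))
  obtain ⟨T, _, _, _, c, hc, ⟨θ, hθ, hcθ⟩, hT⟩ := exists_nonsingularVariety_chart y
  refine ⟨Module.finrank ℂ T, le_antisymm ?_ ?_, hT⟩
  · refine topologicalKrullDim_le_of_dense (M := Rep Ω w w') (S := affineSet Ω v w w') hθ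
      fun r hr => ?_
    obtain ⟨z, hz⟩ := proj_surjective h.nonemptyCondition ⟨r, hr⟩
    -- The chart is dense in the irreducible F̃, and π is continuous and onto, so every point of E
    -- lies in the closure of the image of `θ`.
    have hd : Dense (range c.toFun) := c.isOpenEmbedding.isOpen_range.dense (range_nonempty _)
    have hg : Continuous fun z => (proj Ω v w w' z).1 :=
      continuous_subtype_val.comp continuous_proj
    have h1 := image_closure_subset_closure_image hg (mem_image_of_mem _ (hd z))
    rw [hz] at h1
    refine closure_mono ?_ h1
    rintro _ ⟨_, ⟨t, rfl⟩, rfl⟩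
    exact ⟨t, (hcθ t).symm⟩
  · let D : Set (affineVariety Ω v w w') := {z | z.1 ∈ stratum Ω v w w'}
    have hD : IsOpen D := isOpen_stratum Subset.rfl
    -- The part of the chart over the stratum; two nonempty open subsets of the irreducible F̃ meet,
    -- so it is not empty.
    let O : Set (affineSpace T) := c.toFun ⁻¹' (proj Ω v w w' ⁻¹' D)
    have hO : IsOpen O := (hD.preimage continuous_proj).preimage c.isOpenEmbedding.continuous
    have hOne : O.Nonempty := by
      obtain ⟨_, ⟨t, rfl⟩, ht⟩ := nonempty_preirreducible_inter c.isOpenEmbedding.isOpen_range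
        (hD.preimage continuous_proj) (range_nonempty _) (preimage_stratum_nonempty h)
      exact ⟨t, ht⟩
    refine (finrank_le_topologicalKrullDim hO hOne).trans ?_
    let g : O → proj Ω v w w' ⁻¹' D := fun t => ⟨c.toFun t.1, t.2⟩
    have hg : IsInducing g := (IsInducing.subtypeVal.of_comp_iff (f := g)).1
      (c.isOpenEmbedding.isInducing.comp IsInducing.subtypeVal)
    -- The section is a continuous left inverse of π over the stratum.
    have hp : IsInducing (restrictPreimage D (proj Ω v w w')) :=
      (Function.LeftInverse.isEmbedding (f := stratumSection) stratumSection_restrictPreimage_proj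
        (isMorphism_iff.2 morphAt_stratumSection).1 isMorphism_restrictPreimage_proj.1).isInducing
    exact (IsInducing.subtypeVal.comp (hp.comp hg)).topologicalKrullDim_le

theorem hasDim_affineVariety :
    (affineVariety Ω v w w').HasDim (dimFtilde Ω (vbar Ω v w w') w w') := by
  rw [affineVariety_vbar]
  exact hasDim_affineVariety_of_lDominant lDominant_vbar

/-! #### Dimension formulas -/

variable (Ω v w w') in
theorem dimF_eq : dimF Ω v w w' =
    ∑ α, (w (.inl α) : ℤ) * v (.inl α) + ∑ β, (w' (.inr β) : ℤ) * v (.inr β)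
      - ∑ i, (v i : ℤ) ^ 2 + ∑ β, ∑ α, ∑ _h : Ω β α, (v (.inr β) : ℤ) * v (.inl α) := by
  have h : ∀ β, ∑ h : ArrowsFrom Ω β, (v (.inl h.1) : ℤ) * v (.inr β) =
      ∑ α, ∑ _h : Ω β α, (v (.inr β) : ℤ) * v (.inl α) := fun β => by
    rw [Fintype.sum_sigma]
    simp only [mul_comm]
  simp only [dimF, Fintype.sum_sum_type, sub_mul, add_mul, Finset.sum_mul, h,
    Finset.sum_sub_distrib, Finset.sum_add_distrib, pow_two]
  ring

variable (Ω v w w') in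
theorem dimFtilde_eq : dimFtilde Ω v w w' =
    ∑ α, ((w (.inl α) : ℤ) + w' (.inl α)) * v (.inl α)
      + ∑ β, ((w (.inr β) : ℤ) + w' (.inr β)) * v (.inr β)
      - ∑ i, (v i : ℤ) ^ 2 + ∑ β, ∑ α, ∑ _h : Ω β α, (v (.inr β) : ℤ) * v (.inl α) := by
  rw [dimFtilde, dimF_eq]
  simp only [add_mul, Finset.sum_add_distrib, mul_comm (v _ : ℤ) (w _ : ℤ),
    mul_comm (v _ : ℤ) (w' _ : ℤ)]
  ring

end GradedQuiver

/-! ### The main theorem -/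

open GradedQuiver in
theorem proposition3p6 {I₀ I₁ : Type} [Fintype I₀] [Fintype I₁]
    (Ω : I₁ → I₀ → Type) [∀ β α, Fintype (Ω β α)] (v w w' : I₀ ⊕ I₁ → ℕ) :
    -- `v̄` is the largest `l`-dominant vector below `v`
    IsGreatest {u | u ≤ v ∧ LDominant Ω u w w'} (vbar Ω v w w') ∧
    -- (a)
    (affineSet Ω v w w' = affineSet Ω (vbar Ω v w w') w w' ∧
      IrreducibleSpace (affineVariety Ω v w w') ∧
      IsGreatest {u | (stratum Ω u w w').Nonempty ∧ stratum Ω u w w' ⊆ affineSet Ω v w w'}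
        (vbar Ω v w w') ∧
      IsOpen {z : affineVariety Ω v w w' | z.1 ∈ stratum Ω (vbar Ω v w w') w w'} ∧
      affineSet Ω v w w' = closure (stratum Ω (vbar Ω v w w') w w')) ∧
    -- (b)
    (NonemptyCondition Ω v w w' →
      IrreducibleSpace (nonsingularVariety Ω v w w') ∧
      (nonsingularVariety Ω v w w').IsNonsingular ∧
      IrreducibleSpace (flagVariety Ω v w w') ∧
      (flagVariety Ω v w w').IsNonsingular ∧
      Function.Surjective (proj Ω v w w') ∧
      (flagVariety Ω v w w').HasDim (dimF Ω v w w') ∧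
      dimF Ω v w w' =
        ∑ α, (w (.inl α) : ℤ) * v (.inl α) + ∑ β, (w' (.inr β) : ℤ) * v (.inr β)
          - ∑ i, (v i : ℤ) ^ 2 + ∑ β, ∑ α, ∑ _h : Ω β α, (v (.inr β) : ℤ) * v (.inl α) ∧
      (nonsingularVariety Ω v w w').HasDim (dimFtilde Ω v w w') ∧
      dimFtilde Ω v w w' =
        ∑ α, ((w (.inl α) : ℤ) + w' (.inl α)) * v (.inl α)
          + ∑ β, ((w (.inr β) : ℤ) + w' (.inr β)) * v (.inr β)
          - ∑ i, (v i : ℤ) ^ 2 + ∑ β, ∑ α, ∑ _h : Ω β α, (v (.inr β) : ℤ) * v (.inl α) ∧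
      (affineVariety Ω v w w').HasDim (dimFtilde Ω (vbar Ω v w w') w w') ∧
      (affineVariety Ω (vbar Ω v w w') w w').HasDim (dimFtilde Ω (vbar Ω v w w') w w')) ∧
    -- (c)
    (LDominant Ω v w w' →
      FunctionSpace.IsBirational (proj Ω v w w') ∧
      FunctionSpace.IsIsomorphism
        (X := (nonsingularVariety Ω v w w').sub
          (proj Ω v w w' ⁻¹' {z : affineVariety Ω v w w' | z.1 ∈ stratum Ω v w w'}))
        (Y := (affineVariety Ω v w w').sub
          {z : affineVariety Ω v w w' | z.1 ∈ stratum Ω v w w'})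
        (Set.restrictPreimage {z : affineVariety Ω v w w' | z.1 ∈ stratum Ω v w w'}
          (proj Ω v w w'))) := by
  refine ⟨isGreatest_vbar, ⟨affineSet_vbar, irreducibleSpace_affineVariety, isGreatest_stratum,
    isOpen_stratum affineSet_vbar.subset, affineSet_eq_closure⟩, fun h => ?_, fun h =>
    ⟨isBirational_proj h, isIsomorphism_restrictPreimage_proj⟩⟩
  exact ⟨irreducibleSpace_nonsingularVariety h, isNonsingular_nonsingularVariety,
    irreducibleSpace_flagVariety h, isNonsingular_flagVariety, proj_surjective h,
    hasDim_flagVariety h, dimF_eq Ω v w w', hasDim_nonsingularVariety h, dimFtilde_eq Ω v w w',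
    hasDim_affineVariety, hasDim_affineVariety_of_lDominant lDominant_vbar⟩
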